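/- Conventions. All vector spaces, algebras (unital) and tensor products are over $\mathbb C$; Sweedler notation is $\Delta(a)=a_{(1)}\otimes a_{(2)}$ for coproducts and $\delta(v)=v_{(-1)}\otimes v_{(0)}$ for left coactions. A Hopf $*$-algebra is a Hopf algebra $A$ that is a $*$-algebra and whose coproduct is a $*$-homomorphism (its antipode $S$ is then bijective). A left $A$-comodule $*$-algebra is a $*$-algebra $B$ with a left $A$-comodule structure $\delta:B\to A\otimes B$ that is a unital $*$-homomorphism. An object of the category ${}^A_B\mathcal M_B$ of relative Hopf modules is a $B$-bimodule and left $A$-comodule $\mathcal E$ with $\delta(b\,e\,c)=\delta(b)\delta(e)\delta(c)$; morphisms are the $B$-bilinear $A$-colinear maps. For $\mathcal E$ in ${}^A_B\mathcal M_B$, the conjugate space $\overline{\mathcal E}=\{\bar e: e\in\mathcal E\}$ is an object by $b\,\bar e=\overline{e\,b^*}$, $\bar e\,b=\overline{b^*e}$, $\delta(\bar e)=e_{(-1)}^*\otimes\overline{e_{(0)}}$. If $\mathcal E$ is finitely generated as a left $B$-module and $\mathcal F$ is another object, the space ${}_B\mathrm{Hom}(\mathcal E,\mathcal F)$ of left $B$-linear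 maps is an object by $(b\cdot f)(e)=f(eb)$, $(f\cdot b)(e)=f(e)b$ and the coaction determined by $f_{(-1)}\otimes f_{(0)}(e)=S(e_{(-1)})\,[f(e_{(0)})]_{(-1)}\otimes[f(e_{(0)})]_{(0)}$. If $\mathcal E$ is moreover projective as a left $B$-module, an $A$-covariant Hermitian metric on $\mathcal E$ is an isomorphism $\mathfrak H:\overline{\mathcal E}\to{}_B\mathrm{Hom}(\mathcal E,B)$ in ${}^A_B\mathcal M_B$ such that $\langle y,\bar x\rangle^*=\langle x,\bar y\rangle$ for all $x,y\in\mathcal E$, where $\langle x,\bar y\rangle:=\mathfrak H(\bar y)(x)$. A (unital) $2$-cocycle on $A$ is a convolution invertible linear map $\gamma:A\otimes A\to\mathbb C$, with convolution inverse $\bar\gamma$, such that $\gamma(g_{(1)}\otimes h_{(1)})\gamma(g_{(2)}h_{(2)}\otimes k)=\gamma(h_{(1)}\otimes k_{(1)})\gamma(g\otimes h_{(2)}k_{(2)})$ and $\gamma(h\otimes1)=\epsilon(h)=\gamma(1\otimes h)$. It is unitary if $\overline{\gamma(a\otimes b)}=\bar\gamma(S(a)^*\otimes S(b)^*)$. Put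 $U(k)=\gamma(k_{(1)}\otimes S(k_{(2)}))$, $\bar U(k)=\bar\gamma(S(k_{(1)})\otimes k_{(2)})$, $V=U\circ S^{-1}$, $\bar V=\bar U\circ S^{-1}$. The deformed objects have the same underlying vector spaces: * $A_\gamma$ has the coproduct, counit and unit of $A$, the product $h\cdot_\gamma k=\gamma(h_{(1)}\otimes k_{(1)})\,h_{(2)}k_{(2)}\,\bar\gamma(h_{(3)}\otimes k_{(3)})$, the antipode $S_\gamma(h)=U(h_{(1)})S(h_{(2)})\bar U(h_{(3)})$ and the star $h^{*_\gamma}=\bar V(h_{(1)}^*)\,h_{(2)}^*\,V(h_{(3)}^*)$; * $B_\gamma$ has the coaction and unit of $B$, the product $a\cdot_\gamma b=\gamma(a_{(-1)}\otimes b_{(-1)})\,a_{(0)}b_{(0)}$ and the star $b^{*_\gamma}=\bar V(b_{(-1)}^*)\,b_{(0)}^*$; * $\Gamma(\mathcal E)$ has the coaction of $\mathcal E$ and the actions $b\cdot_\gamma e=\gamma(b_{(-1)}\otimes e_{(-1)})\,b_{(0)}e_{(0)}$, $e\cdot_\gamma b=\gamma(e_{(-1)}\otimes b_{(-1)})\,e_{(0)}b_{(0)}$.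 Theorem. Let $A$ be a Hopf $*$-algebra, $B$ a left $A$-comodule $*$-algebra, $\mathcal E$ an object of ${}^A_B\mathcal M_B$ which is finitely generated and projective as a left $B$-module, $\mathfrak H$ an $A$-covariant Hermitian metric on $\mathcal E$, and $\gamma$ a unitary $2$-cocycle on $A$. Then $A_\gamma$ is a Hopf $*$-algebra, $B_\gamma$ is a left $A_\gamma$-comodule $*$-algebra, $\Gamma(\mathcal E)$ is an object of ${}^{A_\gamma}_{B_\gamma}\mathcal M_{B_\gamma}$ which is finitely generated and projective as a left $B_\gamma$-module, and the map $$\mathfrak H_\gamma=\mathfrak S\circ\Gamma(\mathfrak H)\circ\mathfrak N_{\mathcal E}:\ \overline{\Gamma(\mathcal E)}\to{}_{B_\gamma}\mathrm{Hom}(\Gamma(\mathcal E),B_\gamma)$$ is an $A_\gamma$-covariant Hermitian metric on $\Gamma(\mathcal E)$, where $\Gamma(\mathfrak H)$ is $\mathfrak H$ as a linear map, $\mathfrak N_{\mathcal E}:\overline{\Gamma(\mathcal E)}\to\Gamma(\overline{\mathcal E})$ is $\mathfrak N_{\mathcal E}(\bar e)=\bar V(e_{(-1)}^*)\,\overline{e_{(0)}}$,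 and $\mathfrak S:\Gamma({}_B\mathrm{Hom}(\mathcal E,B))\to{}_{B_\gamma}\mathrm{Hom}(\Gamma(\mathcal E),B_\gamma)$ is $\mathfrak S(f)(v)=\gamma\big(v_{(-2)}\otimes S(v_{(-1)})\,[f(v_{(0)})]_{(-1)}\big)\,[f(v_{(0)})]_{(0)}$. -/

import Mathlib

open scoped TensorProduct ComplexConjugate
open Coalgebra WithConv MulOpposite

universe u v w x

noncomputable section

namespace RelHopf

/-! ### Hopf `*`-algebras and their comodules -/

/-- `A` is a Hopf `*`-algebra: it is a Hopf algebra and a `*`-algebra over `ℂ`, and the coproduct is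
a `*`-homomorphism (for the componentwise star on `A ⊗ A`). -/
class HopfStarAlgebra (A : Type u) [Ring A] [HopfAlgebra ℂ A] [StarRing A] [StarModule ℂ A] :
    Prop where
  comul_star : ∀ a : A, comul (R := ℂ) (star a) = star (comul (R := ℂ) a)

/-- A linear map `V → A ⊗ V`. -/
class LeftCoaction (A : Type u) (V : Type v) [AddCommGroup A] [Module ℂ A] [AddCommGroup V]
    [Module ℂ V] where
  coaction : V →ₗ[ℂ] A ⊗[ℂ] V

/-- The coaction `δ : V → A ⊗ V`, written `v ↦ v₍₋₁₎ ⊗ v₍₀₎` in the comments below. -/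
def coact (A : Type u) {V : Type v} [AddCommGroup A] [Module ℂ A] [AddCommGroup V]
    [Module ℂ V] [LeftCoaction A V] : V →ₗ[ℂ] A ⊗[ℂ] V :=
  LeftCoaction.coaction

/-- The coaction makes `V` a left `A`-comodule. -/
class LeftComodule (A : Type u) (V : Type v) [Ring A] [HopfAlgebra ℂ A] [AddCommGroup V]
    [Module ℂ V] [LeftCoaction A V] : Prop where
  coassoc : ∀ v : V, TensorProduct.assoc ℂ A A V ((comul (R := ℂ)).rTensor V (coact A v)) =
    (coact A).lTensor A (coact A v)
  counit : ∀ v : V, TensorProduct.lid ℂ V ((counit (R := ℂ)).rTensor V (coact A v)) = v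

/-- `B` is a left `A`-comodule `*`-algebra: a left `A`-comodule and a `*`-algebra over `ℂ` whose
coaction `B → A ⊗ B` is a unital `*`-homomorphism. -/
class ComoduleStarAlgebra (A : Type u) (B : Type v) [Ring A] [HopfAlgebra ℂ A] [StarRing A]
    [StarModule ℂ A] [Ring B] [Algebra ℂ B] [StarRing B] [StarModule ℂ B] [LeftCoaction A B] :
    Prop extends LeftComodule A B where
  coact_one : coact A (1 : B) = 1
  coact_mul : ∀ b c : B, coact A (b * c) = coact A b * coact A c
  coact_star : ∀ b : B, coact A (star b) = star (coact A b)

section Actions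

variable (B : Type v) (E : Type w) [Ring B] [Algebra ℂ B] [AddCommGroup E] [Module ℂ E]

/-- The left action as a bilinear map, `b, e ↦ b e`. -/
def leftAct [Module B E] [IsScalarTower ℂ B E] : B →ₗ[ℂ] E →ₗ[ℂ] E :=
  (Algebra.lsmul ℂ ℂ E : B →ₐ[ℂ] Module.End ℂ E).toLinearMap

/-- The right action as a bilinear map, `e, b ↦ e b`. -/
def rightAct [Module Bᵐᵒᵖ E] [IsScalarTower ℂ Bᵐᵒᵖ E] : E →ₗ[ℂ] B →ₗ[ℂ] E :=
  ((Algebra.lsmul ℂ ℂ E : Bᵐᵒᵖ →ₐ[ℂ] Module.End ℂ E).toLinearMap ∘ₗ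
    (opLinearEquiv ℂ : B ≃ₗ[ℂ] Bᵐᵒᵖ).toLinearMap).flip

@[simp] lemma leftAct_apply [Module B E] [IsScalarTower ℂ B E] (b : B) (e : E) :
    leftAct B E b e = b • e := rfl

@[simp] lemma rightAct_apply [Module Bᵐᵒᵖ E] [IsScalarTower ℂ Bᵐᵒᵖ E] (b : B) (e : E) :
    rightAct B E e b = op b • e := rfl

end Actions

/-- `E` is an object of the category of relative Hopf modules: a `B`-bimodule and a left
`A`-comodule with `δ(b e) = δ(b) δ(e)` and `δ(e b) = δ(e) δ(b)`. The right action of `b` on `e` is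
`op b • e`. -/
class RelHopfModule (A : Type u) (B : Type v) (E : Type w) [Ring A] [HopfAlgebra ℂ A] [Ring B]
    [Algebra ℂ B] [LeftCoaction A B] [AddCommGroup E] [Module ℂ E] [Module B E] [Module Bᵐᵒᵖ E]
    [SMulCommClass B Bᵐᵒᵖ E] [IsScalarTower ℂ B E] [IsScalarTower ℂ Bᵐᵒᵖ E] [LeftCoaction A E] :
    Prop extends LeftComodule A E where
  coact_smul : ∀ (b : B) (e : E), coact A (b • e) =
    TensorProduct.map₂ (LinearMap.mul ℂ A) (leftAct B E) (coact A b) (coact A e)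
  coact_op_smul : ∀ (b : B) (e : E), coact A (op b • e) =
    TensorProduct.map₂ (LinearMap.mul ℂ A) (rightAct B E) (coact A e) (coact A b)

/-- The algebra `B` is itself a relative Hopf module. -/
instance {A : Type u} {B : Type v} [Ring A] [HopfAlgebra ℂ A] [StarRing A]
    [StarModule ℂ A] [Ring B] [Algebra ℂ B] [StarRing B] [StarModule ℂ B] [LeftCoaction A B]
    [ComoduleStarAlgebra A B] : RelHopfModule A B B where
  coassoc := LeftComodule.coassoc
  counit := LeftComodule.counit
  coact_smul b e := by
    rw [smul_eq_mul, ComoduleStarAlgebra.coact_mul]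
    generalize coact A b = s
    generalize coact A e = t
    induction s with
    | zero => simp
    | add s s' hs hs' => simp [add_mul, hs, hs']
    | tmul a b =>
      induction t with
      | zero => simp
      | add s s' hs hs' => simp [mul_add, hs, hs']
      | tmul a b => simp
  coact_op_smul b e := by
    rw [op_smul_eq_mul, ComoduleStarAlgebra.coact_mul]
    generalize coact A b = s
    generalize coact A e = t
    induction s with
    | zero => simp
    | add s s' hs hs' => simp [mul_add, hs, hs']
    | tmul a b =>
      induction t with
      | zero => simp
      | add s s' hs hs' => simp [add_mul, hs, hs']
      | tmul a b => simp

/-! ### The conjugate module -/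

/-- The conjugate `Ē` of a vector space `E`. -/
def Bar (E : Type w) : Type w := E

namespace Bar

variable {A : Type u} {B : Type v} {E : Type w} [AddCommGroup E]

instance : AddCommGroup (Bar E) := inferInstanceAs (AddCommGroup E)

/-- `e ↦ ē`. -/
def mk : E ≃+ Bar E := AddEquiv.refl E

/-- `ē ↦ e`. -/
def out : Bar E ≃+ E := mk.symm

@[simp] lemma out_mk (e : E) : out (mk e) = e := rfl
@[simp] lemma mk_out (e : Bar E) : mk (out e) = e := rfl

/-- `c ē` is the conjugate of `c̄ e`. -/
instance [Module ℂ E] : Module ℂ (Bar E) where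
  smul c e := mk (conj c • out e)
  one_smul e := by change mk (conj (1 : ℂ) • out e) = e; simp
  mul_smul c d e := by
    change mk (conj (c * d) • out e) = mk (conj c • out (mk (conj d • out e)))
    simp [mul_smul]
  smul_zero c := by change mk (conj c • out (0 : Bar E)) = 0; simp
  smul_add c e f := by
    change mk (conj c • out (e + f)) = mk (conj c • out e) + mk (conj c • out f)
    simp
  add_smul c d e := by
    change mk (conj (c + d) • out e) = mk (conj c • out e) + mk (conj d • out e)
    simp [add_smul]
  zero_smul e := by change mk (conj (0 : ℂ) • out e) = 0; simp

lemma smul_mk [Module ℂ E] (c : ℂ) (e : E) : c • mk e = mk (conj c • e) := rfl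

variable [Ring B] [StarRing B]

/-- `b ē` is the conjugate of `e b*`. -/
instance [Module Bᵐᵒᵖ E] : Module B (Bar E) where
  smul b e := mk (op (star b) • out e)
  one_smul e := by change mk (op (star (1 : B)) • out e) = e; simp
  mul_smul c d e := by
    change mk (op (star (c * d)) • out e) = mk (op (star c) • out (mk (op (star d) • out e)))
    simp [mul_smul]
  smul_zero c := by change mk (op (star c) • out (0 : Bar E)) = 0; simp
  smul_add c e f := by
    change mk (op (star c) • out (e + f)) = mk (op (star c) • out e) + mk (op (star c) • out f)
    simp
  add_smul c d e := by
    change mk (op (star (c + d)) • out e) = mk (op (star c) • out e) + mk (op (star d) • out e)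
    simp [add_smul]
  zero_smul e := by change mk (op (star (0 : B)) • out e) = 0; simp

lemma smul_mk' [Module Bᵐᵒᵖ E] (b : B) (e : E) : b • mk e = mk (op (star b) • e) := rfl

/-- `ē b` is the conjugate of `b* e`. -/
instance [Module B E] : Module Bᵐᵒᵖ (Bar E) where
  smul b e := mk (star (unop b) • out e)
  one_smul e := by change mk (star (unop (1 : Bᵐᵒᵖ)) • out e) = e; simp
  mul_smul c d e := by
    change mk (star (unop (c * d)) • out e) = mk (star (unop c) • out (mk (star (unop d) • out e)))
    simp [mul_smul]
  smul_zero c := by change mk (star (unop c) • out (0 : Bar E)) = 0; simp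
  smul_add c e f := by
    change mk (star (unop c) • out (e + f)) = mk (star (unop c) • out e) + mk (star (unop c) • out f)
    simp
  add_smul c d e := by
    change mk (star (unop (c + d)) • out e) = mk (star (unop c) • out e) + mk (star (unop d) • out e)
    simp [add_smul]
  zero_smul e := by change mk (star (unop (0 : Bᵐᵒᵖ)) • out e) = 0; simp

lemma op_smul_mk [Module B E] (b : B) (e : E) : op b • mk e = mk (star b • e) := rfl

/-- `e ↦ ē` as a conjugate-linear map. -/
def mkₛₗ [Module ℂ E] : E →ₛₗ[starRingEnd ℂ] Bar E where
  toFun := mk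
  map_add' := map_add mk
  map_smul' c e := by simp [smul_mk]

/-- `δ(ē) = e₍₋₁₎* ⊗ ē₍₀₎`. -/
instance [Ring A] [Algebra ℂ A] [StarRing A] [StarModule ℂ A] [Module ℂ E] [LeftCoaction A E] :
    LeftCoaction A (Bar E) where
  coaction :=
    { toFun := fun e => TensorProduct.map
        (starLinearEquiv ℂ (A := A) : A →ₛₗ[starRingEnd ℂ] A) mkₛₗ (coact A (out e))
      map_add' := by simp
      map_smul' := fun c e => by
        obtain ⟨e, rfl⟩ := mk.surjective e
        simp [smul_mk] }

end Bar


/-! ### The module of left `B`-linear maps -/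

section Hom

variable {A : Type u} {B : Type v} {E : Type w} {F : Type x} [Ring A] [HopfAlgebra ℂ A]
  [Ring B] [Algebra ℂ B]
  [AddCommGroup E] [Module ℂ E] [Module B E] [Module Bᵐᵒᵖ E] [SMulCommClass B Bᵐᵒᵖ E]
  [IsScalarTower ℂ B E] [IsScalarTower ℂ Bᵐᵒᵖ E]
  [AddCommGroup F] [Module ℂ F] [Module B F] [Module Bᵐᵒᵖ F] [SMulCommClass B Bᵐᵒᵖ F]
  [IsScalarTower ℂ B F] [IsScalarTower ℂ Bᵐᵒᵖ F]

/-- The left action of `B` on left `B`-linear maps, `(b · f)(e) = f(e b)`. -/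
def homSMul (b : B) (f : E →ₗ[B] F) : E →ₗ[B] F where
  toFun e := f (op b • e)
  map_add' := by simp
  map_smul' c e := by simp [← smul_comm c (op b) e]

/-- The right action of `B` on left `B`-linear maps, `(f · b)(e) = f(e) b`. -/
def homOpSMul (f : E →ₗ[B] F) (b : B) : E →ₗ[B] F where
  toFun e := op b • f e
  map_add' := by simp
  map_smul' c e := by simp [← smul_comm c (op b) (f e)]

/-- Evaluation of `t = ∑ aᵢ ⊗ fᵢ` at `e`, that is `∑ aᵢ ⊗ fᵢ(e)`. -/
def evalHom (t : A ⊗[ℂ] (E →ₗ[B] F)) (e : E) : A ⊗[ℂ] F :=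
  (LinearMap.applyₗ' ℂ e).lTensor A t

variable [LeftCoaction A B] [LeftCoaction A E] [LeftCoaction A F]

/-- `e ↦ S(e₍₋₁₎) f(e₍₀₎)₍₋₁₎ ⊗ f(e₍₀₎)₍₀₎`. -/
def homCoactAt (A : Type u) [Ring A] [HopfAlgebra ℂ A] [LeftCoaction A E] [LeftCoaction A F]
    (f : E →ₗ[B] F) : E →ₗ[ℂ] A ⊗[ℂ] F :=
  (LinearMap.mul' ℂ A).rTensor F ∘ₗ (TensorProduct.assoc ℂ A A F).symm.toLinearMap ∘ₗ
    TensorProduct.map (HopfAlgebra.antipode ℂ) (coact A ∘ₗ f.restrictScalars ℂ) ∘ₗ coact A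

lemma antipode_mul_coact {V : Type x} [AddCommGroup V] [Module ℂ V] [LeftCoaction A V]
    [LeftComodule A V] (v : V) :
    (LinearMap.mul' ℂ A).rTensor V ((TensorProduct.assoc ℂ A A V).symm
      (TensorProduct.map (HopfAlgebra.antipode ℂ) (coact A) (coact A v))) = 1 ⊗ₜ v := by
  have h1 : TensorProduct.map (HopfAlgebra.antipode ℂ) (coact A) (coact A v) =
      (HopfAlgebra.antipode ℂ).rTensor _ ((coact A).lTensor A (coact A v)) := by
    rw [← LinearMap.rTensor_comp_lTensor, LinearMap.comp_apply]
  rw [h1, ← LeftComodule.coassoc]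
  have h2 : ∀ t : A ⊗[ℂ] V, (LinearMap.mul' ℂ A).rTensor V ((TensorProduct.assoc ℂ A A V).symm
      ((HopfAlgebra.antipode ℂ).rTensor _ (TensorProduct.assoc ℂ A A V
        ((comul (R := ℂ)).rTensor V t)))) =
      1 ⊗ₜ TensorProduct.lid ℂ V ((counit (R := ℂ)).rTensor V t) := by
    intro t
    induction t with
    | zero => simp
    | add s t hs ht => simp [hs, ht, TensorProduct.tmul_add]
    | tmul a v =>
      have h3 : ∀ z : A ⊗[ℂ] A, (LinearMap.mul' ℂ A).rTensor V ((TensorProduct.assoc ℂ A A V).symm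
          ((HopfAlgebra.antipode ℂ).rTensor _ (TensorProduct.assoc ℂ A A V (z ⊗ₜ v)))) =
          (LinearMap.mul' ℂ A ((HopfAlgebra.antipode ℂ).rTensor A z)) ⊗ₜ v := by
        intro z
        induction z with
        | zero => simp
        | add s t hs ht => simp [hs, ht, TensorProduct.add_tmul]
        | tmul a b => simp
      simp [h3, Algebra.algebraMap_eq_smul_one, TensorProduct.smul_tmul]
  rw [h2, LeftComodule.counit]

lemma homCoactAt_smul [LeftComodule A B] [RelHopfModule A B E] [RelHopfModule A B F]
    (f : E →ₗ[B] F) (b : B) (e : E) :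
    homCoactAt A f (b • e) = (leftAct B F b).lTensor A (homCoactAt A f e) := by
  -- `P z e = S(a) z` for `z` in `A ⊗ F`
  let P : A →ₗ[ℂ] A ⊗[ℂ] F →ₗ[ℂ] A ⊗[ℂ] F :=
    LinearMap.compr₂ (TensorProduct.mk ℂ A (A ⊗[ℂ] F) ∘ₗ HopfAlgebra.antipode ℂ)
      ((LinearMap.mul' ℂ A).rTensor F ∘ₗ (TensorProduct.assoc ℂ A A F).symm.toLinearMap)
  have hP : ∀ a c y, P a (c ⊗ₜ y) = (HopfAlgebra.antipode ℂ a * c) ⊗ₜ y := fun a c y => by simp [P]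
  have hD : ∀ g : E →ₗ[B] F, ∀ e, homCoactAt A g e =
      TensorProduct.lift (P.compl₂ (coact A ∘ₗ g.restrictScalars ℂ)) (coact A e) := by
    intro g e
    simp only [homCoactAt, LinearMap.comp_apply]
    generalize coact A e = t
    induction t with
    | zero => simp
    | add s t hs ht => simp only [map_add, hs, ht]
    | tmul a e => simp [P]
  have hM : ∀ (s : A ⊗[ℂ] B) (z : A ⊗[ℂ] F) (a : A),
      P a (TensorProduct.map₂ (LinearMap.mul ℂ A) (leftAct B F) s z) =
      TensorProduct.map₂ (LinearMap.mul ℂ A) (leftAct B F)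
        ((LinearMap.mulLeft ℂ (HopfAlgebra.antipode ℂ a)).rTensor B s) z := by
    intro s z a
    induction s with
    | zero => simp
    | add s t hs ht => simp only [map_add, hs, ht, LinearMap.add_apply]
    | tmul c b =>
      induction z with
      | zero => simp
      | add s t hs ht => simp only [map_add, hs, ht]
      | tmul d y => simp [hP, mul_assoc]
  have hK : ∀ (b : B) (z : A ⊗[ℂ] F), TensorProduct.map₂ (LinearMap.mul ℂ A) (leftAct B F)
      ((LinearMap.mul' ℂ A).rTensor B ((TensorProduct.assoc ℂ A A B).symm
      (TensorProduct.map (HopfAlgebra.antipode ℂ) (coact A) (coact A b)))) z =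
      (leftAct B F b).lTensor A z := by
    intro b z
    rw [antipode_mul_coact]
    induction z with
    | zero => simp
    | add s t hs ht => simp only [map_add, hs, ht]
    | tmul d y => simp
  rw [hD, hD, RelHopfModule.coact_smul]
  generalize coact A e = t
  induction t with
  | zero => simp
  | add s t hs ht => simp only [map_add, hs, ht]
  | tmul a e =>
    simp only [TensorProduct.lift.tmul, LinearMap.compl₂_apply, LinearMap.comp_apply]
    have h4 : ∀ s : A ⊗[ℂ] B, TensorProduct.lift (P.compl₂ (coact A ∘ₗ f.restrictScalars ℂ))
        (TensorProduct.map₂ (LinearMap.mul ℂ A) (leftAct B E) s (a ⊗ₜ e)) =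
        P a (TensorProduct.map₂ (LinearMap.mul ℂ A) (leftAct B F)
          ((LinearMap.mul' ℂ A).rTensor B ((TensorProduct.assoc ℂ A A B).symm
          (TensorProduct.map (HopfAlgebra.antipode ℂ) (coact A) s))) (coact A (f e))) := by
      intro s
      induction s with
      | zero => simp
      | add s t hs ht => simp only [map_add, hs, ht, LinearMap.add_apply]
      | tmul c b =>
        simp only [TensorProduct.map₂_apply_tmul, TensorProduct.lift.tmul, leftAct_apply,
          LinearMap.compl₂_apply, LinearMap.comp_apply, LinearMap.restrictScalars_apply, map_smul,
          RelHopfModule.coact_smul, TensorProduct.map_tmul, hM]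
        congr 2
        generalize coact A b = s
        induction s with
        | zero => simp
        | add s t hs ht => simp only [map_add, TensorProduct.tmul_add, hs, ht]
        | tmul d y => simp [HopfAlgebra.antipode_mul_antidistrib]
    rw [h4, hK]
    have h5 : ∀ z : A ⊗[ℂ] F, P a ((leftAct B F b).lTensor A z) =
        (leftAct B F b).lTensor A (P a z) := by
      intro z
      induction z with
      | zero => simp
      | add s t hs ht => simp only [map_add, hs, ht]
      | tmul d y => simp [hP]
    rw [h5]
    rfl

/-- If `E` is finitely generated over `B`, there is exactly one element `f₍₋₁₎ ⊗ f₍₀₎` of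
`A ⊗ Hom(E, F)` with `f₍₋₁₎ ⊗ f₍₀₎(e) = S(e₍₋₁₎) f(e₍₀₎)₍₋₁₎ ⊗ f(e₍₀₎)₍₀₎` for all `e`. -/
theorem existsUnique_homCoact [LeftComodule A B] [RelHopfModule A B E] [RelHopfModule A B F]
    [Module.Finite B E] (f : E →ₗ[B] F) :
    ∃! t : A ⊗[ℂ] (E →ₗ[B] F), ∀ e, evalHom t e = homCoactAt A f e := by
  classical
  let 𝓑 := Module.Basis.ofVectorSpace ℂ A
  let φ := fun i => (TensorProduct.lid ℂ F).toLinearMap ∘ₗ (𝓑.coord i).rTensor F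
  have hφ : ∀ i (b : B) z, φ i ((leftAct B F b).lTensor A z) = b • φ i z := by
    intro i b z
    induction z with
    | zero => simp
    | add s t hs ht => simp only [map_add, hs, ht, smul_add]
    | tmul d y =>
      simp only [φ, LinearMap.comp_apply, LinearMap.lTensor_tmul, LinearMap.rTensor_tmul,
        leftAct_apply, LinearEquiv.coe_coe, TensorProduct.lid_tmul]
      exact smul_comm _ _ _
  let g : _ → E →ₗ[B] F := fun i =>
    { toFun := fun e => φ i (homCoactAt A f e)
      map_add' := by simp
      map_smul' := fun b e => by simp only [homCoactAt_smul, hφ, RingHom.id_apply] }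
  have hφe : ∀ z : A ⊗[ℂ] F, z = (TensorProduct.equivFinsuppOfBasisLeft 𝓑).symm
      (TensorProduct.equivFinsuppOfBasisLeft 𝓑 z) := fun z => by simp
  obtain ⟨S, hS⟩ := (inferInstance : Module.Finite B E)
  let T := S.biUnion fun e => (TensorProduct.equivFinsuppOfBasisLeft 𝓑 (homCoactAt A f e)).support
  have hT : ∀ i, i ∉ T → g i = 0 := by
    intro i hi
    refine LinearMap.ext_on hS fun e he => ?_
    simp only [T, Finset.mem_biUnion, not_exists, not_and, Finsupp.mem_support_iff, not_not] at hi
    have := hi e he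
    rw [TensorProduct.equivFinsuppOfBasisLeft_apply] at this
    exact this
  refine ⟨∑ i ∈ T, 𝓑 i ⊗ₜ g i, fun e => ?_, fun t ht => ?_⟩
  · rw [hφe (homCoactAt A f e), TensorProduct.equivFinsuppOfBasisLeft_symm_apply,
      Finsupp.sum_of_support_subset (s := T)]
    · simp [evalHom, map_sum, g, φ, TensorProduct.equivFinsuppOfBasisLeft_apply]
    · intro i hi
      by_contra h
      have := congr($(hT i h) e)
      rw [Finsupp.mem_support_iff, TensorProduct.equivFinsuppOfBasisLeft_apply] at hi
      exact hi this
    · simp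
  · have h0 : ∀ (s : A ⊗[ℂ] (E →ₗ[B] F)) i e,
        (TensorProduct.equivFinsuppOfBasisLeft 𝓑 s i) e = φ i (evalHom s e) := by
      intro s i e
      rw [TensorProduct.equivFinsuppOfBasisLeft_apply]
      induction s with
      | zero => simp [evalHom]
      | add s t hs ht =>
        simp only [evalHom, map_add, LinearMap.add_apply] at hs ht ⊢
        rw [hs, ht]
      | tmul a g => simp [evalHom, φ]
    apply (TensorProduct.equivFinsuppOfBasisLeft 𝓑).injective
    ext i e
    rw [h0, ht, map_sum, Finset.sum_apply']
    simp only [TensorProduct.equivFinsuppOfBasisLeft_apply_tmul_apply, Module.Basis.repr_self]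
    by_cases hi : i ∈ T
    · rw [Finset.sum_eq_single i]
      · simp [g]
      · intro j _ hj
        simp [hj]
      · simp [hi]
    · rw [Finset.sum_eq_zero]
      · exact congr($(hT i hi) e)
      · intro j hj
        have : j ≠ i := fun h => hi (h ▸ hj)
        simp [this]

/-- The coaction `f ↦ f₍₋₁₎ ⊗ f₍₀₎` on `Hom(E, F)`, for `E` finitely generated over `B`. -/
def homCoact (A : Type u) [Ring A] [HopfAlgebra ℂ A] [LeftCoaction A B] [LeftCoaction A E]
    [LeftCoaction A F] [LeftComodule A B] [RelHopfModule A B E] [RelHopfModule A B F]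
    [Module.Finite B E] (f : E →ₗ[B] F) : A ⊗[ℂ] (E →ₗ[B] F) :=
  (existsUnique_homCoact f).choose

lemma evalHom_homCoact [LeftComodule A B] [RelHopfModule A B E] [RelHopfModule A B F]
    [Module.Finite B E] (f : E →ₗ[B] F) (e : E) :
    evalHom (homCoact A f) e = homCoactAt A f e :=
  (existsUnique_homCoact f).choose_spec.1 e

end Hom


/-! ### Hermitian metrics -/

/-- An `A`-covariant Hermitian metric on a relative Hopf module `E` which is finitely generated and
projective as a left `B`-module: an isomorphism `Ē → Hom(E, B)` of relative Hopf modules such that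
`⟨y, x̄⟩* = ⟨x, ȳ⟩`, where `⟨x, ȳ⟩` is the value at `x` of the image of `ȳ`. -/
structure HermitianMetric (A : Type u) (B : Type v) (E : Type w) [Ring A] [HopfAlgebra ℂ A]
    [StarRing A] [StarModule ℂ A] [HopfStarAlgebra A]
    [Ring B] [Algebra ℂ B] [StarRing B] [StarModule ℂ B] [LeftCoaction A B]
    [ComoduleStarAlgebra A B]
    [AddCommGroup E] [Module ℂ E] [Module B E] [Module Bᵐᵒᵖ E] [SMulCommClass B Bᵐᵒᵖ E]
    [IsScalarTower ℂ B E] [IsScalarTower ℂ Bᵐᵒᵖ E] [LeftCoaction A E] [RelHopfModule A B E]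
    [Module.Finite B E] [Module.Projective B E] where
  /-- the linear isomorphism `Ē → Hom(E, B)` -/
  iso : Bar E ≃ₗ[ℂ] (E →ₗ[B] B)
  map_smul : ∀ (b : B) (z : Bar E), iso (b • z) = homSMul b (iso z)
  map_op_smul : ∀ (b : B) (z : Bar E), iso (op b • z) = homOpSMul (iso z) b
  covariant : ∀ z : Bar E, homCoact A (iso z) = iso.toLinearMap.lTensor A (coact A z)
  star_inner : ∀ x y : E, star (iso (Bar.mk x) y) = iso (Bar.mk y) x

/-! ### The inverse of the antipode -/

section AntipodeInv

variable {A : Type u} [Ring A] [HopfAlgebra ℂ A] [StarRing A] [StarModule ℂ A]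

/-- `a ↦ S(a*)*`. In a Hopf `*`-algebra this is the inverse of the antipode. -/
def antipodeInv (A : Type u) [Ring A] [HopfAlgebra ℂ A] [StarRing A] [StarModule ℂ A] :
    A →ₗ[ℂ] A where
  toFun a := star (HopfAlgebra.antipode ℂ (star a))
  map_add' := by simp
  map_smul' := by simp

lemma counit_star [HopfStarAlgebra A] (a : A) :
    counit (R := ℂ) (star a) = conj (counit (R := ℂ) a) := by
  -- `a ↦ conj ε(a*)` is a left counit as well
  let ε' : A →ₗ[ℂ] ℂ :=
    { toFun := fun a => conj (counit (R := ℂ) (star a))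
      map_add' := by simp
      map_smul' := by simp }
  have h1 : ∀ t : A ⊗[ℂ] A, TensorProduct.lid ℂ A (ε'.rTensor A t) =
      star (TensorProduct.lid ℂ A ((counit (R := ℂ)).rTensor A (star t))) := by
    intro t
    induction t with
    | zero => simp
    | add s t hs ht => simp only [map_add, star_add, hs, ht]
    | tmul a b => simp [ε']
  have h2 : ∀ t : A ⊗[ℂ] A, counit (R := ℂ) (TensorProduct.lid ℂ A (ε'.rTensor A t)) =
      ε' (TensorProduct.rid ℂ A ((counit (R := ℂ)).lTensor A t)) := by
    intro t
    induction t with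
    | zero => simp
    | add s t hs ht => simp only [map_add, hs, ht]
    | tmul a b => simp [mul_comm]
  have h3 := h2 (comul (R := ℂ) a)
  rw [h1, ← HopfStarAlgebra.comul_star] at h3
  simp only [rTensor_counit_comul, lTensor_counit_comul, TensorProduct.lid_tmul,
    TensorProduct.rid_tmul, one_smul, star_star] at h3
  simp [h3, ε']

lemma antipode_antipodeInv [HopfStarAlgebra A] (a : A) :
    HopfAlgebra.antipode ℂ (antipodeInv A a) = a := by
  -- `T(a₂) a₁ = ε(a)` for `T(a) = S(a*)*`
  have h1 : ∀ t : A ⊗[ℂ] A, LinearMap.mul' ℂ A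
      ((antipodeInv A).rTensor A (TensorProduct.comm ℂ A A t)) =
      star (LinearMap.mul' ℂ A ((HopfAlgebra.antipode ℂ).lTensor A (star t))) := by
    intro t
    induction t with
    | zero => simp
    | add s t hs ht => simp only [map_add, star_add, hs, ht]
    | tmul a b => simp [antipodeInv]
  have h2 : ∀ a : A, LinearMap.mul' ℂ A
      ((antipodeInv A).rTensor A (TensorProduct.comm ℂ A A (comul (R := ℂ) a))) =
      algebraMap ℂ A (counit (R := ℂ) a) := by
    intro a
    rw [h1, ← HopfStarAlgebra.comul_star, HopfAlgebra.mul_antipode_lTensor_comul_apply,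
      counit_star, Algebra.algebraMap_eq_smul_one, Algebra.algebraMap_eq_smul_one]
    simp
  have h3 : ∀ t : A ⊗[ℂ] A, LinearMap.mul' ℂ A (TensorProduct.map (HopfAlgebra.antipode ℂ)
      (HopfAlgebra.antipode ℂ ∘ₗ antipodeInv A) t) = HopfAlgebra.antipode ℂ (LinearMap.mul' ℂ A
      ((antipodeInv A).rTensor A (TensorProduct.comm ℂ A A t))) := by
    intro t
    induction t with
    | zero => simp
    | add s t hs ht => simp only [map_add, hs, ht]
    | tmul a b => simp [HopfAlgebra.antipode_mul_antidistrib]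
  have h4 : toConv (HopfAlgebra.antipode ℂ (A := A)) *
      toConv (HopfAlgebra.antipode ℂ ∘ₗ antipodeInv A) = 1 := by
    ext a
    simp only [LinearMap.convMul_apply, h3, h2, LinearMap.convOne_apply]
    rw [Algebra.algebraMap_eq_smul_one]
    simp
  have h5 := left_inv_eq_right_inv LinearMap.id_mul_antipode h4
  exact congr($h5 a).symm

lemma antipodeInv_antipode [HopfStarAlgebra A] (a : A) :
    antipodeInv A (HopfAlgebra.antipode ℂ a) = a := by
  have h := antipode_antipodeInv (star a)
  simp only [antipodeInv, LinearMap.coe_mk, AddHom.coe_mk, star_star] at h ⊢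
  rw [h, star_star]

end AntipodeInv

/-! ### Cocycles -/

/-- A unital `2`-cocycle `γ : A ⊗ A → ℂ`, with its convolution inverse `γ.inv`. -/
structure TwoCocycle (A : Type u) [Ring A] [HopfAlgebra ℂ A] where
  /-- the functional `γ` -/
  val : A ⊗[ℂ] A →ₗ[ℂ] ℂ
  /-- the convolution inverse of `γ` -/
  inv : A ⊗[ℂ] A →ₗ[ℂ] ℂ
  val_inv : toConv val * toConv inv = 1
  inv_val : toConv inv * toConv val = 1
  /-- `γ(g₁ ⊗ h₁) γ(g₂ h₂ ⊗ k) = γ(h₁ ⊗ k₁) γ(g ⊗ h₂ k₂)` -/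
  cocycle : ∀ g h k : A,
    (toConv val * toConv (val ∘ₗ (TensorProduct.mk ℂ A A).flip k ∘ₗ LinearMap.mul' ℂ A))
      (g ⊗ₜ h) =
    (toConv val * toConv (val ∘ₗ TensorProduct.mk ℂ A A g ∘ₗ LinearMap.mul' ℂ A)) (h ⊗ₜ k)
  val_one_right : ∀ h : A, val (h ⊗ₜ 1) = counit (R := ℂ) h
  val_one_left : ∀ h : A, val (1 ⊗ₜ h) = counit (R := ℂ) h

/-- `v ↦ φ(v₍₋₁₎) v₍₀₎`. -/
def contract {A : Type u} {V : Type v} [AddCommGroup A] [Module ℂ A] [AddCommGroup V] [Module ℂ V]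
    [LeftCoaction A V] (φ : A →ₗ[ℂ] ℂ) : V →ₗ[ℂ] V :=
  (TensorProduct.lid ℂ V).toLinearMap ∘ₗ φ.rTensor V ∘ₗ coact A

namespace TwoCocycle

variable {A : Type u} [Ring A] [HopfAlgebra ℂ A] (γ : TwoCocycle A)

/-- The cocycle is unitary: the conjugate of `γ(a ⊗ b)` is `γ⁻¹(S(a)* ⊗ S(b)*)`. -/
def IsUnitary [StarRing A] : Prop :=
  ∀ a b : A, conj (γ.val (a ⊗ₜ b)) =
    γ.inv (star (HopfAlgebra.antipode ℂ a) ⊗ₜ star (HopfAlgebra.antipode ℂ b))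

/-- `U(k) = γ(k₁ ⊗ S(k₂))`. -/
def U : A →ₗ[ℂ] ℂ := γ.val ∘ₗ (HopfAlgebra.antipode ℂ).lTensor A ∘ₗ comul

/-- `Ū(k) = γ⁻¹(S(k₁) ⊗ k₂)`. -/
def Ubar : A →ₗ[ℂ] ℂ := γ.inv ∘ₗ (HopfAlgebra.antipode ℂ).rTensor A ∘ₗ comul

/-- The deformed product `h ·_γ k = γ(h₁ ⊗ k₁) h₂ k₂ γ⁻¹(h₃ ⊗ k₃)`. -/
def mul : A ⊗[ℂ] A →ₗ[ℂ] A :=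
  (toConv (Algebra.linearMap ℂ A ∘ₗ γ.val) * toConv (LinearMap.mul' ℂ A) *
    toConv (Algebra.linearMap ℂ A ∘ₗ γ.inv)).ofConv

/-- The deformed antipode `S_γ(h) = U(h₁) S(h₂) Ū(h₃)`. -/
def antipode : A →ₗ[ℂ] A :=
  (toConv (Algebra.linearMap ℂ A ∘ₗ γ.U) * toConv (HopfAlgebra.antipode ℂ) *
    toConv (Algebra.linearMap ℂ A ∘ₗ γ.Ubar)).ofConv

section Star

variable [StarRing A] [StarModule ℂ A]

/-- `V(k) = U(S⁻¹(k))`. -/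
def V : A →ₗ[ℂ] ℂ := γ.U ∘ₗ antipodeInv A

/-- `V̄(k) = Ū(S⁻¹(k))`. -/
def Vbar : A →ₗ[ℂ] ℂ := γ.Ubar ∘ₗ antipodeInv A

/-- The deformed star on `A`, `V̄((h*)₁) (h*)₂ V((h*)₃)`. -/
def starHopf (h : A) : A :=
  (toConv (Algebra.linearMap ℂ A ∘ₗ γ.Vbar) * toConv LinearMap.id *
    toConv (Algebra.linearMap ℂ A ∘ₗ γ.V)).ofConv (star h)

/-- The deformed star on a comodule `*`-algebra, `V̄((b*)₍₋₁₎) (b*)₍₀₎`. -/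
def starAlg {B : Type v} [Ring B] [Algebra ℂ B] [StarRing B] [LeftCoaction A B] (b : B) : B :=
  contract γ.Vbar (star b)

/-- The map `𝔑(ē) = V̄(e₍₋₁₎*) ē₍₀₎`. -/
def frakN {E : Type w} [AddCommGroup E] [Module ℂ E] [LeftCoaction A E] (z : Bar E) : Bar E :=
  contract γ.Vbar z

end Star

/-- The deformation `v ⊗ w ↦ γ(v₍₋₁₎ ⊗ w₍₋₁₎) μ(v₍₀₎ ⊗ w₍₀₎)` of a bilinear map `μ` of comodules. -/
def twist {V : Type v} {W : Type w} {X : Type x} [AddCommGroup V] [Module ℂ V] [LeftCoaction A V]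
    [AddCommGroup W] [Module ℂ W] [LeftCoaction A W] [AddCommGroup X] [Module ℂ X]
    (μ : V →ₗ[ℂ] W →ₗ[ℂ] X) : V ⊗[ℂ] W →ₗ[ℂ] X :=
  (TensorProduct.lid ℂ X).toLinearMap ∘ₗ TensorProduct.map γ.val (TensorProduct.lift μ) ∘ₗ
    (TensorProduct.tensorTensorTensorComm ℂ A V A W).toLinearMap ∘ₗ
    TensorProduct.map (coact A) (coact A)

/-- The map `𝔖(f)(v) = γ(v₍₋₂₎ ⊗ S(v₍₋₁₎) f(v₍₀₎)₍₋₁₎) f(v₍₀₎)₍₀₎`. -/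
def frakS {B : Type v} {E : Type w} {F : Type x} [Ring B] [Algebra ℂ B] [AddCommGroup E]
    [Module ℂ E] [Module B E] [IsScalarTower ℂ B E] [AddCommGroup F] [Module ℂ F] [Module B F]
    [IsScalarTower ℂ B F] [LeftCoaction A E] [LeftCoaction A F] (f : E →ₗ[B] F) : E →ₗ[ℂ] F :=
  (TensorProduct.lid ℂ F).toLinearMap ∘ₗ
    (γ.val ∘ₗ (LinearMap.mul' ℂ A ∘ₗ (HopfAlgebra.antipode ℂ).rTensor A).lTensor A ∘ₗ
      (TensorProduct.assoc ℂ A A A).toLinearMap).rTensor F ∘ₗ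
    (TensorProduct.assoc ℂ (A ⊗[ℂ] A) A F).symm.toLinearMap ∘ₗ
    TensorProduct.map (comul (R := ℂ)) (coact A ∘ₗ f.restrictScalars ℂ) ∘ₗ coact A

end TwoCocycle


/-! ### The deformed objects

Each of the following structures consists of a linear isomorphism `of` from the given space onto the
underlying space of the deformed object, which is an honest object of the same kind whose operations
are, through `of`, the deformed operations. It is determined up to a unique isomorphism. -/

/-- The Hopf `*`-algebra `A_γ`. -/
structure TwistedHopf {A : Type u} [Ring A] [HopfAlgebra ℂ A] [StarRing A] [StarModule ℂ A]
    (γ : TwoCocycle A) where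
  /-- the underlying space -/
  carrier : Type u
  [ring : Ring carrier]
  [hopf : HopfAlgebra ℂ carrier]
  [starRing : StarRing carrier]
  [starModule : StarModule ℂ carrier]
  [hopfStar : HopfStarAlgebra carrier]
  /-- the identity map `A → A_γ` -/
  of : A ≃ₗ[ℂ] carrier
  comul_of : ∀ a, comul (R := ℂ) (of a) =
    TensorProduct.map of.toLinearMap of.toLinearMap (comul (R := ℂ) a)
  counit_of : ∀ a, counit (R := ℂ) (of a) = counit (R := ℂ) a
  one_eq : 1 = of 1
  mul_of : ∀ h k, of h * of k = of (γ.mul (h ⊗ₜ k))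
  antipode_of : ∀ h, HopfAlgebra.antipode ℂ (of h) = of (γ.antipode h)
  star_of : ∀ h, star (of h) = of (γ.starHopf h)

attribute [instance] TwistedHopf.ring TwistedHopf.hopf TwistedHopf.starRing TwistedHopf.starModule
  TwistedHopf.hopfStar

section Twisted

variable {A : Type u} [Ring A] [HopfAlgebra ℂ A] [StarRing A] [StarModule ℂ A]
  {γ : TwoCocycle A} (Aγ : TwistedHopf γ)

/-- The left `A_γ`-comodule `*`-algebra `B_γ`. -/
structure TwistedAlgebra (B : Type v) [Ring B] [Algebra ℂ B] [StarRing B] [LeftCoaction A B] where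
  /-- the underlying space -/
  carrier : Type v
  [ring : Ring carrier]
  [algebra : Algebra ℂ carrier]
  [starRing : StarRing carrier]
  [starModule : StarModule ℂ carrier]
  [leftCoaction : LeftCoaction Aγ.carrier carrier]
  [comoduleStarAlgebra : ComoduleStarAlgebra Aγ.carrier carrier]
  /-- the identity map `B → B_γ` -/
  of : B ≃ₗ[ℂ] carrier
  coact_of : ∀ b, coact Aγ.carrier (of b) =
    TensorProduct.map Aγ.of.toLinearMap of.toLinearMap (coact A b)
  one_eq : 1 = of 1
  mul_of : ∀ a b, of a * of b = of (γ.twist (LinearMap.mul ℂ B) (a ⊗ₜ b))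
  star_of : ∀ b, star (of b) = of (γ.starAlg b)

attribute [instance] TwistedAlgebra.ring TwistedAlgebra.algebra TwistedAlgebra.starRing
  TwistedAlgebra.starModule TwistedAlgebra.leftCoaction TwistedAlgebra.comoduleStarAlgebra

/-- The object `Γ(E)` of the category of relative Hopf modules over `A_γ` and `B_γ`. -/
structure TwistedModule {Aγ : TwistedHopf γ} {B : Type v} [Ring B] [Algebra ℂ B] [StarRing B]
    [LeftCoaction A B] (Bγ : TwistedAlgebra Aγ B)
    (E : Type w) [AddCommGroup E] [Module ℂ E] [Module B E] [Module Bᵐᵒᵖ E]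
    [IsScalarTower ℂ B E] [IsScalarTower ℂ Bᵐᵒᵖ E] [LeftCoaction A E] where
  /-- the underlying space -/
  carrier : Type w
  [addCommGroup : AddCommGroup carrier]
  [module : Module ℂ carrier]
  [leftModule : Module Bγ.carrier carrier]
  [rightModule : Module Bγ.carrierᵐᵒᵖ carrier]
  [smulCommClass : SMulCommClass Bγ.carrier Bγ.carrierᵐᵒᵖ carrier]
  [leftScalarTower : IsScalarTower ℂ Bγ.carrier carrier]
  [rightScalarTower : IsScalarTower ℂ Bγ.carrierᵐᵒᵖ carrier]
  [leftCoaction : LeftCoaction Aγ.carrier carrier]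
  [relHopfModule : RelHopfModule Aγ.carrier Bγ.carrier carrier]
  /-- the identity map `E → Γ(E)` -/
  of : E ≃ₗ[ℂ] carrier
  coact_of : ∀ e, coact Aγ.carrier (of e) =
    TensorProduct.map Aγ.of.toLinearMap of.toLinearMap (coact A e)
  smul_of : ∀ (b : B) (e : E), Bγ.of b • of e = of (γ.twist (leftAct B E) (b ⊗ₜ e))
  op_smul_of : ∀ (b : B) (e : E), op (Bγ.of b) • of e = of (γ.twist (rightAct B E) (e ⊗ₜ b))

attribute [instance] TwistedModule.addCommGroup TwistedModule.module TwistedModule.leftModule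
  TwistedModule.rightModule TwistedModule.smulCommClass TwistedModule.leftScalarTower
  TwistedModule.rightScalarTower TwistedModule.leftCoaction TwistedModule.relHopfModule

end Twisted

end RelHopf

end

/-!
Everything is expressed through the convolution algebra `Fn C` of linear functionals on a coalgebra
`C`. It acts on the maps `f` out of a `C`-comodule by `v ↦ φ(v₍₋₁₎) f(v₍₀₎)` (`act`), and
`act φ (act ψ f) = act (φ * ψ) f`. The product of `B_γ` and the actions on `Γ(E)` have the form
`γ.twist μ = act γ (lift μ)`, for a bilinear map `μ : X → Y → Z` of `A`-comodules and the
`A ⊗ A`-comodule `X ⊗ Y`. Identities between deformed structures thus become identities in the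
convolution algebras of `A ⊗ A` and `A ⊗ A ⊗ A`. There are four of them.

* The cocycle identity `γ₁₂ * γ(m ⊗ id) = γ₂₃ * γ(id ⊗ m)` says that a relation
  `μ(ν(x, y), z) = μ'(x, ν'(y, z))` between colinear maps persists after twisting all four maps
  (`twist_assoc`). All associativity, linearity and bimodule axioms are instances of this.
* `γ * γ⁻¹ = 1` says that the twist of a colinear map is colinear for the deformed product
  (`coact_twist`), because `ω ∘ m_γ = γ * (ω ∘ m) * γ⁻¹` for every functional `ω` on `A`.
* `U * Ū = 1 = Ū * U` and `γ * (U ∘ m) = (U ⊗ U) * γ⁻¹(S ⊗ S)τ`, with `τ` the flip of `A ⊗ A`.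
  These are proved on matrix coefficients: every element of a coalgebra is a combination of entries
  of a matrix `a` with `Δ(aᵢⱼ) = ∑ aᵢₗ ⊗ aₗⱼ` (`exists_isComatrix`), on which Sweedler notation is
  a finite sum.
* Unitarity of `γ` gives `conj γ(q* ⊗ p*) = γ⁻¹(S⁻¹(q) ⊗ S⁻¹(p))` and `conj V̄(a*) = V(a)`. Together
  with the previous identities, composed with `S⁻¹`, it follows that conjugation turns the twist of
  `μ` into the twist of the conjugate of `μ`, up to the maps `𝔑`
  (`TwoCocycle.IsUnitary.apply_frakN_mk_twist`). The star of `B_γ`, the compatibility of `𝔑` with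
  the bimodule structures and the Hermitian symmetry of the deformed metric are instances of this.

For the metric, a map `i : W → Hom(E, F)` is colinear if and only if the bilinear map
`e, w ↦ i(w)(e)` is colinear (`colinear_pairing_iff`), and `𝔖` then twists this bilinear map
(`frakS_apply`). So the deformed metric is `𝔥_γ(x̄)(y) = γ.twist ⟨·,·⟩ (y ⊗ 𝔑(x̄))`, and covariance
and bilinearity follow from the above.

A dual basis of `E` is an element `T` of `Ē ⊗ E` with `⟨v, T₁⟩ T₂ = v`. The action of `γ⁻¹` on `T`
gives a dual basis of `Γ(E)` (`exists_dual_basis_twist`), so that `Γ(E)` is finitely generated and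
projective and `𝔥_γ` is surjective. It is injective because the form can be untwisted by `γ⁻¹`.
-/

noncomputable section

namespace RelHopf

/-! ### The convolution algebra of functionals and its action on maps out of a comodule -/

/-- The dual space of `C`, with the convolution product of Mathlib when `C` is a coalgebra. -/
abbrev Fn (C : Type*) [AddCommGroup C] [Module ℂ C] : Type _ := WithConv (C →ₗ[ℂ] ℂ)

section Fn

variable {C D : Type*} [AddCommGroup C] [Module ℂ C] [AddCommGroup D] [Module ℂ D]

lemma Fn.ext_apply {φ ψ : Fn C} (h : ∀ c, φ c = ψ c) : φ = ψ :=
  WithConv.ext (LinearMap.ext h)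

/-- The product `c ⊗ d ↦ φ(c) ψ(d)` of two functionals. -/
def box (φ : Fn C) (ψ : Fn D) : Fn (C ⊗[ℂ] D) :=
  toConv (LinearMap.mul' ℂ ℂ ∘ₗ TensorProduct.map φ.ofConv ψ.ofConv)

@[simp] lemma box_tmul (φ : Fn C) (ψ : Fn D) (c : C) (d : D) : box φ ψ (c ⊗ₜ d) = φ c * ψ d := rfl

variable [Coalgebra ℂ C] [Coalgebra ℂ D]

/-- Pulling back functionals along a coalgebra morphism is multiplicative. -/
def pull (p : C →ₗc[ℂ] D) : Fn D →+* Fn C where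
  toFun φ := toConv (φ.ofConv ∘ₗ p.toLinearMap)
  map_one' := by ext c; simp [LinearMap.convOne_def]
  map_zero' := rfl
  map_add' _ _ := rfl
  map_mul' φ ψ := by
    apply WithConv.ext
    exact LinearMap.convMul_comp_coalgHom_distrib φ ψ p

@[simp] lemma pull_apply (p : C →ₗc[ℂ] D) (φ : Fn D) (c : C) : pull p φ c = φ (p c) := rfl

lemma box_mul_box (φ φ' : Fn C) (ψ ψ' : Fn D) :
    box φ ψ * box φ' ψ' = box (φ * φ') (ψ * ψ') := by
  apply WithConv.ext
  ext c d
  simp only [box, TensorProduct.AlgebraTensorModule.curry_apply, LinearMap.restrictScalars_self,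
    TensorProduct.curry_apply, LinearMap.convMul_apply, TensorProduct.comul_tmul,
    LinearMap.coe_comp, Function.comp_apply, TensorProduct.map_tmul]
  generalize comul (R := ℂ) c = s
  generalize comul (R := ℂ) d = t
  induction s with
  | zero => simp
  | add s s' hs hs' => simp only [TensorProduct.add_tmul, map_add, hs, hs']
  | tmul a b =>
    induction t with
    | zero => simp
    | add t t' ht ht' => simp only [TensorProduct.tmul_add, map_add, ht, ht']
    | tmul a b => simp; ring

lemma box_one_one : box (1 : Fn C) (1 : Fn D) = 1 := by
  apply WithConv.ext
  ext c d
  simp [box, LinearMap.convOne_def, mul_comm]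

end Fn

/-- A left comodule over a coalgebra. -/
class IsComod (C : Type*) (V : Type*) [AddCommGroup C] [Module ℂ C] [Coalgebra ℂ C]
    [AddCommGroup V] [Module ℂ V] [LeftCoaction C V] : Prop where
  coassoc : ∀ v : V, TensorProduct.assoc ℂ C C V ((comul (R := ℂ)).rTensor V (coact C v)) =
    (coact C).lTensor C (coact C v)
  counit : ∀ v : V, TensorProduct.lid ℂ V ((counit (R := ℂ)).rTensor V (coact C v)) = v

instance {A : Type u} {V : Type v} [Ring A] [HopfAlgebra ℂ A] [AddCommGroup V]
    [Module ℂ V] [LeftCoaction A V] [LeftComodule A V] : IsComod A V :=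
  ⟨LeftComodule.coassoc, LeftComodule.counit⟩

section Act

variable {C D V W X Y : Type*} [AddCommGroup C] [Module ℂ C]
  [AddCommGroup D] [Module ℂ D]
  [AddCommGroup V] [Module ℂ V] [AddCommGroup W] [Module ℂ W] [AddCommGroup X] [Module ℂ X]
  [AddCommGroup Y] [Module ℂ Y] [LeftCoaction C V] [LeftCoaction D W]

/-- The action of a functional `φ` on a map `f` out of a comodule, `v ↦ φ(v₍₋₁₎) f(v₍₀₎)`. -/
def act (φ : Fn C) (f : V →ₗ[ℂ] X) : V →ₗ[ℂ] X :=
  (TensorProduct.lid ℂ X).toLinearMap ∘ₗ TensorProduct.map φ.ofConv f ∘ₗ coact C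

lemma act_apply (φ : Fn C) (f : V →ₗ[ℂ] X) (v : V) :
    act φ f v = TensorProduct.lid ℂ X (TensorProduct.map φ.ofConv f (coact C v)) := rfl

lemma comp_act (φ : Fn C) (f : V →ₗ[ℂ] X) (g : X →ₗ[ℂ] Y) : g ∘ₗ act φ f = act φ (g ∘ₗ f) := by
  ext v
  simp only [act, LinearMap.comp_apply]
  generalize coact C v = t
  induction t with
  | zero => simp
  | add s t hs ht => simp only [map_add, hs, ht]
  | tmul a v => simp

lemma apply_act (φ : Fn C) (f : V →ₗ[ℂ] X) (g : X →ₗ[ℂ] Y) (v : V) :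
    g (act φ f v) = act φ (g ∘ₗ f) v :=
  congr($(comp_act φ f g) v)

section

variable [Coalgebra ℂ C] [Coalgebra ℂ D]

lemma act_one [IsComod C V] (f : V →ₗ[ℂ] X) : act (1 : Fn C) f = f := by
  have h : f ∘ₗ act (1 : Fn C) (LinearMap.id (M := V)) = f := by
    ext v
    rw [LinearMap.comp_apply]
    conv_rhs => rw [← IsComod.counit (C := C) v]
    rfl
  rw [comp_act] at h
  exact h

lemma act_act [IsComod C V] (φ ψ : Fn C) (f : V →ₗ[ℂ] X) :
    act φ (act ψ f) = act (φ * ψ) f := by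
  ext v
  have h1 : act φ (act ψ f) v = TensorProduct.lid ℂ X (TensorProduct.map φ.ofConv
      ((TensorProduct.lid ℂ X).toLinearMap ∘ₗ TensorProduct.map ψ.ofConv f)
      ((coact C).lTensor C (coact C v))) := by
    rw [← LinearMap.comp_apply (TensorProduct.map _ _), LinearMap.lTensor,
      ← TensorProduct.map_comp]
    rfl
  rw [h1, ← IsComod.coassoc, act_apply]
  generalize coact C v = t
  induction t with
  | zero => simp
  | add s t hs ht => simp only [map_add, hs, ht]
  | tmul a v =>
    simp only [LinearMap.rTensor_tmul, TensorProduct.map_tmul, TensorProduct.lid_tmul]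
    change _ = (φ * ψ) a • _
    rw [LinearMap.convMul_apply]
    generalize comul (R := ℂ) a = t
    induction t with
    | zero => simp
    | add s t hs ht => simp only [map_add, TensorProduct.add_tmul, add_smul, hs, ht]
    | tmul a b => simp [mul_smul, smul_comm (ψ.ofConv b)]

/-- A linear map intertwining two coactions along a coalgebra morphism intertwines the actions of
the functionals. -/
lemma act_comp (p : C →ₗc[ℂ] D) (h : V →ₗ[ℂ] W)
    (hh : ∀ v, coact D (h v) = TensorProduct.map p.toLinearMap h (coact C v))
    (φ : Fn D) (f : W →ₗ[ℂ] X) : act φ f ∘ₗ h = act (pull p φ) (f ∘ₗ h) := by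
  ext v
  rw [LinearMap.comp_apply, act_apply, act_apply, hh]
  generalize coact C v = t
  induction t with
  | zero => simp
  | add s t hs ht => simp only [map_add, hs, ht]
  | tmul a v => simp

end

/-- The tensor product of a `C`-comodule and a `D`-comodule is a comodule over `C ⊗ D`, by
`δ(v ⊗ w) = (v₍₋₁₎ ⊗ w₍₋₁₎) ⊗ (v₍₀₎ ⊗ w₍₀₎)`. -/
instance tensorCoaction : LeftCoaction (C ⊗[ℂ] D) (V ⊗[ℂ] W) where
  coaction := (TensorProduct.tensorTensorTensorComm ℂ C V D W).toLinearMap ∘ₗ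
    TensorProduct.map (coact C) (coact D)

lemma coact_tmul (v : V) (w : W) : coact (C ⊗[ℂ] D) (v ⊗ₜ[ℂ] w) =
    TensorProduct.tensorTensorTensorComm ℂ C V D W (coact C v ⊗ₜ coact D w) := rfl

/-- The actions on the two factors of a tensor product combine. -/
lemma map_act_act (φ : Fn C) (ψ : Fn D) (f : V →ₗ[ℂ] X) (g : W →ₗ[ℂ] Y) :
    TensorProduct.map (act φ f) (act ψ g) = act (box φ ψ) (TensorProduct.map f g) := by
  ext v w
  simp only [TensorProduct.AlgebraTensorModule.curry_apply, LinearMap.restrictScalars_self,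
    TensorProduct.curry_apply, TensorProduct.map_tmul, act_apply, coact_tmul]
  generalize coact C v = s
  generalize coact D w = t
  induction s with
  | zero => simp
  | add s s' hs hs' => simp only [TensorProduct.add_tmul, map_add, hs, hs']
  | tmul a b =>
    induction t with
    | zero => simp
    | add t t' ht ht' => simp only [TensorProduct.tmul_add, map_add, ht, ht']
    | tmul c d => simp [TensorProduct.smul_tmul', mul_smul, box, smul_comm (φ.ofConv a)]

instance [Coalgebra ℂ C] [Coalgebra ℂ D] [IsComod C V] [IsComod D W] :
    IsComod (C ⊗[ℂ] D) (V ⊗[ℂ] W) where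
  coassoc z := by
    induction z with
    | zero => simp
    | add s t hs ht => simp only [map_add, hs, ht]
    | tmul x y =>
      let F : (C ⊗[ℂ] (C ⊗[ℂ] V)) ⊗[ℂ] (D ⊗[ℂ] (D ⊗[ℂ] W)) →ₗ[ℂ] _ :=
        (TensorProduct.tensorTensorTensorComm ℂ C V D W).toLinearMap.lTensor (C ⊗[ℂ] D) ∘ₗ
        (TensorProduct.tensorTensorTensorComm ℂ C (C ⊗[ℂ] V) D (D ⊗[ℂ] W)).toLinearMap
      have h := congr(F ($(IsComod.coassoc (C := C) x) ⊗ₜ $(IsComod.coassoc (C := D) y)))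
      rw [coact_tmul]
      convert! h using 1
      · generalize coact C x = s
        generalize coact D y = t
        induction s with
        | zero => simp
        | add s s' hs hs' => simp only [TensorProduct.add_tmul, map_add, hs, hs']
        | tmul a b =>
          induction t with
          | zero => simp
          | add t t' ht ht' => simp only [TensorProduct.tmul_add, map_add, ht, ht']
          | tmul c d =>
            simp only [TensorProduct.tensorTensorTensorComm_tmul, LinearMap.rTensor_tmul,
              TensorProduct.comul_tmul]
            generalize comul (R := ℂ) a = s
            generalize comul (R := ℂ) c = t
            induction s with
            | zero => simp
            | add s s' hs hs' => simp only [TensorProduct.add_tmul, map_add, hs, hs']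
            | tmul a b =>
              induction t with
              | zero => simp
              | add t t' ht ht' => simp only [TensorProduct.tmul_add, TensorProduct.add_tmul,
                  map_add, ht, ht']
              | tmul c d => rfl
      · generalize coact C x = s
        generalize coact D y = t
        induction s with
        | zero => simp
        | add s s' hs hs' => simp only [TensorProduct.add_tmul, map_add, hs, hs']
        | tmul a b =>
          induction t with
          | zero => simp
          | add t t' ht ht' => simp only [TensorProduct.tmul_add, map_add, ht, ht']
          | tmul c d =>
            simp only [TensorProduct.tensorTensorTensorComm_tmul, LinearMap.lTensor_tmul,
              coact_tmul, F, LinearMap.comp_apply, LinearEquiv.coe_coe]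
  counit z := by
    induction z with
    | zero => simp
    | add s t hs ht => simp only [map_add, hs, ht]
    | tmul x y =>
      rw [coact_tmul]
      have h := congr($(IsComod.counit (C := C) x) ⊗ₜ[ℂ] $(IsComod.counit (C := D) y))
      convert! h using 1
      generalize coact C x = s
      generalize coact D y = t
      induction s with
      | zero => simp
      | add s s' hs hs' => simp only [TensorProduct.add_tmul, map_add, hs, hs']
      | tmul a b =>
        induction t with
        | zero => simp
        | add t t' ht ht' => simp only [TensorProduct.tmul_add, map_add, ht, ht']
        | tmul c d => simp [TensorProduct.smul_tmul', mul_smul]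

lemma map_act_id [Coalgebra ℂ D] [IsComod D W] (φ : Fn C) (f : V →ₗ[ℂ] X) (g : W →ₗ[ℂ] Y) :
    TensorProduct.map (act φ f) g = act (box φ (1 : Fn D)) (TensorProduct.map f g) := by
  rw [← map_act_act, act_one]

lemma map_id_act [Coalgebra ℂ C] [IsComod C V] (ψ : Fn D) (f : V →ₗ[ℂ] X) (g : W →ₗ[ℂ] Y) :
    TensorProduct.map f (act ψ g) = act (box (1 : Fn C) ψ) (TensorProduct.map f g) := by
  rw [← map_act_act, act_one]

end Act

/-! ### Separation by functionals -/

section Separation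

variable {V W : Type*} [AddCommGroup V] [Module ℂ V] [AddCommGroup W] [Module ℂ W]

lemma eq_of_fn {v v' : V} (h : ∀ φ : Fn V, φ v = φ v') : v = v' := by
  rw [← sub_eq_zero, ← Module.forall_dual_apply_eq_zero_iff ℂ]
  intro φ
  rw [map_sub, sub_eq_zero]
  exact h (toConv φ)

/-- Product functionals separate the points of a tensor product. -/
lemma eq_of_box {t t' : V ⊗[ℂ] W} (h : ∀ (φ : Fn V) (ψ : Fn W), box φ ψ t = box φ ψ t') :
    t = t' := by
  let b := Module.Basis.ofVectorSpace ℂ V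
  let c := Module.Basis.ofVectorSpace ℂ W
  refine (b.tensorProduct c).ext_elem fun i => ?_
  have key : ∀ s : V ⊗[ℂ] W, (b.tensorProduct c).repr s i =
      box (toConv (b.coord i.1)) (toConv (c.coord i.2)) s := by
    intro s
    induction s with
    | zero => simp
    | add s t hs ht => simp only [map_add, Finsupp.add_apply, hs, ht]
    | tmul v w =>
      rw [Module.Basis.tensorProduct_repr_tmul_apply]
      simp [mul_comm]
  rw [key, key, h]

end Separation

/-! ### The cocycle identity in the convolution algebra -/

section Slices

variable {C D : Type*} [AddCommGroup C] [Module ℂ C] [Coalgebra ℂ C] [AddCommGroup D] [Module ℂ D]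
  [Coalgebra ℂ D]

/-- The functional `c ↦ φ(c ⊗ d)`. -/
def sliceRight (φ : Fn (C ⊗[ℂ] D)) (d : D) : Fn C :=
  toConv (φ.ofConv ∘ₗ (TensorProduct.mk ℂ _ _).flip d)

/-- The functional `d ↦ φ(c ⊗ d)`. -/
def sliceLeft (φ : Fn (C ⊗[ℂ] D)) (c : C) : Fn D :=
  toConv (φ.ofConv ∘ₗ TensorProduct.mk ℂ _ _ c)

lemma sliceRight_mul_box (φ : Fn (C ⊗[ℂ] D)) (ψ : Fn C) (d : D) :
    sliceRight (φ * box ψ 1) d = sliceRight φ d * ψ := by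
  apply Fn.ext_apply
  intro c
  change (φ * box ψ 1 : Fn (C ⊗[ℂ] D)) (c ⊗ₜ d) = _
  rw [LinearMap.convMul_apply, LinearMap.convMul_apply, TensorProduct.comul_tmul]
  have h : ∀ (t : C ⊗[ℂ] C) (s : D ⊗[ℂ] D), LinearMap.mul' ℂ ℂ (TensorProduct.map φ.ofConv
      (box ψ 1).ofConv (TensorProduct.AlgebraTensorModule.tensorTensorTensorComm ℂ ℂ ℂ ℂ C C D D
        (t ⊗ₜ s))) =
      LinearMap.mul' ℂ ℂ (TensorProduct.map (sliceRight φ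
        (TensorProduct.rid ℂ D ((counit (R := ℂ)).lTensor D s))).ofConv ψ.ofConv t) := by
    intro t s
    induction t with
    | zero => simp
    | add t t' ht ht' => simp only [TensorProduct.add_tmul, map_add, ht, ht']
    | tmul c d =>
      induction s with
      | zero => simp [sliceRight]
      | add s s' hs hs' =>
        simp only [sliceRight] at hs hs' ⊢
        simp only [TensorProduct.tmul_add, map_add, hs, hs', LinearMap.comp_add,
          TensorProduct.map_add_left, LinearMap.add_apply]
      | tmul a b =>
        have h1 : (box ψ 1).ofConv (d ⊗ₜ b) = ψ d * counit (R := ℂ) b := rfl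
        simp [h1, sliceRight]
        ring
  rw [h]
  simp

lemma sliceRight_box_mul (φ : Fn (C ⊗[ℂ] D)) (ψ : Fn C) (d : D) :
    sliceRight (box ψ 1 * φ) d = ψ * sliceRight φ d := by
  apply Fn.ext_apply
  intro c
  change (box ψ 1 * φ : Fn (C ⊗[ℂ] D)) (c ⊗ₜ d) = _
  rw [LinearMap.convMul_apply, LinearMap.convMul_apply, TensorProduct.comul_tmul]
  have h : ∀ (t : C ⊗[ℂ] C) (s : D ⊗[ℂ] D), LinearMap.mul' ℂ ℂ (TensorProduct.map
      (box ψ 1).ofConv φ.ofConv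
      (TensorProduct.AlgebraTensorModule.tensorTensorTensorComm ℂ ℂ ℂ ℂ C C D D (t ⊗ₜ s))) =
      LinearMap.mul' ℂ ℂ (TensorProduct.map ψ.ofConv (sliceRight φ
        (TensorProduct.lid ℂ D ((counit (R := ℂ)).rTensor D s))).ofConv t) := by
    intro t s
    induction t with
    | zero => simp
    | add t t' ht ht' => simp only [TensorProduct.add_tmul, map_add, ht, ht']
    | tmul c d =>
      induction s with
      | zero => simp [sliceRight]
      | add s s' hs hs' =>
        simp only [sliceRight] at hs hs' ⊢
        simp only [TensorProduct.tmul_add, map_add, hs, hs', LinearMap.comp_add,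
          TensorProduct.map_add_right, LinearMap.add_apply]
      | tmul a b =>
        have h1 : (box ψ 1).ofConv (c ⊗ₜ a) = ψ c * counit (R := ℂ) a := rfl
        simp [h1, sliceRight]
        ring
  rw [h]
  simp

lemma sliceLeft_mul_box (φ : Fn (C ⊗[ℂ] D)) (ψ : Fn D) (c : C) :
    sliceLeft (φ * box 1 ψ) c = sliceLeft φ c * ψ := by
  apply Fn.ext_apply
  intro d
  change (φ * box 1 ψ : Fn (C ⊗[ℂ] D)) (c ⊗ₜ d) = _
  rw [LinearMap.convMul_apply, LinearMap.convMul_apply, TensorProduct.comul_tmul]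
  have h : ∀ (t : C ⊗[ℂ] C) (s : D ⊗[ℂ] D), LinearMap.mul' ℂ ℂ (TensorProduct.map φ.ofConv
      (box 1 ψ).ofConv (TensorProduct.AlgebraTensorModule.tensorTensorTensorComm ℂ ℂ ℂ ℂ C C D D
        (t ⊗ₜ s))) =
      LinearMap.mul' ℂ ℂ (TensorProduct.map (sliceLeft φ
        (TensorProduct.rid ℂ C ((counit (R := ℂ)).lTensor C t))).ofConv ψ.ofConv s) := by
    intro t s
    induction s with
    | zero => simp
    | add t t' ht ht' => simp only [TensorProduct.tmul_add, map_add, ht, ht']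
    | tmul c d =>
      induction t with
      | zero => simp [sliceLeft]
      | add s s' hs hs' =>
        simp only [sliceLeft] at hs hs' ⊢
        simp only [TensorProduct.add_tmul, map_add, hs, hs', LinearMap.comp_add,
          TensorProduct.map_add_left, LinearMap.add_apply]
      | tmul a b =>
        have h1 : (box 1 ψ).ofConv (b ⊗ₜ d) = counit (R := ℂ) b * ψ d := rfl
        simp [h1, sliceLeft]
        ring
  rw [h]
  simp

lemma sliceLeft_box_mul (φ : Fn (C ⊗[ℂ] D)) (ψ : Fn D) (c : C) :
    sliceLeft (box 1 ψ * φ) c = ψ * sliceLeft φ c := by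
  apply Fn.ext_apply
  intro d
  change (box 1 ψ * φ : Fn (C ⊗[ℂ] D)) (c ⊗ₜ d) = _
  rw [LinearMap.convMul_apply, LinearMap.convMul_apply, TensorProduct.comul_tmul]
  have h : ∀ (t : C ⊗[ℂ] C) (s : D ⊗[ℂ] D), LinearMap.mul' ℂ ℂ (TensorProduct.map
      (box 1 ψ).ofConv φ.ofConv
      (TensorProduct.AlgebraTensorModule.tensorTensorTensorComm ℂ ℂ ℂ ℂ C C D D (t ⊗ₜ s))) =
      LinearMap.mul' ℂ ℂ (TensorProduct.map ψ.ofConv (sliceLeft φ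
        (TensorProduct.lid ℂ C ((counit (R := ℂ)).rTensor C t))).ofConv s) := by
    intro t s
    induction s with
    | zero => simp
    | add t t' ht ht' => simp only [TensorProduct.tmul_add, map_add, ht, ht']
    | tmul c d =>
      induction t with
      | zero => simp [sliceLeft]
      | add s s' hs hs' =>
        simp only [sliceLeft] at hs hs' ⊢
        simp only [TensorProduct.add_tmul, map_add, hs, hs', LinearMap.comp_add,
          TensorProduct.map_add_right, LinearMap.add_apply]
      | tmul a b =>
        have h1 : (box 1 ψ).ofConv (a ⊗ₜ c) = counit (R := ℂ) a * ψ c := rfl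
        simp [h1, sliceLeft]
        ring
  rw [h]
  simp

end Slices

namespace TwoCocycle

variable {A : Type u} [Ring A] [HopfAlgebra ℂ A] (γ : TwoCocycle A)

/-- The cocycle as an element of the convolution algebra of functionals on `A ⊗ A`. -/
def fn : Fn (A ⊗[ℂ] A) := toConv γ.val

/-- The convolution inverse of the cocycle. -/
def fnInv : Fn (A ⊗[ℂ] A) := toConv γ.inv

@[simp] lemma fn_apply (z : A ⊗[ℂ] A) : γ.fn z = γ.val z := rfl

@[simp] lemma fnInv_apply (z : A ⊗[ℂ] A) : γ.fnInv z = γ.inv z := rfl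

@[simp] lemma fn_mul_fnInv : γ.fn * γ.fnInv = 1 := γ.val_inv

@[simp] lemma fnInv_mul_fn : γ.fnInv * γ.fn = 1 := γ.inv_val

/-- The multiplication `A ⊗ A → A` as a morphism of coalgebras. -/
def mulHom (A : Type u) [Ring A] [HopfAlgebra ℂ A] : A ⊗[ℂ] A →ₗc[ℂ] A :=
  Bialgebra.mulCoalgHom ℂ A

lemma toLinearMap_mulHom : (mulHom A).toLinearMap = LinearMap.mul' ℂ A := rfl

@[simp] lemma mulHom_apply (z : A ⊗[ℂ] A) : mulHom A z = LinearMap.mul' ℂ A z := rfl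

/-- Multiplication of the last two factors of `A ⊗ (A ⊗ A)`. -/
def mulRight (A : Type u) [Ring A] [HopfAlgebra ℂ A] : A ⊗[ℂ] (A ⊗[ℂ] A) →ₗc[ℂ] A ⊗[ℂ] A :=
  Coalgebra.TensorProduct.map (CoalgHom.id ℂ A) (mulHom A)

/-- Multiplication of the first two factors of `(A ⊗ A) ⊗ A`. -/
def mulLeft (A : Type u) [Ring A] [HopfAlgebra ℂ A] : (A ⊗[ℂ] A) ⊗[ℂ] A →ₗc[ℂ] A ⊗[ℂ] A :=
  Coalgebra.TensorProduct.map (mulHom A) (CoalgHom.id ℂ A)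

@[simp] lemma mulRight_tmul (a : A) (z : A ⊗[ℂ] A) :
    mulRight A (a ⊗ₜ z) = a ⊗ₜ LinearMap.mul' ℂ A z := rfl

@[simp] lemma mulLeft_tmul (a : A) (z : A ⊗[ℂ] A) :
    mulLeft A (z ⊗ₜ a) = LinearMap.mul' ℂ A z ⊗ₜ a := rfl

/-- The associator as a morphism of coalgebras. -/
def assocHom (A : Type u) [Ring A] [HopfAlgebra ℂ A] :
    (A ⊗[ℂ] A) ⊗[ℂ] A →ₗc[ℂ] A ⊗[ℂ] (A ⊗[ℂ] A) :=
  (Coalgebra.TensorProduct.assoc ℂ ℂ A A A : _ →ₗc[ℂ] _)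

@[simp] lemma assocHom_tmul (a b c : A) : assocHom A ((a ⊗ₜ b) ⊗ₜ c) = a ⊗ₜ (b ⊗ₜ c) := rfl

/-- The cocycle identity in the convolution algebra of functionals on `A ⊗ A ⊗ A`. -/
lemma cocycle_fn : box γ.fn 1 * pull (mulLeft A) γ.fn =
    pull (assocHom A) (box 1 γ.fn * pull (mulRight A) γ.fn) := by
  apply WithConv.ext
  ext g h k
  have h1 := γ.cocycle g h k
  have h2 := congr(ofConv $(sliceRight_box_mul (pull (mulLeft A) γ.fn) γ.fn k) (g ⊗ₜ h))
  have h3 := congr(ofConv $(sliceLeft_box_mul (pull (mulRight A) γ.fn) γ.fn g) (h ⊗ₜ k))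
  exact h2.trans (h1.trans h3.symm)

end TwoCocycle

/-! ### Colinear bilinear maps and their twists -/

section Colinear

variable {A : Type u} [Ring A] [HopfAlgebra ℂ A] (γ : TwoCocycle A)
  {X Y Z P R : Type*}
  [AddCommGroup X] [Module ℂ X] [LeftCoaction A X] [AddCommGroup Y] [Module ℂ Y] [LeftCoaction A Y]
  [AddCommGroup Z] [Module ℂ Z] [LeftCoaction A Z] [AddCommGroup P] [Module ℂ P] [LeftCoaction A P]
  [AddCommGroup R] [Module ℂ R] [LeftCoaction A R]

/-- A bilinear map of comodules is colinear if `δ(μ(x, y)) = x₍₋₁₎ y₍₋₁₎ ⊗ μ(x₍₀₎, y₍₀₎)`. -/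
def Colinear (A : Type u) [Ring A] [HopfAlgebra ℂ A] {X Y P : Type*}
    [AddCommGroup X] [Module ℂ X] [LeftCoaction A X]
    [AddCommGroup Y] [Module ℂ Y] [LeftCoaction A Y]
    [AddCommGroup P] [Module ℂ P] [LeftCoaction A P] (μ : X →ₗ[ℂ] Y →ₗ[ℂ] P) : Prop :=
  ∀ z : X ⊗[ℂ] Y, coact A (TensorProduct.lift μ z) =
    TensorProduct.map (LinearMap.mul' ℂ A) (TensorProduct.lift μ) (coact (A ⊗[ℂ] A) z)

lemma colinear_iff_map₂ (μ : X →ₗ[ℂ] Y →ₗ[ℂ] P) : Colinear A μ ↔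
    ∀ x y, coact A (μ x y) = TensorProduct.map₂ (LinearMap.mul ℂ A) μ (coact A x) (coact A y) := by
  have h : ∀ (s : A ⊗[ℂ] X) (t : A ⊗[ℂ] Y),
      TensorProduct.map (LinearMap.mul' ℂ A) (TensorProduct.lift μ)
        (TensorProduct.tensorTensorTensorComm ℂ A X A Y (s ⊗ₜ t)) =
      TensorProduct.map₂ (LinearMap.mul ℂ A) μ s t := by
    intro s t
    induction s with
    | zero => simp
    | add s s' hs hs' => simp only [TensorProduct.add_tmul, map_add, hs, hs', LinearMap.add_apply]
    | tmul a b =>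
      induction t with
      | zero => simp
      | add t t' ht ht' => simp only [TensorProduct.tmul_add, map_add, ht, ht']
      | tmul c d => simp
  constructor
  · intro hμ x y
    have := hμ (x ⊗ₜ y)
    rwa [coact_tmul, h, TensorProduct.lift.tmul] at this
  · intro hμ z
    induction z with
    | zero => simp
    | add s s' hs hs' => simp only [map_add, hs, hs']
    | tmul x y => rw [coact_tmul, h, TensorProduct.lift.tmul, hμ]

lemma twist_eq_act {P : Type*} [AddCommGroup P] [Module ℂ P] (μ : X →ₗ[ℂ] Y →ₗ[ℂ] P) :
    γ.twist μ = act γ.fn (TensorProduct.lift μ) := rfl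

lemma Colinear.act_comp {Q : Type*} [AddCommGroup Q] [Module ℂ Q] {μ : X →ₗ[ℂ] Y →ₗ[ℂ] P}
    (hμ : Colinear A μ) (φ : Fn A) (f : P →ₗ[ℂ] Q) :
    act φ f ∘ₗ TensorProduct.lift μ =
      act (pull (TwoCocycle.mulHom A) φ) (f ∘ₗ TensorProduct.lift μ) :=
  RelHopf.act_comp (TwoCocycle.mulHom A) _
    (fun v => by rw [TwoCocycle.toLinearMap_mulHom]; exact hμ v) φ f

lemma coact_map_lift_id {ν : X →ₗ[ℂ] Y →ₗ[ℂ] P} (hν : Colinear A ν) (v : (X ⊗[ℂ] Y) ⊗[ℂ] Z) :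
    coact (A ⊗[ℂ] A) (TensorProduct.map (TensorProduct.lift ν) LinearMap.id v) =
      TensorProduct.map (TwoCocycle.mulLeft A).toLinearMap
        (TensorProduct.map (TensorProduct.lift ν) LinearMap.id) (coact ((A ⊗[ℂ] A) ⊗[ℂ] A) v) := by
  induction v with
  | zero => simp
  | add s t hs ht => simp only [map_add, hs, ht]
  | tmul z y =>
    rw [TensorProduct.map_tmul, coact_tmul, coact_tmul, hν, LinearMap.id_apply]
    generalize coact (A ⊗[ℂ] A) z = s
    generalize coact A y = t
    induction s with
    | zero => simp
    | add s s' hs hs' => simp only [TensorProduct.add_tmul, map_add, hs, hs']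
    | tmul a b =>
      induction t with
      | zero => simp
      | add t t' ht ht' => simp only [TensorProduct.tmul_add, map_add, ht, ht']
      | tmul c d => simp

lemma coact_map_id_lift {ν : Y →ₗ[ℂ] Z →ₗ[ℂ] P} (hν : Colinear A ν) (v : X ⊗[ℂ] (Y ⊗[ℂ] Z)) :
    coact (A ⊗[ℂ] A) (TensorProduct.map LinearMap.id (TensorProduct.lift ν) v) =
      TensorProduct.map (TwoCocycle.mulRight A).toLinearMap
        (TensorProduct.map LinearMap.id (TensorProduct.lift ν)) (coact (A ⊗[ℂ] (A ⊗[ℂ] A)) v) := by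
  induction v with
  | zero => simp
  | add s t hs ht => simp only [map_add, hs, ht]
  | tmul y z =>
    rw [TensorProduct.map_tmul, coact_tmul, coact_tmul, hν, LinearMap.id_apply]
    generalize coact (A ⊗[ℂ] A) z = s
    generalize coact A y = t
    induction s with
    | zero => simp
    | add s s' hs hs' => simp only [TensorProduct.tmul_add, map_add, hs, hs']
    | tmul a b =>
      induction t with
      | zero => simp
      | add t t' ht ht' => simp only [TensorProduct.add_tmul, map_add, ht, ht']
      | tmul c d => simp

lemma coact_assoc (v : (X ⊗[ℂ] Y) ⊗[ℂ] Z) :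
    coact (A ⊗[ℂ] (A ⊗[ℂ] A)) (TensorProduct.assoc ℂ X Y Z v) =
      TensorProduct.map (TwoCocycle.assocHom A).toLinearMap
        (TensorProduct.assoc ℂ X Y Z).toLinearMap (coact ((A ⊗[ℂ] A) ⊗[ℂ] A) v) := by
  have h : ∀ (s : A ⊗[ℂ] X) (t : A ⊗[ℂ] Y) (r : A ⊗[ℂ] Z),
      TensorProduct.tensorTensorTensorComm ℂ A X (A ⊗[ℂ] A) (Y ⊗[ℂ] Z)
        (s ⊗ₜ TensorProduct.tensorTensorTensorComm ℂ A Y A Z (t ⊗ₜ r)) =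
      TensorProduct.map (TwoCocycle.assocHom A).toLinearMap
        (TensorProduct.assoc ℂ X Y Z).toLinearMap
        (TensorProduct.tensorTensorTensorComm ℂ (A ⊗[ℂ] A) (X ⊗[ℂ] Y) A Z
        (TensorProduct.tensorTensorTensorComm ℂ A X A Y (s ⊗ₜ t) ⊗ₜ r)) := by
    intro s t r
    induction s with
    | zero => simp
    | add s s' hs hs' => simp only [TensorProduct.add_tmul, map_add, hs, hs']
    | tmul a b =>
      induction t with
      | zero => simp
      | add t t' ht ht' => simp only [TensorProduct.add_tmul, TensorProduct.tmul_add, map_add, ht,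
          ht']
      | tmul c d =>
        induction r with
        | zero => simp
        | add t t' ht ht' => simp only [TensorProduct.tmul_add, map_add, ht, ht']
        | tmul e f => simp
  induction v with
  | zero => simp
  | add s t hs ht => simp only [map_add, hs, ht]
  | tmul v z =>
    induction v with
    | zero => simp
    | add s t hs ht => simp only [map_add, TensorProduct.add_tmul, hs, ht]
    | tmul x y =>
      rw [TensorProduct.assoc_tmul, coact_tmul, coact_tmul, coact_tmul, coact_tmul, h]

/-- An associativity relation between colinear bilinear maps persists after twisting all of them.
This is where the cocycle identity is used. -/
theorem twist_assoc {Q : Type*} [AddCommGroup Q] [Module ℂ Q] [IsComod A X] [IsComod A Y]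
    [IsComod A Z]
    {ν : X →ₗ[ℂ] Y →ₗ[ℂ] P} {μ : P →ₗ[ℂ] Z →ₗ[ℂ] Q} {ν' : Y →ₗ[ℂ] Z →ₗ[ℂ] R}
    {μ' : X →ₗ[ℂ] R →ₗ[ℂ] Q} (hν : Colinear A ν) (hν' : Colinear A ν')
    (h : ∀ x y z, μ (ν x y) z = μ' x (ν' y z)) (x : X) (y : Y) (z : Z) :
    γ.twist μ (γ.twist ν (x ⊗ₜ y) ⊗ₜ z) = γ.twist μ' (x ⊗ₜ γ.twist ν' (y ⊗ₜ z)) := by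
  have e1 : act γ.fn (TensorProduct.lift μ) ∘ₗ
      TensorProduct.map (TensorProduct.lift ν) (LinearMap.id (M := Z)) = _ :=
    act_comp (TwoCocycle.mulLeft A) _ (coact_map_lift_id hν) γ.fn (TensorProduct.lift μ)
  have e2 : act γ.fn (TensorProduct.lift μ') ∘ₗ
      TensorProduct.map (LinearMap.id (M := X)) (TensorProduct.lift ν') = _ :=
    act_comp (TwoCocycle.mulRight A) _ (coact_map_id_lift hν') γ.fn (TensorProduct.lift μ')
  have h1 : γ.twist μ ∘ₗ TensorProduct.map (γ.twist ν) LinearMap.id =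
      act (box γ.fn 1 * pull (TwoCocycle.mulLeft A) γ.fn)
        (TensorProduct.lift μ ∘ₗ TensorProduct.map (TensorProduct.lift ν) LinearMap.id) := by
    rw [twist_eq_act, twist_eq_act, map_act_id (D := A), comp_act, e1, act_act]
  have h2 : γ.twist μ' ∘ₗ TensorProduct.map LinearMap.id (γ.twist ν') =
      act (box 1 γ.fn * pull (TwoCocycle.mulRight A) γ.fn)
        (TensorProduct.lift μ' ∘ₗ TensorProduct.map LinearMap.id (TensorProduct.lift ν')) := by
    rw [twist_eq_act, twist_eq_act, map_id_act (C := A), comp_act, e2, act_act]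
  have h3 : γ.twist μ ∘ₗ TensorProduct.map (γ.twist ν) LinearMap.id =
      (γ.twist μ' ∘ₗ TensorProduct.map LinearMap.id (γ.twist ν')) ∘ₗ
        (TensorProduct.assoc ℂ X Y Z).toLinearMap := by
    rw [h1, h2, act_comp (TwoCocycle.assocHom A) _ coact_assoc, γ.cocycle_fn]
    congr 1
    ext x y z
    simp [h]
  exact congr($h3 ((x ⊗ₜ y) ⊗ₜ z))

/-! ### The deformed product of `A` -/

section Conv

variable {C : Type*} [AddCommGroup C] [Module ℂ C] [Coalgebra ℂ C]

lemma comp_linearMap_mul (φ : Fn C) (f : WithConv (C →ₗ[ℂ] A)) (ω : Fn A) :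
    toConv (ω.ofConv ∘ₗ (toConv (Algebra.linearMap ℂ A ∘ₗ φ.ofConv) * f).ofConv) =
      φ * toConv (ω.ofConv ∘ₗ f.ofConv) := by
  apply Fn.ext_apply
  intro c
  rw [LinearMap.convMul_apply]
  change ω.ofConv (LinearMap.mul' ℂ A (TensorProduct.map _ _ (comul c))) = _
  generalize comul (R := ℂ) c = t
  induction t with
  | zero => simp
  | add s t hs ht => simp only [map_add, hs, ht]
  | tmul a b => simp [Algebra.algebraMap_eq_smul_one]

lemma comp_mul_linearMap (φ : Fn C) (f : WithConv (C →ₗ[ℂ] A)) (ω : Fn A) :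
    toConv (ω.ofConv ∘ₗ (f * toConv (Algebra.linearMap ℂ A ∘ₗ φ.ofConv)).ofConv) =
      toConv (ω.ofConv ∘ₗ f.ofConv) * φ := by
  apply Fn.ext_apply
  intro c
  rw [LinearMap.convMul_apply]
  change ω.ofConv (LinearMap.mul' ℂ A (TensorProduct.map _ _ (comul c))) = _
  generalize comul (R := ℂ) c = t
  induction t with
  | zero => simp
  | add s t hs ht => simp only [map_add, hs, ht]
  | tmul a b => simp [Algebra.algebraMap_eq_smul_one, mul_comm]

end Conv

/-- The deformed product `γ * m * γ⁻¹`, tested by functionals. -/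
lemma TwoCocycle.comp_mul (ω : Fn A) : toConv (ω.ofConv ∘ₗ γ.mul) =
    γ.fn * pull (TwoCocycle.mulHom A) ω * γ.fnInv := by
  rw [TwoCocycle.mul]
  exact (comp_mul_linearMap γ.fnInv _ ω).trans
    congr($(comp_linearMap_mul γ.fn (toConv (LinearMap.mul' ℂ A)) ω) * γ.fnInv)

lemma box_coact {C V : Type*} [AddCommGroup C] [Module ℂ C] [AddCommGroup V] [Module ℂ V]
    [LeftCoaction C V] (φ : Fn C) (ξ : Fn V) (v : V) :
    box φ ξ (coact C v) = act φ ξ.ofConv v := by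
  rw [act_apply]
  generalize coact C v = t
  induction t with
  | zero => simp
  | add s t hs ht => simp only [map_add, hs, ht]
  | tmul a b => simp

lemma box_map {C D V W : Type*} [AddCommGroup C] [Module ℂ C] [AddCommGroup D] [Module ℂ D]
    [AddCommGroup V] [Module ℂ V] [AddCommGroup W] [Module ℂ W]
    (φ : Fn D) (ξ : Fn W) (f : C →ₗ[ℂ] D) (g : V →ₗ[ℂ] W) (t : C ⊗[ℂ] V) :
    box φ ξ (TensorProduct.map f g t) =
      box (toConv (φ.ofConv ∘ₗ f)) (toConv (ξ.ofConv ∘ₗ g)) t := by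
  induction t with
  | zero => simp
  | add s t hs ht => simp only [map_add, hs, ht]
  | tmul a b => simp

/-- The twist of a colinear map is colinear for the deformed product. -/
theorem coact_twist [IsComod A X] [IsComod A Y] {μ : X →ₗ[ℂ] Y →ₗ[ℂ] P} (hμ : Colinear A μ)
    (z : X ⊗[ℂ] Y) : coact A (γ.twist μ z) =
      TensorProduct.map γ.mul (γ.twist μ) (coact (A ⊗[ℂ] A) z) := by
  refine eq_of_box fun φ ξ => ?_
  rw [box_coact, box_map, box_coact, γ.comp_mul, twist_eq_act, apply_act (C := A ⊗[ℂ] A),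
    hμ.act_comp, act_act, ofConv_toConv, comp_act, act_act, mul_assoc, γ.fnInv_mul_fn, mul_one]

end Colinear

/-! ### Matrix coefficients -/

section Comatrix

variable {C : Type*} [AddCommGroup C] [Module ℂ C] [Coalgebra ℂ C]
  {ι : Type*} [Fintype ι] [DecidableEq ι]

/-- A square matrix `a` of elements of a coalgebra with `Δ(aᵢⱼ) = ∑ aᵢₗ ⊗ aₗⱼ` and `ε(aᵢⱼ) = δᵢⱼ`,
that is the matrix of coefficients of a finite-dimensional comodule. -/
structure IsComatrix (a : ι → ι → C) : Prop where
  comul_eq : ∀ i j, comul (R := ℂ) (a i j) = ∑ l, a i l ⊗ₜ[ℂ] a l j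
  counit_eq : ∀ i j, counit (R := ℂ) (a i j) = if i = j then 1 else 0

/-- Every element of a coalgebra is a linear combination of the entries of a comatrix, namely of the
matrix of coefficients of the left subcomodule that it generates. -/
theorem exists_isComatrix (c : C) : ∃ (n : ℕ) (a : Fin n → Fin n → C), IsComatrix a ∧
    c ∈ Submodule.span ℂ (Set.range fun p : Fin n × Fin n => a p.1 p.2) := by
  classical
  let e := Module.Basis.ofVectorSpace ℂ C
  let y := TensorProduct.equivFinsuppOfBasisLeft (N := C) e (comul (R := ℂ) c)
  have hy : comul (R := ℂ) c = ∑ α ∈ y.support, e α ⊗ₜ[ℂ] y α := by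
    conv_lhs => rw [← (TensorProduct.equivFinsuppOfBasisLeft (N := C) e).symm_apply_apply
      (comul (R := ℂ) c)]
    rw [TensorProduct.equivFinsuppOfBasisLeft_symm_apply]
    rfl
  have hyα : ∀ α, y α = TensorProduct.lid ℂ C ((e.coord α).rTensor C (comul (R := ℂ) c)) :=
    fun α => TensorProduct.equivFinsuppOfBasisLeft_apply e _ α
  let V : Submodule ℂ C := Submodule.span ℂ (y '' y.support)
  have : Module.Finite ℂ V := Module.Finite.span_of_finite ℂ (y.support.finite_toSet.image _)
  have hyV : ∀ α ∈ y.support, y α ∈ V := fun α hα => Submodule.subset_span ⟨α, hα, rfl⟩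
  let b := Module.finBasis ℂ V
  -- elements of `C ⊗ V` in terms of the basis of `V`
  have hT : ∀ (x : C) (v : C), v ∈ V → ∃ z : Fin _ → C, x ⊗ₜ[ℂ] v = ∑ j, z j ⊗ₜ[ℂ] (b j : C) := by
    intro x v hv
    refine ⟨fun j => b.repr ⟨v, hv⟩ j • x, ?_⟩
    have h := congr(x ⊗ₜ[ℂ] V.subtype $(b.sum_repr ⟨v, hv⟩))
    rw [map_sum, TensorProduct.tmul_sum] at h
    simpa [TensorProduct.smul_tmul] using h.symm
  let T : Submodule ℂ (C ⊗[ℂ] C) :=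
    { carrier := {t | ∃ z : Fin _ → C, t = ∑ j, z j ⊗ₜ[ℂ] (b j : C)}
      zero_mem' := ⟨0, by simp⟩
      add_mem' := by
        rintro _ _ ⟨z, rfl⟩ ⟨z', rfl⟩
        exact ⟨z + z', by simp [TensorProduct.add_tmul, Finset.sum_add_distrib]⟩
      smul_mem' := by
        rintro r _ ⟨z, rfl⟩
        exact ⟨r • z, by simp [Finset.smul_sum, TensorProduct.smul_tmul']⟩ }
  have hΔ : ∀ v ∈ V, comul (R := ℂ) v ∈ T := by
    intro v hv
    suffices V ≤ T.comap (comul (R := ℂ)) from this hv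
    rw [Submodule.span_le]
    rintro _ ⟨α, hα, rfl⟩
    -- slice the coassociativity relation for `c` with the `α`-th coordinate
    have h1 : ∀ t : C ⊗[ℂ] C, comul (R := ℂ) (TensorProduct.lid ℂ C ((e.coord α).rTensor C t)) =
        TensorProduct.lid ℂ _ ((e.coord α).rTensor _ ((comul (R := ℂ)).lTensor C t)) := by
      intro t
      induction t with
      | zero => simp
      | add s t hs ht => simp only [map_add, hs, ht]
      | tmul a b => simp
    change comul (R := ℂ) (y α) ∈ T
    rw [hyα, h1, ← Coalgebra.coassoc_apply, hy]
    simp only [map_sum, LinearMap.rTensor_tmul]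
    refine Submodule.sum_mem _ fun β hβ => ?_
    generalize comul (R := ℂ) (e β) = s
    induction s with
    | zero => simp
    | add s t hs ht => simpa only [TensorProduct.add_tmul, map_add] using add_mem hs ht
    | tmul a a' =>
      simp only [TensorProduct.assoc_tmul, LinearMap.rTensor_tmul, TensorProduct.lid_tmul]
      exact T.smul_mem _ (hT a' _ (hyV β hβ))
  choose a ha using fun i => hΔ _ (b i).2
  have hβ : ∀ l, ∃ β : C →ₗ[ℂ] ℂ, ∀ j, β (b j) = if l = j then 1 else 0 := by
    intro l
    obtain ⟨β, hβ⟩ := LinearMap.exists_extend (b.coord l)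
    refine ⟨β, fun j => ?_⟩
    have := congr($hβ (b j))
    rw [LinearMap.comp_apply, V.subtype_apply] at this
    rw [this, b.coord_apply, b.repr_self, Finsupp.single_apply]
    simp [eq_comm]
  choose β hβ using hβ
  refine ⟨_, a, ⟨fun i j => ?_, fun i j => ?_⟩, ?_⟩
  · have h := Coalgebra.coassoc_apply (R := ℂ) (b i : C)
    rw [ha] at h
    have h2 := congr(TensorProduct.rid ℂ _
        ((β j).lTensor _ ((TensorProduct.assoc ℂ C C C).symm $h)))
    simpa [ha, TensorProduct.tmul_sum, hβ] using h2
  · have h := rTensor_counit_comul (R := ℂ) (b i : C)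
    rw [ha] at h
    have h2 := congr(β j (TensorProduct.lid ℂ _ $h))
    simpa [hβ, eq_comm] using h2
  · have hb : ∀ i, (b i : C) ∈ Submodule.span ℂ (Set.range fun p : _ × _ => a p.1 p.2) := by
      intro i
      have h := lTensor_counit_comul (R := ℂ) (b i : C)
      rw [ha] at h
      have h2 := congr(TensorProduct.rid ℂ _ $h)
      simp only [map_sum, LinearMap.lTensor_tmul, TensorProduct.rid_tmul, one_smul] at h2
      rw [← h2]
      exact Submodule.sum_mem _ fun j _ => Submodule.smul_mem _ _ (Submodule.subset_span ⟨(i, j),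
          rfl⟩)
    have hc : c ∈ V := by
      have h := rTensor_counit_comul (R := ℂ) c
      rw [hy] at h
      have h2 := congr(TensorProduct.lid ℂ _ $h)
      simp only [map_sum, LinearMap.rTensor_tmul, TensorProduct.lid_tmul, one_smul] at h2
      rw [← h2]
      exact Submodule.sum_mem _ fun α hα => Submodule.smul_mem _ _ (hyV α hα)
    have h := congr(V.subtype $(b.sum_repr ⟨c, hc⟩))
    rw [map_sum] at h
    simp only [V.subtype_apply] at h
    rw [← h]
    exact Submodule.sum_mem _ fun j _ => Submodule.smul_mem _ _ (hb j)

/-- Linear maps out of a coalgebra are determined by their values on comatrices. -/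
lemma ext_comatrix {X : Type*} [AddCommGroup X] [Module ℂ X] {f g : C →ₗ[ℂ] X}
    (h : ∀ (n : ℕ) (a : Fin n → Fin n → C), IsComatrix a → ∀ i j, f (a i j) = g (a i j)) :
    f = g := by
  ext c
  obtain ⟨n, a, ha, hc⟩ := exists_isComatrix c
  refine LinearMap.eqOn_span ?_ hc
  rintro _ ⟨p, rfl⟩
  exact h n a ha p.1 p.2

end Comatrix

section Antipode

variable {A : Type u} [Ring A] [HopfAlgebra ℂ A]
  {ι : Type*} [Fintype ι] [DecidableEq ι] {a : ι → ι → A}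

lemma IsComatrix.sum_antipode_mul (ha : IsComatrix a) (i j : ι) :
    ∑ l, HopfAlgebra.antipode ℂ (a i l) * a l j = if i = j then 1 else 0 := by
  have h := HopfAlgebra.mul_antipode_rTensor_comul_apply (R := ℂ) (a i j)
  rw [ha.comul_eq, ha.counit_eq] at h
  simpa [apply_ite] using h

lemma IsComatrix.sum_mul_antipode (ha : IsComatrix a) (i j : ι) :
    ∑ l, a i l * HopfAlgebra.antipode ℂ (a l j) = if i = j then 1 else 0 := by
  have h := HopfAlgebra.mul_antipode_lTensor_comul_apply (R := ℂ) (a i j)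
  rw [ha.comul_eq, ha.counit_eq] at h
  simpa [apply_ite] using h

variable (A) in
/-- The antipode reverses the coproduct. -/
lemma comul_comp_antipode : comul (R := ℂ) ∘ₗ HopfAlgebra.antipode ℂ (A := A) =
    TensorProduct.map (HopfAlgebra.antipode ℂ) (HopfAlgebra.antipode ℂ) ∘ₗ
        (TensorProduct.comm ℂ A A).toLinearMap ∘ₗ comul := by
  have h : toConv (TensorProduct.map (HopfAlgebra.antipode ℂ) (HopfAlgebra.antipode ℂ) ∘ₗ
      (TensorProduct.comm ℂ A A).toLinearMap ∘ₗ comul) *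
      toConv (comul (R := ℂ) (A := A)) = 1 := by
    apply WithConv.ext
    refine ext_comatrix fun n a ha i j => ?_
    rw [LinearMap.convMul_apply, LinearMap.convOne_apply]
    simp only [ha.comul_eq, ha.counit_eq, map_sum, TensorProduct.map_tmul,
      LinearMap.comp_apply, LinearEquiv.coe_coe, TensorProduct.comm_tmul, LinearMap.mul'_apply,
      Finset.sum_mul_sum, Algebra.TensorProduct.tmul_mul_tmul]
    calc ∑ m, ∑ l, ∑ p, (HopfAlgebra.antipode ℂ (a l m) * a m p) ⊗ₜ[ℂ]
        (HopfAlgebra.antipode ℂ (a i l) * a p j)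
        = ∑ l, ∑ p, (∑ m, HopfAlgebra.antipode ℂ (a l m) * a m p) ⊗ₜ[ℂ]
            (HopfAlgebra.antipode ℂ (a i l) * a p j) := by
          rw [Finset.sum_comm]
          refine Finset.sum_congr rfl fun l _ => ?_
          rw [Finset.sum_comm]
          simp only [TensorProduct.sum_tmul]
      _ = ∑ l, 1 ⊗ₜ[ℂ] (HopfAlgebra.antipode ℂ (a i l) * a l j) := by
          simp only [ha.sum_antipode_mul]
          refine Finset.sum_congr rfl fun l _ => ?_
          rw [Finset.sum_eq_single l]
          · simp
          · intro p _ hp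
            simp [hp.symm]
          · simp
      _ = _ := by
          rw [← TensorProduct.tmul_sum, ha.sum_antipode_mul]
          split_ifs <;> simp
  exact congr(ofConv $(left_inv_eq_right_inv h LinearMap.comul_right_inv)).symm

lemma comul_antipode (x : A) : comul (R := ℂ) (HopfAlgebra.antipode ℂ x) =
    TensorProduct.map (HopfAlgebra.antipode ℂ) (HopfAlgebra.antipode ℂ)
        (TensorProduct.comm ℂ A A (comul x)) :=
  congr($(comul_comp_antipode A) x)

lemma IsComatrix.comul_antipode (ha : IsComatrix a) (i j : ι) :
    comul (R := ℂ) (HopfAlgebra.antipode ℂ (a i j)) =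
    ∑ l, HopfAlgebra.antipode ℂ (a l j) ⊗ₜ[ℂ] HopfAlgebra.antipode ℂ (a i l) := by
  simp [RelHopf.comul_antipode, ha.comul_eq]

end Antipode

/-! ### The functionals `U` and `Ū` -/

namespace TwoCocycle

variable {A : Type u} [Ring A] [HopfAlgebra ℂ A] (γ : TwoCocycle A)

/-- `U` in the convolution algebra. -/
def fnU : Fn A := toConv γ.U

/-- `Ū` in the convolution algebra. -/
def fnUbar : Fn A := toConv γ.Ubar

section

variable {ι : Type*} [Fintype ι] [DecidableEq ι] {a : ι → ι → A}

lemma U_comatrix (ha : IsComatrix a) (i j : ι) :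
    γ.U (a i j) = ∑ l, γ.val (a i l ⊗ₜ HopfAlgebra.antipode ℂ (a l j)) := by
  simp [U, ha.comul_eq]

lemma Ubar_comatrix (ha : IsComatrix a) (i j : ι) :
    γ.Ubar (a i j) = ∑ l, γ.inv (HopfAlgebra.antipode ℂ (a i l) ⊗ₜ a l j) := by
  simp [Ubar, ha.comul_eq]

end

/-- The morphism of coalgebras `h ↦ h ⊗ 1`. -/
def unitRight (A : Type u) [Ring A] [HopfAlgebra ℂ A] : A →ₗc[ℂ] A ⊗[ℂ] A where
  toLinearMap := (TensorProduct.mk ℂ A A).flip 1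
  counit_comp := by ext; simp
  map_comp_comul := by
    ext h
    simp only [LinearMap.comp_apply, LinearMap.flip_apply, TensorProduct.mk_apply,
      TensorProduct.comul_tmul, Bialgebra.comul_one]
    generalize comul (R := ℂ) h = t
    induction t with
    | zero => simp
    | add s t hs ht => simp only [map_add, TensorProduct.add_tmul, hs, ht]
    | tmul a b => simp [Algebra.TensorProduct.one_def]

/-- The morphism of coalgebras `h ↦ 1 ⊗ h`. -/
def unitLeft (A : Type u) [Ring A] [HopfAlgebra ℂ A] : A →ₗc[ℂ] A ⊗[ℂ] A where
  toLinearMap := TensorProduct.mk ℂ A A 1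
  counit_comp := by ext; simp
  map_comp_comul := by
    ext h
    simp only [LinearMap.comp_apply, TensorProduct.mk_apply,
      TensorProduct.comul_tmul, Bialgebra.comul_one]
    generalize comul (R := ℂ) h = t
    induction t with
    | zero => simp
    | add s t hs ht => simp only [map_add, TensorProduct.tmul_add, hs, ht]
    | tmul a b => simp [Algebra.TensorProduct.one_def]

@[simp] lemma unitRight_apply (h : A) : unitRight A h = h ⊗ₜ 1 := rfl

@[simp] lemma unitLeft_apply (h : A) : unitLeft A h = 1 ⊗ₜ h := rfl

lemma pull_unitRight_fn : pull (unitRight A) γ.fn = 1 := Fn.ext_apply γ.val_one_right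

lemma pull_unitLeft_fn : pull (unitLeft A) γ.fn = 1 := Fn.ext_apply γ.val_one_left

lemma pull_unitRight_fnInv : pull (unitRight A) γ.fnInv = 1 := by
  have h := map_mul (pull (unitRight A)) γ.fn γ.fnInv
  rwa [fn_mul_fnInv, map_one, pull_unitRight_fn, one_mul, eq_comm] at h

lemma pull_unitLeft_fnInv : pull (unitLeft A) γ.fnInv = 1 := by
  have h := map_mul (pull (unitLeft A)) γ.fn γ.fnInv
  rwa [fn_mul_fnInv, map_one, pull_unitLeft_fn, one_mul, eq_comm] at h

lemma inv_one_right (h : A) : γ.inv (h ⊗ₜ 1) = counit (R := ℂ) h :=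
  congr(ofConv $(γ.pull_unitRight_fnInv) h)

lemma inv_one_left (h : A) : γ.inv (1 ⊗ₜ h) = counit (R := ℂ) h :=
  congr(ofConv $(γ.pull_unitLeft_fnInv) h)

/-- `γ⁻¹(h₁ ⊗ k) γ(g ⊗ h₂) = γ(g₁ ⊗ h₁ k₁) γ⁻¹(g₂ h₂ ⊗ k₂)`. -/
lemma box_inv_mul_box : pull (assocHom A) (box 1 γ.fnInv) * box γ.fn 1 =
    pull (assocHom A) (pull (mulRight A) γ.fn) * pull (mulLeft A) γ.fnInv := by
  have h1 : pull (assocHom A) (box 1 γ.fnInv) * pull (assocHom A) (box 1 γ.fn) = 1 := by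
    rw [← map_mul, box_mul_box, one_mul, fnInv_mul_fn, box_one_one, map_one]
  have h2 : pull (mulLeft A) γ.fn * pull (mulLeft A) γ.fnInv = 1 := by
    rw [← map_mul, fn_mul_fnInv, map_one]
  have h := γ.cocycle_fn
  rw [map_mul] at h
  calc _ = pull (assocHom A) (box 1 γ.fnInv) * (box γ.fn 1 * pull (mulLeft A) γ.fn) *
        pull (mulLeft A) γ.fnInv := by rw [mul_assoc, mul_assoc, h2, mul_one]
    _ = _ := by rw [h, ← mul_assoc, h1, one_mul]

/-- `γ(g₁ h₁ ⊗ k₁) γ⁻¹(g₂ ⊗ h₂ k₂) = γ⁻¹(g ⊗ h₁) γ(h₂ ⊗ k)`. -/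
lemma pull_mul_pull_inv : pull (mulLeft A) γ.fn * pull (assocHom A) (pull (mulRight A) γ.fnInv) =
    box γ.fnInv 1 * pull (assocHom A) (box 1 γ.fn) := by
  have h1 : box γ.fnInv (1 : Fn A) * box γ.fn 1 = 1 := by
    rw [box_mul_box, one_mul, fnInv_mul_fn, box_one_one]
  have h2 : pull (assocHom A) (pull (mulRight A) γ.fn) *
      pull (assocHom A) (pull (mulRight A) γ.fnInv) = 1 := by
    rw [← map_mul, ← map_mul, fn_mul_fnInv, map_one, map_one]
  have h := γ.cocycle_fn
  rw [map_mul] at h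
  calc _ = box γ.fnInv 1 * (box γ.fn 1 * pull (mulLeft A) γ.fn) *
        pull (assocHom A) (pull (mulRight A) γ.fnInv) := by rw [← mul_assoc, h1, one_mul]
    _ = _ := by rw [h, mul_assoc, mul_assoc, h2, mul_one]

/-- Reordering of a triple sum of products. -/
lemma sum_comm_mul {ι ι' κ R : Type*} [Fintype ι] [Fintype ι'] [Fintype κ] [CommRing R]
    (F : ι → κ → R) (G : ι' → κ → R) :
    ∑ l, ∑ p, ∑ x, F p x * G l x = ∑ x, (∑ p, F p x) * ∑ l, G l x := by
  rw [Finset.sum_comm, Finset.sum_congr rfl fun p _ => Finset.sum_comm, Finset.sum_comm]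
  refine Finset.sum_congr rfl fun x _ => ?_
  rw [Finset.sum_mul_sum]

lemma fnU_mul_fnUbar : γ.fnU * γ.fnUbar = 1 := by
  apply WithConv.ext
  refine ext_comatrix fun n a ha i j => ?_
  -- evaluate at `a₁ ⊗ S(a₂) ⊗ a₃`
  have h1 : ∀ l p, ∑ m, γ.val (a i l ⊗ₜ[ℂ] HopfAlgebra.antipode ℂ (a l m)) *
      γ.inv (HopfAlgebra.antipode ℂ (a m p) ⊗ₜ[ℂ] a p j) =
      ∑ x, ∑ y, ∑ z, γ.val (a i z ⊗ₜ[ℂ] (HopfAlgebra.antipode ℂ (a y p) * a p x)) *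
        γ.inv ((a z l * HopfAlgebra.antipode ℂ (a l y)) ⊗ₜ[ℂ] a x j) := by
    intro l p
    have h := congr(ofConv $(γ.box_inv_mul_box) ((a i l ⊗ₜ HopfAlgebra.antipode ℂ (a l p)) ⊗ₜ
        a p j))
    simpa [ha.comul_eq, ha.counit_eq, ha.comul_antipode, TensorProduct.sum_tmul,
      TensorProduct.tmul_sum, mul_comm (γ.inv _)] using h
  rw [LinearMap.convOne_apply, LinearMap.convMul_apply]
  simp only [ha.comul_eq, ha.counit_eq, map_sum, TensorProduct.map_tmul, LinearMap.mul'_apply]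
  simp only [fnU, fnUbar, γ.U_comatrix ha, γ.Ubar_comatrix ha]
  calc _ = ∑ l, ∑ p, ∑ m, γ.val (a i l ⊗ₜ[ℂ] HopfAlgebra.antipode ℂ (a l m)) *
      γ.inv (HopfAlgebra.antipode ℂ (a m p) ⊗ₜ[ℂ] a p j) := by
        rw [Finset.sum_comm]
        exact (sum_comm_mul (fun l m => γ.val (a i l ⊗ₜ[ℂ] HopfAlgebra.antipode ℂ (a l m)))
          (fun p m => γ.inv (HopfAlgebra.antipode ℂ (a m p) ⊗ₜ[ℂ] a p j))).symm
    _ = ∑ x : _ × _ × _, γ.val (a i x.2.2 ⊗ₜ[ℂ] ∑ p, HopfAlgebra.antipode ℂ (a x.2.1 p) * a p x.1) *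
        γ.inv ((∑ l, a x.2.2 l * HopfAlgebra.antipode ℂ (a l x.2.1)) ⊗ₜ[ℂ] a x.1 j) := by
        simp only [h1, TensorProduct.tmul_sum, TensorProduct.sum_tmul, map_sum]
        rw [← sum_comm_mul]
        simp only [Fintype.sum_prod_type]
    _ = _ := by
        simp only [ha.sum_antipode_mul, ha.sum_mul_antipode, Fintype.sum_prod_type]
        simp [apply_ite γ.val, apply_ite γ.inv, TensorProduct.tmul_ite, TensorProduct.ite_tmul,
          γ.val_one_right, γ.inv_one_left, ha.counit_eq]

lemma fnUbar_mul_fnU : γ.fnUbar * γ.fnU = 1 := by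
  apply WithConv.ext
  refine ext_comatrix fun n a ha i j => ?_
  -- evaluate at `S(a₁) ⊗ a₂ ⊗ S(a₃)`
  have h1 : ∀ l p, ∑ m, γ.inv (HopfAlgebra.antipode ℂ (a i l) ⊗ₜ[ℂ] a l m) *
      γ.val (a m p ⊗ₜ[ℂ] HopfAlgebra.antipode ℂ (a p j)) =
      ∑ x, ∑ y, ∑ z, γ.inv (HopfAlgebra.antipode ℂ (a i z) ⊗ₜ[ℂ]
          (a y p * HopfAlgebra.antipode ℂ (a p x))) *
        γ.val ((HopfAlgebra.antipode ℂ (a z l) * a l y) ⊗ₜ[ℂ] HopfAlgebra.antipode ℂ (a x j)) := by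
    intro l p
    have h := congr(ofConv $(γ.pull_mul_pull_inv) ((HopfAlgebra.antipode ℂ (a i l) ⊗ₜ a l p) ⊗ₜ
        HopfAlgebra.antipode ℂ (a p j)))
    simpa [ha.comul_eq, ha.counit_eq, ha.comul_antipode, TensorProduct.sum_tmul,
      TensorProduct.tmul_sum, mul_comm (γ.val _)] using h.symm
  rw [LinearMap.convOne_apply, LinearMap.convMul_apply]
  simp only [ha.comul_eq, ha.counit_eq, map_sum, TensorProduct.map_tmul, LinearMap.mul'_apply]
  simp only [fnU, fnUbar, γ.U_comatrix ha, γ.Ubar_comatrix ha]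
  calc _ = ∑ l, ∑ p, ∑ m, γ.inv (HopfAlgebra.antipode ℂ (a i l) ⊗ₜ[ℂ] a l m) *
      γ.val (a m p ⊗ₜ[ℂ] HopfAlgebra.antipode ℂ (a p j)) := by
        rw [Finset.sum_comm]
        exact (sum_comm_mul (fun l m => γ.inv (HopfAlgebra.antipode ℂ (a i l) ⊗ₜ[ℂ] a l m))
          (fun p m => γ.val (a m p ⊗ₜ[ℂ] HopfAlgebra.antipode ℂ (a p j)))).symm
    _ = ∑ x : _ × _ × _, γ.inv (HopfAlgebra.antipode ℂ (a i x.2.2) ⊗ₜ[ℂ] ∑ p, a x.2.1 p *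
        HopfAlgebra.antipode ℂ (a p x.1)) *
        γ.val ((∑ l, HopfAlgebra.antipode ℂ (a x.2.2 l) * a l x.2.1) ⊗ₜ[ℂ]
            HopfAlgebra.antipode ℂ (a x.1 j)) := by
        simp only [h1, TensorProduct.tmul_sum, TensorProduct.sum_tmul, map_sum]
        rw [← sum_comm_mul]
        simp only [Fintype.sum_prod_type]
    _ = _ := by
        simp only [ha.sum_antipode_mul, ha.sum_mul_antipode, Fintype.sum_prod_type]
        simp [apply_ite γ.val, apply_ite γ.inv, TensorProduct.tmul_ite, TensorProduct.ite_tmul,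
          γ.val_one_left, γ.inv_one_right, ha.counit_eq]

end TwoCocycle

/-! ### Compatibility of `U` with the product -/

variable {A : Type u} [Ring A] [HopfAlgebra ℂ A]

lemma ext_comatrix₂ {X : Type*} [AddCommGroup X] [Module ℂ X] {f g : A ⊗[ℂ] A →ₗ[ℂ] X}
    (h : ∀ (n m : ℕ) (a : Fin n → Fin n → A) (b : Fin m → Fin m → A), IsComatrix a →
      IsComatrix b → ∀ i j p q, f (a i j ⊗ₜ b p q) = g (a i j ⊗ₜ b p q)) : f = g := by
  refine TensorProduct.ext (ext_comatrix fun n a ha i j => ext_comatrix fun m b hb p q => ?_)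
  exact h n m a b ha hb i j p q

/-- The linear map `s` reverses the coproduct. -/
def AntiComul (s : A →ₗ[ℂ] A) : Prop :=
  ∀ x, comul (R := ℂ) (s x) = TensorProduct.map s s (TensorProduct.comm ℂ A A (comul x))

lemma AntiComul.comatrix {s : A →ₗ[ℂ] A} (hs : AntiComul s) {ι : Type*} [Fintype ι]
    [DecidableEq ι] {a : ι → ι → A} (ha : IsComatrix a) (i j : ι) :
    comul (R := ℂ) (s (a i j)) = ∑ l, s (a l j) ⊗ₜ[ℂ] s (a i l) := by
  simp [hs (a i j), ha.comul_eq]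

/-- Pulling back a functional on `A ⊗ A` along `a ⊗ b ↦ s(b) ⊗ s(a)`. -/
def antiFlip (s : A →ₗ[ℂ] A) (φ : Fn (A ⊗[ℂ] A)) : Fn (A ⊗[ℂ] A) :=
  toConv (φ.ofConv ∘ₗ (TensorProduct.comm ℂ A A).toLinearMap ∘ₗ TensorProduct.map s s)

@[simp] lemma antiFlip_tmul (s : A →ₗ[ℂ] A) (φ : Fn (A ⊗[ℂ] A)) (a b : A) :
    antiFlip s φ (a ⊗ₜ b) = φ (s b ⊗ₜ s a) := rfl

lemma antiFlip_mul {s : A →ₗ[ℂ] A} (hs : AntiComul s) (φ ψ : Fn (A ⊗[ℂ] A)) :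
    antiFlip s (φ * ψ) = antiFlip s ψ * antiFlip s φ := by
  apply WithConv.ext
  refine ext_comatrix₂ fun n m a b ha hb i j p q => ?_
  have h : (antiFlip s (φ * ψ)) (a i j ⊗ₜ b p q) = (φ * ψ) (s (b p q) ⊗ₜ s (a i j)) := rfl
  rw [h, LinearMap.convMul_apply, LinearMap.convMul_apply]
  simp only [TensorProduct.comul_tmul, hs.comatrix ha, hs.comatrix hb, ha.comul_eq, hb.comul_eq,
    TensorProduct.sum_tmul, TensorProduct.tmul_sum, map_sum,
    TensorProduct.AlgebraTensorModule.tensorTensorTensorComm_tmul, TensorProduct.map_tmul,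
    LinearMap.mul'_apply, antiFlip_tmul]
  rw [Finset.sum_comm]
  simp only [mul_comm]

lemma antiFlip_one {s : A →ₗ[ℂ] A} (hs : ∀ x, counit (R := ℂ) (s x) = counit (R := ℂ) x) :
    antiFlip s 1 = 1 := by
  apply WithConv.ext
  ext a b
  simp [antiFlip, LinearMap.convOne_def, hs, mul_comm]

/-- Pulling back a functional on `A` along `s`. -/
def antiPull (s : A →ₗ[ℂ] A) (φ : Fn A) : Fn A := toConv (φ.ofConv ∘ₗ s)

lemma antiPull_mul {s : A →ₗ[ℂ] A} (hs : AntiComul s) (φ ψ : Fn A) :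
    antiPull s (φ * ψ) = antiPull s ψ * antiPull s φ := by
  apply WithConv.ext
  refine ext_comatrix fun n a ha i j => ?_
  have h : (antiPull s (φ * ψ)) (a i j) = (φ * ψ) (s (a i j)) := rfl
  rw [h, LinearMap.convMul_apply, LinearMap.convMul_apply]
  simp [hs.comatrix ha, ha.comul_eq, antiPull, mul_comm]

lemma antiComul_antipode : AntiComul (HopfAlgebra.antipode ℂ (A := A)) := comul_antipode

namespace TwoCocycle

variable (γ : TwoCocycle A)

/-- The auxiliary functional `h ⊗ g ↦ γ(g₁ ⊗ S(g₂) S(h))`. -/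
def aux : Fn (A ⊗[ℂ] A) := toConv (γ.val ∘ₗ
  (LinearMap.mul' ℂ A ∘ₗ TensorProduct.map (HopfAlgebra.antipode ℂ)
      (HopfAlgebra.antipode ℂ)).lTensor A ∘ₗ
  (TensorProduct.assoc ℂ A A A).toLinearMap ∘ₗ (comul (R := ℂ)).rTensor A ∘ₗ
  (TensorProduct.comm ℂ A A).toLinearMap)

lemma aux_comatrix {ι : Type*} [Fintype ι] [DecidableEq ι] {b : ι → ι → A} (hb : IsComatrix b)
    (h : A) (p q : ι) : γ.aux (h ⊗ₜ b p q) =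
        ∑ r, γ.val (b p r ⊗ₜ (HopfAlgebra.antipode ℂ (b r q) * HopfAlgebra.antipode ℂ h)) := by
  simp [aux, hb.comul_eq, TensorProduct.sum_tmul]

/-- The cocycle identity for elements with given coproducts. -/
lemma cocycle_sum {ι κ ρ : Type*} [Fintype ι] [Fintype κ] [Fintype ρ] {g h k : A}
    {g₁ g₂ : ι → A} {h₁ h₂ : κ → A} {k₁ k₂ : ρ → A}
    (hg : comul (R := ℂ) g = ∑ i, g₁ i ⊗ₜ[ℂ] g₂ i) (hh : comul (R := ℂ) h = ∑ i, h₁ i ⊗ₜ[ℂ] h₂ i)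
    (hk : comul (R := ℂ) k = ∑ i, k₁ i ⊗ₜ[ℂ] k₂ i) :
    ∑ i, ∑ j, γ.val (g₁ i ⊗ₜ h₁ j) * γ.val ((g₂ i * h₂ j) ⊗ₜ k) =
      ∑ j, ∑ l, γ.val (h₁ j ⊗ₜ k₁ l) * γ.val (g ⊗ₜ (h₂ j * k₂ l)) := by
  have h := γ.cocycle g h k
  simp only [LinearMap.convMul_apply, TensorProduct.comul_tmul, hg, hh, hk, TensorProduct.sum_tmul,
    TensorProduct.tmul_sum, map_sum, TensorProduct.map_tmul, LinearMap.comp_apply,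
    TensorProduct.AlgebraTensorModule.tensorTensorTensorComm_tmul, LinearMap.mul'_apply,
    LinearMap.flip_apply, TensorProduct.mk_apply] at h
  rw [Finset.sum_comm, h, Finset.sum_comm]

/-- Reordering of a fourfold sum. -/
lemma sum_comm_pairs {α β κ ρ R : Type*} [Fintype α] [Fintype β] [Fintype κ] [Fintype ρ]
    [AddCommMonoid R] (f : α → β → κ → ρ → R) :
    ∑ a, ∑ b, ∑ c, ∑ d, f a b c d = ∑ c, ∑ d, ∑ a, ∑ b, f a b c d := by
  have h := Finset.sum_comm (s := Finset.univ) (t := Finset.univ)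
    (f := fun (x : α × β) (y : κ × ρ) => f x.1 x.2 y.1 y.2)
  simpa only [Fintype.sum_prod_type] using h

/-- `γ(h₁ ⊗ g₁) U(h₂ g₂) = U(h₁) γ(g₁ ⊗ S(g₂) S(h₂))`. -/
lemma fn_mul_pull_fnU : γ.fn * pull (mulHom A) γ.fnU = box γ.fnU 1 * γ.aux := by
  apply WithConv.ext
  refine ext_comatrix₂ fun n m a b ha hb i j p q => ?_
  -- the cocycle identity at `h₁ ⊗ g₁ ⊗ S(h₂ g₂)`
  have h1 := fun r s => γ.cocycle_sum
    (k := HopfAlgebra.antipode ℂ (b s q) * HopfAlgebra.antipode ℂ (a r j))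
    (k₁ := fun x : Fin m × Fin n => HopfAlgebra.antipode ℂ (b x.1 q) *
        HopfAlgebra.antipode ℂ (a x.2 j))
    (k₂ := fun x => HopfAlgebra.antipode ℂ (b s x.1) * HopfAlgebra.antipode ℂ (a r x.2))
    (ha.comul_eq i r) (hb.comul_eq p s) (by
      simp [Bialgebra.comul_mul, ha.comul_antipode, hb.comul_antipode, Finset.sum_mul_sum,
        Fintype.sum_prod_type])
  have hU : ∀ l r, γ.U (a l j * b r q) =
      ∑ x, ∑ s, γ.val ((a l x * b r s) ⊗ₜ
      (HopfAlgebra.antipode ℂ (b s q) * HopfAlgebra.antipode ℂ (a x j))) := by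
    intro l r
    simp [U, Bialgebra.comul_mul, ha.comul_eq, hb.comul_eq, Finset.sum_mul_sum,
      HopfAlgebra.antipode_mul_antidistrib]
  rw [LinearMap.convMul_apply, LinearMap.convMul_apply]
  simp only [TensorProduct.comul_tmul, ha.comul_eq, hb.comul_eq,
    TensorProduct.sum_tmul, TensorProduct.tmul_sum, map_sum,
    TensorProduct.AlgebraTensorModule.tensorTensorTensorComm_tmul, TensorProduct.map_tmul,
    LinearMap.mul'_apply, pull_apply, mulHom_apply, box_tmul, fn_apply, aux_comatrix _ hb]
  simp only [fnU, hU, γ.U_comatrix ha]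
  calc _ = ∑ r, ∑ s, ∑ l, ∑ t, γ.val (a i l ⊗ₜ b p t) *
        γ.val ((a l r * b t s) ⊗ₜ (HopfAlgebra.antipode ℂ (b s q) *
            HopfAlgebra.antipode ℂ (a r j))) := by
        simp only [Finset.mul_sum]
        rw [Finset.sum_comm, sum_comm_pairs]
    _ = ∑ r, ∑ t, ∑ x : _ × _, γ.val (b p t ⊗ₜ
        (HopfAlgebra.antipode ℂ (b x.1 q) * HopfAlgebra.antipode ℂ (a x.2 j))) *
          γ.val (a i r ⊗ₜ ((∑ s, b t s * HopfAlgebra.antipode ℂ (b s x.1)) *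
              HopfAlgebra.antipode ℂ (a r x.2))) := by
        simp only [h1]
        refine Finset.sum_congr rfl fun r _ => ?_
        rw [Finset.sum_comm]
        refine Finset.sum_congr rfl fun t _ => ?_
        rw [Finset.sum_comm]
        simp only [Finset.sum_mul, TensorProduct.tmul_sum, map_sum, Finset.mul_sum, mul_assoc]
    _ = _ := by
        simp only [hb.sum_mul_antipode, Fintype.sum_prod_type]
        simp only [ite_mul, one_mul, zero_mul, TensorProduct.tmul_ite, apply_ite γ.val, mul_ite,
          map_zero, mul_zero, Finset.sum_ite_irrel, Finset.sum_const_zero,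
          Finset.sum_ite_eq, Finset.mem_univ, if_true, LinearMap.convOne_apply, hb.counit_eq,
          mul_one, Algebra.algebraMap_self, RingHom.id_apply]
        refine (sum_comm_mul (fun t w => γ.val (b p t ⊗ₜ
            (HopfAlgebra.antipode ℂ (b t q) * HopfAlgebra.antipode ℂ (a w j))))
          (fun r w => γ.val (a i r ⊗ₜ HopfAlgebra.antipode ℂ (a r w)))).trans
              (Finset.sum_congr rfl fun w _ => ?_)
        rw [← Finset.mul_sum, mul_comm]

/-- `γ(g₁ ⊗ S(g₂) S(h₁)) γ(S(g₃) ⊗ S(h₂)) = ε(h) U(g)`. -/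
lemma aux_mul_antiFlip : γ.aux * antiFlip (HopfAlgebra.antipode ℂ) γ.fn = box 1 γ.fnU := by
  apply WithConv.ext
  refine ext_comatrix₂ fun n m a b ha hb i j p q => ?_
  -- the cocycle identity at `g₁ ⊗ S(g₂) ⊗ S(h)`
  have h1 := fun t => γ.cocycle_sum (hb.comul_eq p t) (hb.comul_antipode t q)
    (ha.comul_antipode i j)
  rw [LinearMap.convMul_apply]
  simp only [TensorProduct.comul_tmul, ha.comul_eq, hb.comul_eq,
    TensorProduct.sum_tmul, TensorProduct.tmul_sum, map_sum,
    TensorProduct.AlgebraTensorModule.tensorTensorTensorComm_tmul, TensorProduct.map_tmul,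
    LinearMap.mul'_apply, box_tmul, aux_comatrix _ hb, antiFlip_tmul, fn_apply,
    LinearMap.convOne_apply]
  simp only [fnU, γ.U_comatrix hb]
  calc _ = ∑ t, ∑ r, ∑ w, γ.val (HopfAlgebra.antipode ℂ (b r q) ⊗ₜ HopfAlgebra.antipode ℂ (a w j)) *
        γ.val (b p t ⊗ₜ (HopfAlgebra.antipode ℂ (b t r) * HopfAlgebra.antipode ℂ (a i w))) := by
        conv_rhs => rw [Finset.sum_comm, Finset.sum_congr rfl fun r _ => Finset.sum_comm]
        simp only [mul_comm]
    _ = ∑ x : _ × _, γ.val (b p x.1 ⊗ₜ HopfAlgebra.antipode ℂ (b x.2 q)) *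
        γ.val ((∑ t, b x.1 t * HopfAlgebra.antipode ℂ (b t x.2)) ⊗ₜ
            HopfAlgebra.antipode ℂ (a i j)) := by
        simp only [← h1]
        simp only [Fintype.sum_prod_type, TensorProduct.sum_tmul, map_sum, Finset.mul_sum]
        rw [Finset.sum_comm, Finset.sum_congr rfl fun p _ => Finset.sum_comm]
    _ = _ := by
        simp only [hb.sum_mul_antipode, Fintype.sum_prod_type]
        simp [TensorProduct.ite_tmul, apply_ite γ.val, γ.val_one_left, ha.counit_eq, mul_comm]

lemma antiFlip_fn_mul_antiFlip_fnInv :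
    antiFlip (HopfAlgebra.antipode ℂ) γ.fn * antiFlip (HopfAlgebra.antipode ℂ) γ.fnInv = 1 := by
  rw [← antiFlip_mul antiComul_antipode, fnInv_mul_fn, antiFlip_one HopfAlgebra.counit_antipode]

lemma antiFlip_fnInv_mul_antiFlip_fn :
    antiFlip (HopfAlgebra.antipode ℂ) γ.fnInv * antiFlip (HopfAlgebra.antipode ℂ) γ.fn = 1 := by
  rw [← antiFlip_mul antiComul_antipode, fn_mul_fnInv, antiFlip_one HopfAlgebra.counit_antipode]

/-- `γ(h₁ ⊗ g₁) U(h₂ g₂) = U(h₁) U(g₁) γ⁻¹(S(g₂) ⊗ S(h₂))`. -/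
lemma fn_mul_pull_fnU_eq : γ.fn * pull (mulHom A) γ.fnU =
    box γ.fnU γ.fnU * antiFlip (HopfAlgebra.antipode ℂ) γ.fnInv := by
  calc _ = box γ.fnU 1 * (γ.aux * antiFlip (HopfAlgebra.antipode ℂ) γ.fn) *
      antiFlip (HopfAlgebra.antipode ℂ) γ.fnInv := by
        rw [fn_mul_pull_fnU, mul_assoc, mul_assoc, antiFlip_fn_mul_antiFlip_fnInv, mul_one]
    _ = _ := by rw [aux_mul_antiFlip, box_mul_box, one_mul, mul_one]

/-- `Ū(h₁ g₁) γ⁻¹(h₂ ⊗ g₂) = γ(S(g₁) ⊗ S(h₁)) Ū(h₂) Ū(g₂)`. -/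
lemma pull_fnUbar_mul_fnInv : pull (mulHom A) γ.fnUbar * γ.fnInv =
    antiFlip (HopfAlgebra.antipode ℂ) γ.fn * box γ.fnUbar γ.fnUbar := by
  refine left_inv_eq_right_inv (a := γ.fn * pull (mulHom A) γ.fnU) ?_ ?_
  · rw [mul_assoc, ← mul_assoc γ.fnInv, fnInv_mul_fn, one_mul, ← map_mul, fnUbar_mul_fnU, map_one]
  · rw [fn_mul_pull_fnU_eq, mul_assoc, ← mul_assoc (antiFlip (HopfAlgebra.antipode ℂ) γ.fnInv),
      antiFlip_fnInv_mul_antiFlip_fn, one_mul, box_mul_box, fnU_mul_fnUbar, box_one_one]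

end TwoCocycle

/-! ### The functionals `V` and `V̄` -/

section Star

variable [StarRing A] [StarModule ℂ A] [HopfStarAlgebra A]

lemma IsComatrix.star {ι : Type*} [Fintype ι] [DecidableEq ι] {a : ι → ι → A}
    (ha : IsComatrix a) : IsComatrix fun i j => star (a i j) where
  comul_eq i j := by rw [HopfStarAlgebra.comul_star, ha.comul_eq, star_sum]; simp
  counit_eq i j := by rw [counit_star, ha.counit_eq]; split_ifs <;> simp

variable (A) in
lemma antiComul_antipodeInv : AntiComul (antipodeInv A) := by
  have h : comul (R := ℂ) ∘ₗ antipodeInv A = TensorProduct.map (antipodeInv A) (antipodeInv A) ∘ₗ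
      (TensorProduct.comm ℂ A A).toLinearMap ∘ₗ comul := by
    refine ext_comatrix fun n a ha i j => ?_
    have h1 : comul (R := ℂ) (antipodeInv A (a i j)) =
        star (comul (R := ℂ) (HopfAlgebra.antipode ℂ (star (a i j)))) :=
      HopfStarAlgebra.comul_star _
    rw [LinearMap.comp_apply, h1, ha.star.comul_antipode, star_sum]
    simp [ha.comul_eq, antipodeInv]
  exact fun x => congr($h x)

lemma counit_antipodeInv (x : A) : counit (R := ℂ) (antipodeInv A x) = counit (R := ℂ) x := by
  rw [← HopfAlgebra.counit_antipode, antipode_antipodeInv]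

lemma antipodeInv_mul (x y : A) :
    antipodeInv A (x * y) = antipodeInv A y * antipodeInv A x := by
  simp [antipodeInv, HopfAlgebra.antipode_mul_antidistrib]

/-- The functional `a ↦ conj φ(a*)`. -/
def starFn {C : Type*} [AddCommGroup C] [Module ℂ C] [StarAddMonoid C] [StarModule ℂ C]
    (φ : Fn C) : Fn C := toConv
  { toFun := fun a => conj (φ (star a))
    map_add' := by simp
    map_smul' := by simp }

@[simp] lemma starFn_apply {C : Type*} [AddCommGroup C] [Module ℂ C] [StarAddMonoid C]
    [StarModule ℂ C] (φ : Fn C) (a : C) : starFn φ a = conj (φ (star a)) := rfl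

namespace TwoCocycle

variable (γ : TwoCocycle A)

/-- `V` in the convolution algebra. -/
def fnV : Fn A := toConv γ.V

/-- `V̄` in the convolution algebra. -/
def fnVbar : Fn A := toConv γ.Vbar

lemma fnV_mul_fnVbar : γ.fnV * γ.fnVbar = 1 := by
  have h := antiPull_mul (antiComul_antipodeInv A) γ.fnUbar γ.fnU
  rw [fnUbar_mul_fnU] at h
  refine h.symm.trans (Fn.ext_apply fun x => ?_)
  change (1 : Fn A) (antipodeInv A x) = _
  rw [LinearMap.convOne_apply, counit_antipodeInv]
  rfl

lemma fnVbar_mul_fnV : γ.fnVbar * γ.fnV = 1 := by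
  have h := antiPull_mul (antiComul_antipodeInv A) γ.fnU γ.fnUbar
  rw [fnU_mul_fnUbar] at h
  refine h.symm.trans (Fn.ext_apply fun x => ?_)
  change (1 : Fn A) (antipodeInv A x) = _
  rw [LinearMap.convOne_apply, counit_antipodeInv]
  rfl

lemma antiFlip_antipodeInv_fn_mul_fnInv :
    antiFlip (antipodeInv A) γ.fn * antiFlip (antipodeInv A) γ.fnInv = 1 := by
  rw [← antiFlip_mul (antiComul_antipodeInv A), fnInv_mul_fn, antiFlip_one counit_antipodeInv]

/-- `γ⁻¹(S⁻¹(q₁) ⊗ S⁻¹(p₁)) V̄(p₂ q₂) = V̄(p₁) V̄(q₁) γ(p₂ ⊗ q₂)`. -/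
lemma antiFlip_fnInv_mul_pull_fnVbar :
    antiFlip (antipodeInv A) γ.fnInv * pull (mulHom A) γ.fnVbar =
      box γ.fnVbar γ.fnVbar * γ.fn := by
  have h := congr(antiFlip (antipodeInv A) $(γ.pull_fnUbar_mul_fnInv))
  rw [antiFlip_mul (antiComul_antipodeInv A), antiFlip_mul (antiComul_antipodeInv A)] at h
  have h1 : antiFlip (antipodeInv A) (pull (mulHom A) γ.fnUbar) = pull (mulHom A) γ.fnVbar := by
    apply WithConv.ext
    ext p q
    change γ.Ubar (antipodeInv A q * antipodeInv A p) = γ.Ubar (antipodeInv A (p * q))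
    rw [antipodeInv_mul]
  have h2 : antiFlip (antipodeInv A) (antiFlip (HopfAlgebra.antipode ℂ) γ.fn) = γ.fn := by
    apply WithConv.ext
    ext p q
    change γ.val (HopfAlgebra.antipode ℂ (antipodeInv A p) ⊗ₜ
        HopfAlgebra.antipode ℂ (antipodeInv A q)) = _
    rw [antipode_antipodeInv, antipode_antipodeInv]
    rfl
  have h3 : antiFlip (antipodeInv A) (box γ.fnUbar γ.fnUbar) = box γ.fnVbar γ.fnVbar := by
    apply WithConv.ext
    ext p q
    exact mul_comm _ _
  rwa [h1, h2, h3] at h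

/-- `V(p₁ q₁) γ(S⁻¹(q₂) ⊗ S⁻¹(p₂)) = γ⁻¹(p₁ ⊗ q₁) V(p₂) V(q₂)`. -/
lemma pull_fnV_mul_antiFlip_fn :
    pull (mulHom A) γ.fnV * antiFlip (antipodeInv A) γ.fn =
      γ.fnInv * box γ.fnV γ.fnV := by
  refine left_inv_eq_right_inv
    (a := antiFlip (antipodeInv A) γ.fnInv * pull (mulHom A) γ.fnVbar) ?_ ?_
  · rw [mul_assoc, ← mul_assoc (antiFlip _ γ.fn), antiFlip_antipodeInv_fn_mul_fnInv, one_mul,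
      ← map_mul, fnV_mul_fnVbar, map_one]
  · rw [antiFlip_fnInv_mul_pull_fnVbar, mul_assoc, ← mul_assoc γ.fn, fn_mul_fnInv, one_mul,
      box_mul_box, fnVbar_mul_fnV, box_one_one]

section Unitary

variable {γ}

lemma IsUnitary.conj_inv (hγ : γ.IsUnitary) (a b : A) : conj (γ.inv (a ⊗ₜ b)) =
    γ.val (star (HopfAlgebra.antipode ℂ a) ⊗ₜ star (HopfAlgebra.antipode ℂ b)) := by
  have h : ∀ x : A, star (HopfAlgebra.antipode ℂ (star (HopfAlgebra.antipode ℂ x))) = x :=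
      antipodeInv_antipode
  have := hγ (star (HopfAlgebra.antipode ℂ a)) (star (HopfAlgebra.antipode ℂ b))
  rw [h, h] at this
  rw [← this, Complex.conj_conj]

/-- `conj γ(q* ⊗ p*) = γ⁻¹(S⁻¹(q) ⊗ S⁻¹(p))`. -/
lemma IsUnitary.conj_val_star (hγ : γ.IsUnitary) (p q : A) : conj (γ.val (star q ⊗ₜ star p)) =
    antiFlip (antipodeInv A) γ.fnInv (p ⊗ₜ q) := hγ _ _

lemma IsUnitary.conj_inv_star (hγ : γ.IsUnitary) (p q : A) : conj (γ.inv (star q ⊗ₜ star p)) =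
    antiFlip (antipodeInv A) γ.fn (p ⊗ₜ q) := hγ.conj_inv _ _

lemma IsUnitary.starFn_fnVbar (hγ : γ.IsUnitary) : starFn γ.fnVbar = γ.fnV := by
  apply WithConv.ext
  refine ext_comatrix fun n a ha i j => ?_
  rw [starFn_apply]
  have h1 : γ.fnVbar.ofConv (star (a i j)) =
      ∑ l, γ.inv (star (a l j) ⊗ₜ antipodeInv A (star (a i l))) := by
    change γ.Ubar (antipodeInv A (star (a i j))) = _
    simp [Ubar, (antiComul_antipodeInv A).comatrix ha.star, antipode_antipodeInv]
  have h2 : γ.fnV.ofConv (a i j) = ∑ l, γ.val (antipodeInv A (a l j) ⊗ₜ a i l) := by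
    change γ.U (antipodeInv A (a i j)) = _
    simp [U, (antiComul_antipodeInv A).comatrix ha, antipode_antipodeInv]
  rw [h1, h2, map_sum]
  refine Finset.sum_congr rfl fun l _ => ?_
  rw [hγ.conj_inv, antipode_antipodeInv, star_star]
  rfl

lemma IsUnitary.starFn_fnV (hγ : γ.IsUnitary) : starFn γ.fnV = γ.fnVbar := by
  rw [← hγ.starFn_fnVbar]
  apply Fn.ext_apply
  simp

end Unitary

end TwoCocycle

end Star

/-! ### The bialgebra axioms for the deformed product -/

namespace TwoCocycle

variable {A : Type u} [Ring A] [HopfAlgebra ℂ A] (γ : TwoCocycle A)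

/-- The functional `(g ⊗ h) ⊗ k ↦ F((g ·_γ h) ⊗ k)` in the convolution algebra. -/
lemma comp_map_mul_id (F : Fn (A ⊗[ℂ] A)) :
    toConv (F.ofConv ∘ₗ TensorProduct.map γ.mul LinearMap.id) =
      box γ.fn 1 * pull (mulLeft A) F * box γ.fnInv 1 := by
  apply WithConv.ext
  refine TensorProduct.ext (LinearMap.ext fun z => LinearMap.ext fun c => ?_)
  have h1 := congr(ofConv $(γ.comp_mul (sliceRight F c)) z)
  have h2 : box γ.fn 1 * pull (mulLeft A) F * box γ.fnInv 1 =
      (box γ.fn 1 * (pull (mulLeft A) F * box γ.fnInv 1) : Fn _) := mul_assoc _ _ _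
  rw [h2]
  refine h1.trans ?_
  have h3 := sliceRight_box_mul (pull (mulLeft A) F * box γ.fnInv 1) γ.fn c
  rw [sliceRight_mul_box] at h3
  rw [mul_assoc]
  exact congr(ofConv $h3.symm z)

/-- The functional `g ⊗ (h ⊗ k) ↦ F(g ⊗ (h ·_γ k))` in the convolution algebra. -/
lemma comp_map_id_mul (F : Fn (A ⊗[ℂ] A)) :
    toConv (F.ofConv ∘ₗ TensorProduct.map LinearMap.id γ.mul) =
      box 1 γ.fn * pull (mulRight A) F * box 1 γ.fnInv := by
  apply WithConv.ext
  refine TensorProduct.ext (LinearMap.ext fun c => LinearMap.ext fun z => ?_)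
  have h1 := congr(ofConv $(γ.comp_mul (sliceLeft F c)) z)
  have h2 : box 1 γ.fn * pull (mulRight A) F * box 1 γ.fnInv =
      (box 1 γ.fn * (pull (mulRight A) F * box 1 γ.fnInv) : Fn _) := mul_assoc _ _ _
  rw [h2]
  refine h1.trans ?_
  have h3 := sliceLeft_box_mul (pull (mulRight A) F * box 1 γ.fnInv) γ.fn c
  rw [sliceLeft_mul_box] at h3
  rw [mul_assoc]
  exact congr(ofConv $h3.symm z)

/-- The cocycle identity for the convolution inverse. -/
lemma cocycle_fnInv : pull (mulLeft A) γ.fnInv * box γ.fnInv 1 =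
    pull (assocHom A) (pull (mulRight A) γ.fnInv * box 1 γ.fnInv) := by
  refine left_inv_eq_right_inv (a := box γ.fn 1 * pull (mulLeft A) γ.fn) ?_ ?_
  · rw [mul_assoc, ← mul_assoc (box γ.fnInv 1), box_mul_box, fnInv_mul_fn, one_mul, box_one_one,
      one_mul, ← map_mul, fnInv_mul_fn, map_one]
  · rw [cocycle_fn, ← map_mul, mul_assoc, ← mul_assoc (pull (mulRight A) γ.fn), ← map_mul,
      fn_mul_fnInv, map_one, one_mul, box_mul_box, fn_mul_fnInv, one_mul, box_one_one, map_one]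

lemma mul_mul (x y z : A) : γ.mul (γ.mul (x ⊗ₜ y) ⊗ₜ z) = γ.mul (x ⊗ₜ γ.mul (y ⊗ₜ z)) := by
  refine eq_of_fn fun ω => ?_
  have h1 := γ.comp_map_mul_id (toConv (ω.ofConv ∘ₗ γ.mul))
  have h2 := γ.comp_map_id_mul (toConv (ω.ofConv ∘ₗ γ.mul))
  rw [γ.comp_mul] at h1 h2
  have h3 : pull (mulLeft A) (pull (mulHom A) ω) =
      pull (assocHom A) (pull (mulRight A) (pull (mulHom A) ω)) := by
    apply WithConv.ext
    ext a b c
    change ω (a * b * c) = ω (a * (b * c))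
    rw [mul_assoc]
  have h4 : box γ.fn 1 * pull (mulLeft A) (γ.fn * pull (mulHom A) ω * γ.fnInv) * box γ.fnInv 1 =
      pull (assocHom A)
        (box 1 γ.fn * pull (mulRight A) (γ.fn * pull (mulHom A) ω * γ.fnInv) * box 1 γ.fnInv) := by
    calc _ = (box γ.fn 1 * pull (mulLeft A) γ.fn) * pull (mulLeft A) (pull (mulHom A) ω) *
          (pull (mulLeft A) γ.fnInv * box γ.fnInv 1) := by
          simp only [map_mul, mul_assoc]
      _ = _ := by
          rw [cocycle_fn, cocycle_fnInv, h3]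
          simp only [map_mul, mul_assoc]
  rw [← h1, ← h2] at h4
  have h5 := congr(ofConv $h4 ((x ⊗ₜ y) ⊗ₜ z))
  have h6 := γ.comp_mul ω
  have e : ∀ t, ω (γ.mul t) = (γ.fn * pull (mulHom A) ω * γ.fnInv).ofConv t :=
    fun t => congr(ofConv $h6 t)
  rw [e, e]
  exact h5

lemma mul_one' (x : A) : γ.mul (x ⊗ₜ 1) = x := by
  refine eq_of_fn fun ω => ?_
  have h := congr(ofConv (pull (unitRight A) $(γ.comp_mul ω)) x)
  rw [map_mul, map_mul, pull_unitRight_fn, pull_unitRight_fnInv, one_mul, mul_one] at h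
  refine h.trans ?_
  change ω (x * 1) = _
  rw [mul_one]

lemma one_mul' (x : A) : γ.mul (1 ⊗ₜ x) = x := by
  refine eq_of_fn fun ω => ?_
  have h := congr(ofConv (pull (unitLeft A) $(γ.comp_mul ω)) x)
  rw [map_mul, map_mul, pull_unitLeft_fn, pull_unitLeft_fnInv, one_mul, mul_one] at h
  refine h.trans ?_
  change ω (1 * x) = _
  rw [one_mul]

lemma box_comul {C : Type*} [AddCommGroup C] [Module ℂ C] [Coalgebra ℂ C] (φ ψ : Fn C) (c : C) :
    box φ ψ (comul (R := ℂ) c) = (φ * ψ) c := by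
  rw [LinearMap.convMul_apply]
  rfl

lemma comul_mul (z : A ⊗[ℂ] A) : comul (R := ℂ) (γ.mul z) =
    TensorProduct.map γ.mul γ.mul (comul (R := ℂ) z) := by
  refine eq_of_box fun φ ψ => ?_
  rw [box_map, box_comul, box_comul, γ.comp_mul, γ.comp_mul]
  have h := congr(ofConv $(γ.comp_mul (φ * ψ)) z)
  refine h.trans ?_
  congr 2
  rw [map_mul]
  calc _ = γ.fn * (pull (mulHom A) φ * (1 * pull (mulHom A) ψ)) * γ.fnInv := by rw [one_mul]
    _ = _ := by
      rw [← γ.fnInv_mul_fn]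
      simp only [mul_assoc]

lemma counit_mul (z : A ⊗[ℂ] A) : counit (R := ℂ) (γ.mul z) = counit (R := ℂ) z := by
  have h := congr(ofConv $(γ.comp_mul 1) z)
  rw [map_one, mul_one, fn_mul_fnInv] at h
  exact h

end TwoCocycle

/-! ### The deformed antipode -/

lemma IsComatrix.antipode {A : Type u} [Ring A] [HopfAlgebra ℂ A] {ι : Type*} [Fintype ι]
    [DecidableEq ι] {a : ι → ι → A} (ha : IsComatrix a) :
    IsComatrix fun i j => HopfAlgebra.antipode ℂ (a j i) where
  comul_eq i j := ha.comul_antipode j i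
  counit_eq i j := by simp [ha.counit_eq, eq_comm]

namespace TwoCocycle

variable {A : Type u} [Ring A] [HopfAlgebra ℂ A] (γ : TwoCocycle A)

section Antipode

variable {ι κ : Type*} [Fintype ι] [DecidableEq ι] [Fintype κ] [DecidableEq κ] {a : ι → ι → A}
  {b : κ → κ → A}

/-- The deformed product of the entries of two comatrices. -/
lemma mul_comatrix (ha : IsComatrix a) (hb : IsComatrix b) (i j : ι) (p q : κ) :
    γ.mul (a i j ⊗ₜ b p q) = ∑ s, ∑ r, ∑ l, ∑ k,
      (γ.val (a i k ⊗ₜ b p l) * γ.inv (a r j ⊗ₜ b s q)) • (a k r * b l s) := by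
  simp only [mul, LinearMap.convMul_def, LinearMap.comp_apply, TensorProduct.comul_tmul,
    ha.comul_eq, hb.comul_eq, TensorProduct.sum_tmul, TensorProduct.tmul_sum, map_sum,
    TensorProduct.map_tmul, TensorProduct.AlgebraTensorModule.tensorTensorTensorComm_tmul,
    LinearMap.mul'_apply]
  simp [Algebra.algebraMap_eq_smul_one, mul_smul, smul_comm (γ.inv _)]

lemma antipode_comatrix (ha : IsComatrix a) (i j : ι) : γ.antipode (a i j) =
    ∑ l, γ.Ubar (a l j) • ∑ k, γ.U (a i k) • HopfAlgebra.antipode ℂ (a k l) := by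
  simp [antipode, LinearMap.convMul_def, ha.comul_eq, TensorProduct.sum_tmul,
    Algebra.algebraMap_eq_smul_one]

/-- `γ(S(a₁) ⊗ a₃) Ū(a₂) = ε(a)`. -/
lemma sum_Ubar_mul_val (ha : IsComatrix a) (i j : ι) : ∑ m, ∑ l, γ.Ubar (a l m) *
    γ.val (HopfAlgebra.antipode ℂ (a i l) ⊗ₜ a m j) = if i = j then 1 else 0 := by
  have h : ∀ t, ∑ m, ∑ l, γ.inv (HopfAlgebra.antipode ℂ (a l t) ⊗ₜ a t m) *
      γ.val (HopfAlgebra.antipode ℂ (a i l) ⊗ₜ a m j) =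
      if i = t then if t = j then 1 else 0 else 0 := by
    intro t
    have h := congr(ofConv $(γ.fnInv_mul_fn) (HopfAlgebra.antipode ℂ (a i t) ⊗ₜ a t j))
    simpa [ha.comul_eq, ha.counit_eq, ha.comul_antipode, TensorProduct.sum_tmul,
      TensorProduct.tmul_sum, -fnInv_mul_fn] using h
  simp only [γ.Ubar_comatrix ha, Finset.sum_mul]
  rw [Finset.sum_congr rfl fun m _ => Finset.sum_comm, Finset.sum_comm]
  simp [h]

/-- `γ⁻¹(a₁ ⊗ S(a₃)) U(a₂) = ε(a)`. -/
lemma sum_inv_mul_U (ha : IsComatrix a) (i j : ι) : ∑ m, ∑ l, γ.U (a l m) *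
    γ.inv (a i l ⊗ₜ HopfAlgebra.antipode ℂ (a m j)) = if i = j then 1 else 0 := by
  have h : ∀ t, ∑ m, ∑ l, γ.val (a l t ⊗ₜ HopfAlgebra.antipode ℂ (a t m)) *
      γ.inv (a i l ⊗ₜ HopfAlgebra.antipode ℂ (a m j)) =
      (if i = t then 1 else 0) * (if t = j then 1 else 0) := by
    intro t
    have h := congr(ofConv $(γ.fnInv_mul_fn) (a i t ⊗ₜ HopfAlgebra.antipode ℂ (a t j)))
    simpa [ha.comul_eq, ha.counit_eq, ha.comul_antipode, TensorProduct.sum_tmul,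
      TensorProduct.tmul_sum, -fnInv_mul_fn, mul_comm] using h
  simp only [γ.U_comatrix ha, Finset.sum_mul]
  rw [Finset.sum_congr rfl fun m _ => Finset.sum_comm, Finset.sum_comm]
  simp [h]

/-- `Ū(a₂) S(a₁) ·_γ a₃ = Ū(a) 1`. -/
lemma sum_mul_antipode_left (ha : IsComatrix a) (i j : ι) :
    ∑ m, ∑ l, γ.Ubar (a l m) • γ.mul (HopfAlgebra.antipode ℂ (a i l) ⊗ₜ a m j) =
      γ.Ubar (a i j) • 1 := by
  have h := fun m l => γ.mul_comatrix ha.antipode ha l i m j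
  calc _ = ∑ s, ∑ r, ∑ t, ∑ w, γ.inv (HopfAlgebra.antipode ℂ (a i r) ⊗ₜ a s j) •
        (∑ m, ∑ l, γ.Ubar (a l m) * γ.val (HopfAlgebra.antipode ℂ (a w l) ⊗ₜ a m t)) •
          (HopfAlgebra.antipode ℂ (a r w) * a t s) := by
        simp only [h, Finset.smul_sum, Finset.sum_smul]
        rw [sum_comm_pairs]
        refine Finset.sum_congr rfl fun s _ => Finset.sum_congr rfl fun r _ => ?_
        rw [sum_comm_pairs]
        refine Finset.sum_congr rfl fun t _ => Finset.sum_congr rfl fun w _ =>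
          Finset.sum_congr rfl fun m _ => Finset.sum_congr rfl fun l _ => ?_
        simp only [smul_smul]
        congr 1
        ring
    _ = ∑ s, ∑ r, γ.inv (HopfAlgebra.antipode ℂ (a i r) ⊗ₜ a s j) •
          ∑ w, (HopfAlgebra.antipode ℂ (a r w) * a w s) := by
        simp [sum_Ubar_mul_val γ ha, Finset.smul_sum]
    _ = _ := by
        simp [ha.sum_antipode_mul, γ.Ubar_comatrix ha, Finset.sum_smul]

/-- `U(a₂) a₁ ·_γ S(a₃) = U(a) 1`. -/
lemma sum_mul_antipode_right (ha : IsComatrix a) (i j : ι) :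
    ∑ m, ∑ l, γ.U (a l m) • γ.mul (a i l ⊗ₜ HopfAlgebra.antipode ℂ (a m j)) =
      γ.U (a i j) • 1 := by
  have h := fun m l => γ.mul_comatrix ha ha.antipode i l j m
  calc _ = ∑ s, ∑ r, ∑ t, ∑ w, γ.val (a i w ⊗ₜ HopfAlgebra.antipode ℂ (a t j)) •
        (∑ m, ∑ l, γ.U (a l m) * γ.inv (a r l ⊗ₜ HopfAlgebra.antipode ℂ (a m s))) •
          (a w r * HopfAlgebra.antipode ℂ (a s t)) := by
        simp only [h, Finset.smul_sum, Finset.sum_smul]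
        rw [sum_comm_pairs]
        refine Finset.sum_congr rfl fun s _ => Finset.sum_congr rfl fun r _ => ?_
        rw [sum_comm_pairs]
        refine Finset.sum_congr rfl fun t _ => Finset.sum_congr rfl fun w _ =>
          Finset.sum_congr rfl fun m _ => Finset.sum_congr rfl fun l _ => ?_
        simp only [smul_smul]
        congr 1
        ring
    _ = ∑ t, ∑ w, γ.val (a i w ⊗ₜ HopfAlgebra.antipode ℂ (a t j)) •
          ∑ s, (a w s * HopfAlgebra.antipode ℂ (a s t)) := by
        simp only [sum_inv_mul_U γ ha, Finset.smul_sum]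
        simp only [ite_smul, one_smul, zero_smul, smul_ite, smul_zero]
        rw [sum_comm_pairs]
        simp
    _ = _ := by
        simp [ha.sum_mul_antipode, γ.U_comatrix ha, Finset.sum_smul]

/-- `S_γ(h₁) ·_γ h₂ = ε(h) 1`. -/
lemma mul_antipode_left (h : A) : γ.mul (TensorProduct.map γ.antipode LinearMap.id
    (comul (R := ℂ) h)) = counit (R := ℂ) h • 1 := by
  suffices γ.mul ∘ₗ TensorProduct.map γ.antipode LinearMap.id ∘ₗ comul =
      (counit (R := ℂ)).smulRight 1 from congr($this h)
  refine ext_comatrix fun n a ha i j => ?_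
  have h1 := congr(ofConv $(γ.fnU_mul_fnUbar) (a i j))
  simp only [LinearMap.convMul_apply, ha.comul_eq, map_sum, TensorProduct.map_tmul,
    LinearMap.mul'_apply, LinearMap.convOne_apply] at h1
  simp only [LinearMap.comp_apply, ha.comul_eq, map_sum, TensorProduct.map_tmul,
    LinearMap.id_apply, antipode_comatrix γ ha, TensorProduct.sum_tmul, ← TensorProduct.smul_tmul',
    map_smul, Finset.smul_sum, LinearMap.smulRight_apply]
  calc _ = ∑ k, γ.U (a i k) • ∑ m, ∑ l, γ.Ubar (a l m) •
        γ.mul (HopfAlgebra.antipode ℂ (a k l) ⊗ₜ a m j) := by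
        rw [Finset.sum_congr rfl fun m _ => Finset.sum_comm, Finset.sum_comm]
        simp only [Finset.smul_sum, smul_comm (γ.U _)]
    _ = (∑ k, γ.U (a i k) * γ.Ubar (a k j)) • 1 := by
        simp only [sum_mul_antipode_left γ ha, Finset.sum_smul, smul_smul]
    _ = _ := congr($h1 • 1)

/-- `h₁ ·_γ S_γ(h₂) = ε(h) 1`. -/
lemma mul_antipode_right (h : A) : γ.mul (TensorProduct.map LinearMap.id γ.antipode
    (comul (R := ℂ) h)) = counit (R := ℂ) h • 1 := by
  suffices γ.mul ∘ₗ TensorProduct.map LinearMap.id γ.antipode ∘ₗ comul =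
      (counit (R := ℂ)).smulRight 1 from congr($this h)
  refine ext_comatrix fun n a ha i j => ?_
  have h1 := congr(ofConv $(γ.fnU_mul_fnUbar) (a i j))
  simp only [LinearMap.convMul_apply, ha.comul_eq, map_sum, TensorProduct.map_tmul,
    LinearMap.mul'_apply, LinearMap.convOne_apply] at h1
  simp only [LinearMap.comp_apply, ha.comul_eq, map_sum, TensorProduct.map_tmul,
    LinearMap.id_apply, antipode_comatrix γ ha, TensorProduct.tmul_sum, TensorProduct.tmul_smul,
    map_smul, Finset.smul_sum, LinearMap.smulRight_apply]
  calc _ = ∑ k, γ.Ubar (a k j) • ∑ m, ∑ l, γ.U (a l m) •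
        γ.mul (a i l ⊗ₜ HopfAlgebra.antipode ℂ (a m k)) := by
        rw [Finset.sum_comm]
        refine Finset.sum_congr rfl fun k _ => ?_
        rw [Finset.sum_comm]
        simp only [Finset.smul_sum]
    _ = (∑ k, γ.U (a i k) * γ.Ubar (a k j)) • 1 := by
        simp only [sum_mul_antipode_right γ ha, Finset.sum_smul, smul_smul, mul_comm]
    _ = _ := congr($h1 • 1)

end Antipode

/-! ### The deformed star of `A` -/

section Star

variable [StarRing A] [StarModule ℂ A]

/-- The deformed star, tested by functionals. -/
lemma comp_starHopf (ω : Fn A) (h : A) :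
    ω (γ.starHopf h) = (γ.fnVbar * ω * γ.fnV : Fn A) (star h) := by
  have h1 := comp_mul_linearMap γ.fnV
    (toConv (Algebra.linearMap ℂ A ∘ₗ γ.Vbar) * toConv LinearMap.id) ω
  have h2 := comp_linearMap_mul γ.fnVbar (toConv LinearMap.id) ω
  have h3 := h1.trans congr($h2 * γ.fnV)
  exact congr(ofConv $h3 (star h))

lemma starHopf_add (h k : A) : γ.starHopf (h + k) = γ.starHopf h + γ.starHopf k := by
  simp [starHopf]

lemma starHopf_smul (c : ℂ) (h : A) : γ.starHopf (c • h) = conj c • γ.starHopf h := by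
  simp [starHopf]

lemma starFn_starFn (φ : Fn A) : starFn (starFn φ) = φ := Fn.ext_apply fun a => by simp

/-- The functional `p ⊗ q ↦ conj φ(q* ⊗ p*)`. -/
def starFlip (φ : Fn (A ⊗[ℂ] A)) : Fn (A ⊗[ℂ] A) := toConv (TensorProduct.lift
  { toFun := fun p =>
      { toFun := fun q => conj (φ (star q ⊗ₜ star p))
        map_add' := by simp [TensorProduct.add_tmul]
        map_smul' := by simp [← TensorProduct.smul_tmul'] }
    map_add' := fun p q => by ext; simp [TensorProduct.tmul_add]
    map_smul' := fun c p => by ext; simp })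

@[simp] lemma starFlip_tmul (φ : Fn (A ⊗[ℂ] A)) (p q : A) :
    starFlip φ (p ⊗ₜ q) = conj (φ (star q ⊗ₜ star p)) := rfl

lemma starFlip_pull_mulHom (φ : Fn A) :
    starFlip (pull (mulHom A) φ) = pull (mulHom A) (starFn φ) := by
  apply WithConv.ext
  ext p q
  change conj (φ (star q * star p)) = conj (φ (star (p * q)))
  rw [star_mul]

variable [HopfStarAlgebra A]

lemma starFn_mul (φ ψ : Fn A) : starFn (φ * ψ) = starFn φ * starFn ψ := by
  apply WithConv.ext
  refine ext_comatrix fun n a ha i j => ?_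
  rw [starFn_apply, LinearMap.convMul_apply, LinearMap.convMul_apply]
  simp [ha.comul_eq, ha.star.comul_eq]

lemma starFlip_mul (φ ψ : Fn (A ⊗[ℂ] A)) : starFlip (φ * ψ) = starFlip φ * starFlip ψ := by
  apply WithConv.ext
  refine ext_comatrix₂ fun n m a b ha hb i j p q => ?_
  rw [starFlip_tmul, LinearMap.convMul_apply, LinearMap.convMul_apply]
  simp only [TensorProduct.comul_tmul, ha.comul_eq, hb.comul_eq, ha.star.comul_eq,
    hb.star.comul_eq, TensorProduct.sum_tmul, TensorProduct.tmul_sum, map_sum,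
    TensorProduct.AlgebraTensorModule.tensorTensorTensorComm_tmul, TensorProduct.map_tmul,
    LinearMap.mul'_apply, starFlip_tmul, map_mul]
  rw [Finset.sum_comm]

variable {γ} in
lemma IsUnitary.starFlip_fn (hγ : γ.IsUnitary) :
    starFlip γ.fn = antiFlip (antipodeInv A) γ.fnInv := by
  apply WithConv.ext
  ext p q
  exact hγ.conj_val_star p q

variable {γ} in
lemma IsUnitary.starFlip_fnInv (hγ : γ.IsUnitary) :
    starFlip γ.fnInv = antiFlip (antipodeInv A) γ.fn := by
  apply WithConv.ext
  ext p q
  exact hγ.conj_inv_star p q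

variable {γ} in
lemma IsUnitary.conj_starHopf (hγ : γ.IsUnitary) (ω : Fn A) (h : A) :
    conj (ω (γ.starHopf h)) = (γ.fnV * starFn ω * γ.fnVbar : Fn A) h := by
  rw [comp_starHopf, ← starFn_apply, starFn_mul, starFn_mul, hγ.starFn_fnV, hγ.starFn_fnVbar]

lemma starHopf_comatrix {ι : Type*} [Fintype ι] [DecidableEq ι] {a : ι → ι → A}
    (ha : IsComatrix a) (i j : ι) : γ.starHopf (a i j) =
      ∑ l, γ.V (star (a l j)) • ∑ k, γ.Vbar (star (a i k)) • star (a k l) := by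
  simp [starHopf, LinearMap.convMul_def, ha.star.comul_eq, TensorProduct.sum_tmul,
    Algebra.algebraMap_eq_smul_one]

variable {γ} in
lemma IsUnitary.conj_starHopf_starHopf (hγ : γ.IsUnitary) (φ : Fn (A ⊗[ℂ] A)) (x y : A) :
    conj (φ (γ.starHopf y ⊗ₜ γ.starHopf x)) =
      (box γ.fnV γ.fnV * starFlip φ * box γ.fnVbar γ.fnVbar : Fn (A ⊗[ℂ] A)) (x ⊗ₜ y) := by
  let ψ : Fn (A ⊗[ℂ] A) := toConv (TensorProduct.lift
    { toFun := fun p =>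
        { toFun := fun q => conj (φ (γ.starHopf q ⊗ₜ γ.starHopf p))
          map_add' := by simp [starHopf_add, TensorProduct.add_tmul]
          map_smul' := by simp [starHopf_smul, ← TensorProduct.smul_tmul'] }
      map_add' := fun p q => by ext; simp [starHopf_add, TensorProduct.tmul_add]
      map_smul' := fun c p => by ext; simp [starHopf_smul] })
  suffices ψ = box γ.fnV γ.fnV * starFlip φ * box γ.fnVbar γ.fnVbar from
    congr(ofConv $this (x ⊗ₜ y))
  have hV : ∀ x, conj (γ.V (star x)) = γ.fnVbar x := fun x =>
    congr(ofConv $(hγ.starFn_fnV) x)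
  have hVbar : ∀ x, conj (γ.Vbar (star x)) = γ.fnV x := fun x =>
    congr(ofConv $(hγ.starFn_fnVbar) x)
  apply WithConv.ext
  refine ext_comatrix₂ fun n m a b ha hb i j p q => ?_
  change conj (φ (γ.starHopf (b p q) ⊗ₜ γ.starHopf (a i j))) = _
  rw [LinearMap.convMul_apply, TensorProduct.comul_tmul, ha.comul_eq, hb.comul_eq]
  simp only [TensorProduct.sum_tmul, TensorProduct.tmul_sum, map_sum,
    TensorProduct.AlgebraTensorModule.tensorTensorTensorComm_tmul, TensorProduct.map_tmul,
    LinearMap.mul'_apply, LinearMap.convMul_apply, TensorProduct.comul_tmul, ha.comul_eq,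
    hb.comul_eq, starHopf_comatrix γ ha, starHopf_comatrix γ hb, box_tmul, starFlip_tmul,
    ← TensorProduct.smul_tmul', TensorProduct.tmul_smul, map_smul, smul_eq_mul, map_mul, hV, hVbar,
    Finset.smul_sum]
  rw [Finset.sum_comm (γ := Fin m)]
  refine Finset.sum_congr rfl fun r _ => ?_
  conv_rhs => rw [Finset.sum_congr rfl fun s _ => Finset.sum_comm, Finset.sum_comm]
  refine Finset.sum_congr rfl fun s _ => Finset.sum_congr rfl fun t _ =>
    Finset.sum_congr rfl fun u _ => ?_
  ring

variable {γ} in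
lemma IsUnitary.starHopf_starHopf (hγ : γ.IsUnitary) (h : A) :
    γ.starHopf (γ.starHopf h) = h := by
  refine eq_of_fn fun ω => ?_
  apply (starRingEnd ℂ).injective
  rw [hγ.conj_starHopf]
  apply (starRingEnd ℂ).injective
  rw [hγ.conj_starHopf, starFn_mul, starFn_mul, starFn_starFn, hγ.starFn_fnV, hγ.starFn_fnVbar]
  have h1 : γ.fnV * (γ.fnVbar * ω * γ.fnV) * γ.fnVbar = ω := by
    rw [mul_assoc, mul_assoc, mul_assoc, fnV_mul_fnVbar, mul_one, ← mul_assoc, fnV_mul_fnVbar,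
      one_mul]
  rw [h1, Complex.conj_conj]

variable {γ} in
lemma IsUnitary.starHopf_mul (hγ : γ.IsUnitary) (x y : A) :
    γ.starHopf (γ.mul (x ⊗ₜ y)) = γ.mul (γ.starHopf y ⊗ₜ γ.starHopf x) := by
  refine eq_of_fn fun ω => ?_
  have h1 : ∀ ω : Fn A, ∀ t, ω (γ.mul t) = (γ.fn * pull (mulHom A) ω * γ.fnInv).ofConv t :=
    fun ω t => congr(ofConv $(γ.comp_mul ω) t)
  apply (starRingEnd ℂ).injective
  rw [hγ.conj_starHopf, h1, h1, hγ.conj_starHopf_starHopf, starFlip_mul, starFlip_mul,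
    starFlip_pull_mulHom, hγ.starFlip_fn, hγ.starFlip_fnInv]
  have h2 : γ.fn * pull (mulHom A) γ.fnV =
      box γ.fnV γ.fnV * antiFlip (antipodeInv A) γ.fnInv := by
    calc _ = γ.fn * (pull (mulHom A) γ.fnV * antiFlip (antipodeInv A) γ.fn) *
          antiFlip (antipodeInv A) γ.fnInv := by
          rw [mul_assoc, mul_assoc, antiFlip_antipodeInv_fn_mul_fnInv, mul_one]
      _ = _ := by rw [pull_fnV_mul_antiFlip_fn, ← mul_assoc γ.fn, fn_mul_fnInv, one_mul]
  have h3 : pull (mulHom A) γ.fnVbar * γ.fnInv =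
      antiFlip (antipodeInv A) γ.fn * box γ.fnVbar γ.fnVbar := by
    calc _ = antiFlip (antipodeInv A) γ.fn * (antiFlip (antipodeInv A) γ.fnInv *
          pull (mulHom A) γ.fnVbar) * γ.fnInv := by
          rw [← mul_assoc (antiFlip _ _), antiFlip_antipodeInv_fn_mul_fnInv, one_mul]
      _ = _ := by
          rw [antiFlip_fnInv_mul_pull_fnVbar, mul_assoc, mul_assoc, fn_mul_fnInv, mul_one]
  have h4 : γ.fn * pull (mulHom A) (γ.fnV * starFn ω * γ.fnVbar) * γ.fnInv =
      box γ.fnV γ.fnV * (antiFlip (antipodeInv A) γ.fnInv * pull (mulHom A) (starFn ω) *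
        antiFlip (antipodeInv A) γ.fn) * box γ.fnVbar γ.fnVbar := by
    calc _ = (γ.fn * pull (mulHom A) γ.fnV) * pull (mulHom A) (starFn ω) *
          (pull (mulHom A) γ.fnVbar * γ.fnInv) := by simp only [map_mul, mul_assoc]
      _ = _ := by rw [h2, h3]; simp only [mul_assoc]
  rw [h4]

/-- The deformed star as a conjugate-linear map. -/
def starHopfₛₗ : A →ₛₗ[starRingEnd ℂ] A where
  toFun := γ.starHopf
  map_add' := γ.starHopf_add
  map_smul' := γ.starHopf_smul

variable {γ} in
lemma IsUnitary.comul_starHopf (hγ : γ.IsUnitary) (h : A) : comul (R := ℂ) (γ.starHopf h) =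
    TensorProduct.map γ.starHopfₛₗ γ.starHopfₛₗ (comul (R := ℂ) h) := by
  refine eq_of_box fun φ ψ => ?_
  apply (starRingEnd ℂ).injective
  have h1 : ∀ t, conj (box φ ψ (TensorProduct.map γ.starHopfₛₗ γ.starHopfₛₗ t)) =
      box (γ.fnV * starFn φ * γ.fnVbar) (γ.fnV * starFn ψ * γ.fnVbar) t := by
    intro t
    induction t with
    | zero => simp
    | add s t hs ht => simp only [map_add, hs, ht]
    | tmul a b =>
      rw [box_tmul, ← hγ.conj_starHopf, ← hγ.conj_starHopf, ← map_mul]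
      rfl
  rw [h1, box_comul, box_comul, hγ.conj_starHopf, starFn_mul]
  have h2 : γ.fnV * (starFn φ * starFn ψ) * γ.fnVbar =
      γ.fnV * starFn φ * γ.fnVbar * (γ.fnV * starFn ψ * γ.fnVbar) := by
    calc _ = γ.fnV * (starFn φ * (1 * starFn ψ)) * γ.fnVbar := by rw [one_mul]
      _ = _ := by
        rw [← γ.fnVbar_mul_fnV]
        simp only [mul_assoc]
  rw [h2]

end Star

end TwoCocycle

/-! ### The Hopf `*`-algebra `A_γ` -/

/-- The underlying space of `A_γ`: a copy of `A`, to carry the deformed structure. -/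
def Deformed {A : Type u} [Ring A] [HopfAlgebra ℂ A] (_ : TwoCocycle A) : Type u := A

namespace Deformed

variable {A : Type u} [Ring A] [HopfAlgebra ℂ A] {γ : TwoCocycle A}

instance : AddCommGroup (Deformed γ) := inferInstanceAs (AddCommGroup A)

/-- The identity map `A → A_γ`. -/
def mk : A ≃+ Deformed γ := AddEquiv.refl A

/-- The identity map `A_γ → A`. -/
def out : Deformed γ ≃+ A := mk.symm

instance : Ring (Deformed γ) where
  __ := (inferInstance : AddCommGroup (Deformed γ))
  mul h k := mk (γ.mul (out h ⊗ₜ out k))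
  one := mk 1
  left_distrib h k l := by
    change mk (γ.mul (out h ⊗ₜ out (k + l))) =
      mk (γ.mul (out h ⊗ₜ out k)) + mk (γ.mul (out h ⊗ₜ out l))
    simp [TensorProduct.tmul_add]
  right_distrib h k l := by
    change mk (γ.mul (out (h + k) ⊗ₜ out l)) =
      mk (γ.mul (out h ⊗ₜ out l)) + mk (γ.mul (out k ⊗ₜ out l))
    simp [TensorProduct.add_tmul]
  zero_mul h := by
    change mk (γ.mul (out (0 : Deformed γ) ⊗ₜ out h)) = 0
    simp
  mul_zero h := by
    change mk (γ.mul (out h ⊗ₜ out (0 : Deformed γ))) = 0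
    simp
  mul_assoc h k l := congr(mk $(γ.mul_mul (out h) (out k) (out l)))
  one_mul h := γ.one_mul' (out h)
  mul_one h := γ.mul_one' (out h)

instance : Module ℂ (Deformed γ) := inferInstanceAs (Module ℂ A)

instance : Algebra ℂ (Deformed γ) := Algebra.ofModule
  (fun c h k => by
    change γ.mul ((c • out h) ⊗ₜ out k) = c • γ.mul (out h ⊗ₜ out k)
    rw [← TensorProduct.smul_tmul', map_smul])
  (fun c h k => by
    change γ.mul (out h ⊗ₜ (c • out k)) = c • γ.mul (out h ⊗ₜ out k)
    rw [TensorProduct.tmul_smul, map_smul])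

/-- The identity map `A → A_γ` as a linear isomorphism. -/
def of : A ≃ₗ[ℂ] Deformed γ := LinearEquiv.refl ℂ A

instance : Coalgebra ℂ (Deformed γ) := inferInstanceAs (Coalgebra ℂ A)

lemma comul_of (h : A) : comul (R := ℂ) (of h : Deformed γ) =
    TensorProduct.map of.toLinearMap of.toLinearMap (comul (R := ℂ) h) :=
  congr($(TensorProduct.map_id (R := ℂ) (M := A) (N := A)) (comul (R := ℂ) h)).symm

lemma counit_of (h : A) : counit (R := ℂ) (of h : Deformed γ) = counit (R := ℂ) h := rfl

lemma one_eq : (1 : Deformed γ) = of 1 := rfl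

lemma mul_of (h k : A) : (of h * of k : Deformed γ) = of (γ.mul (h ⊗ₜ k)) := rfl

instance : Bialgebra ℂ (Deformed γ) := by
  refine Bialgebra.mk' ℂ _ ?_ ?_ ?_ ?_
  · exact Bialgebra.counit_one (R := ℂ) (A := A)
  · intro h k
    obtain ⟨h, rfl⟩ := of.surjective h
    obtain ⟨k, rfl⟩ := of.surjective k
    rw [mul_of, counit_of, counit_of, counit_of, γ.counit_mul]
    simp [mul_comm]
  · rw [one_eq, comul_of, Bialgebra.comul_one, Algebra.TensorProduct.one_def,
      Algebra.TensorProduct.one_def, TensorProduct.map_tmul]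
    rfl
  · intro h k
    obtain ⟨h, rfl⟩ := of.surjective h
    obtain ⟨k, rfl⟩ := of.surjective k
    rw [mul_of, comul_of, comul_of, comul_of, γ.comul_mul, TensorProduct.comul_tmul]
    generalize comul (R := ℂ) h = s
    generalize comul (R := ℂ) k = t
    induction s with
    | zero => simp
    | add s s' hs hs' => simp only [TensorProduct.add_tmul, map_add, hs, hs', add_mul]
    | tmul a b =>
      induction t with
      | zero => simp
      | add t t' ht ht' => simp only [TensorProduct.tmul_add, map_add, ht, ht', mul_add]
      | tmul c d => simp [mul_of]

lemma mul'_map_of (t : A ⊗[ℂ] A) : LinearMap.mul' ℂ (Deformed γ)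
    (TensorProduct.map of.toLinearMap of.toLinearMap t) = of (γ.mul t) := by
  induction t with
  | zero => simp
  | add s t hs ht => simp only [map_add, hs, ht]
  | tmul a b => simp [mul_of]

instance : HopfAlgebra ℂ (Deformed γ) where
  antipode := of.toLinearMap ∘ₗ γ.antipode ∘ₗ of.symm.toLinearMap
  mul_antipode_rTensor_comul := by
    ext h
    obtain ⟨h, rfl⟩ := of.surjective h
    let σ : A ≃ₗ[ℂ] Deformed γ := of
    have h1 : ∀ t : A ⊗[ℂ] A, (σ.toLinearMap ∘ₗ γ.antipode ∘ₗ σ.symm.toLinearMap).rTensor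
        (Deformed γ) (TensorProduct.map σ.toLinearMap σ.toLinearMap t) =
        TensorProduct.map σ.toLinearMap σ.toLinearMap
          (TensorProduct.map γ.antipode LinearMap.id t) := by
      intro t
      induction t with
      | zero => simp
      | add s t hs ht => simp only [map_add, hs, ht]
      | tmul a b => simp
    rw [LinearMap.comp_apply, LinearMap.comp_apply, comul_of, h1, mul'_map_of, γ.mul_antipode_left]
    simp [Algebra.algebraMap_eq_smul_one, counit_of, one_eq]
  mul_antipode_lTensor_comul := by
    ext h
    obtain ⟨h, rfl⟩ := of.surjective h
    let σ : A ≃ₗ[ℂ] Deformed γ := of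
    have h1 : ∀ t : A ⊗[ℂ] A, (σ.toLinearMap ∘ₗ γ.antipode ∘ₗ σ.symm.toLinearMap).lTensor
        (Deformed γ) (TensorProduct.map σ.toLinearMap σ.toLinearMap t) =
        TensorProduct.map σ.toLinearMap σ.toLinearMap
          (TensorProduct.map LinearMap.id γ.antipode t) := by
      intro t
      induction t with
      | zero => simp
      | add s t hs ht => simp only [map_add, hs, ht]
      | tmul a b => simp
    rw [LinearMap.comp_apply, LinearMap.comp_apply, comul_of, h1, mul'_map_of, γ.mul_antipode_right]
    simp [Algebra.algebraMap_eq_smul_one, counit_of, one_eq]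

end Deformed

/-- The Hopf `*`-algebra `A_γ`, for a unitary cocycle `γ`. -/
def twistedHopf {A : Type u} [Ring A] [HopfAlgebra ℂ A] [StarRing A] [StarModule ℂ A]
    [HopfStarAlgebra A] {γ : TwoCocycle A} (hγ : γ.IsUnitary) : TwistedHopf γ :=
  letI : StarRing (Deformed γ) :=
    { star := fun h => Deformed.of (γ.starHopf (Deformed.of.symm h))
      star_involutive := fun h => hγ.starHopf_starHopf (Deformed.of.symm h)
      star_mul := fun h k => hγ.starHopf_mul (Deformed.of.symm h) (Deformed.of.symm k)
      star_add := fun h k => γ.starHopf_add (Deformed.of.symm h) (Deformed.of.symm k) }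
  haveI : StarModule ℂ (Deformed γ) :=
    ⟨fun c h => γ.starHopf_smul c (Deformed.of.symm h)⟩
  haveI : HopfStarAlgebra (Deformed γ) := by
    refine ⟨fun h => ?_⟩
    obtain ⟨h, rfl⟩ := Deformed.of.surjective h
    change comul (R := ℂ) (Deformed.of (γ.starHopf h) : Deformed γ) = _
    rw [Deformed.comul_of, Deformed.comul_of, hγ.comul_starHopf]
    generalize comul (R := ℂ) h = t
    induction t with
    | zero => simp
    | add s t hs ht => simp only [map_add, star_add, hs, ht]
    | tmul a b => rfl
  { carrier := Deformed γ
    of := Deformed.of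
    comul_of := Deformed.comul_of
    counit_of := Deformed.counit_of
    one_eq := rfl
    mul_of := Deformed.mul_of
    antipode_of := fun _ => rfl
    star_of := fun _ => rfl }

/-! ### Conjugation and twisting -/

section Natural

variable {A : Type u} [Ring A] [HopfAlgebra ℂ A] (γ : TwoCocycle A)
  {X Y X' Y' Z Z' : Type*}
  [AddCommGroup X] [Module ℂ X] [LeftCoaction A X] [AddCommGroup Y] [Module ℂ Y] [LeftCoaction A Y]
  [AddCommGroup X'] [Module ℂ X'] [LeftCoaction A X'] [AddCommGroup Y'] [Module ℂ Y']
  [LeftCoaction A Y'] [AddCommGroup Z] [Module ℂ Z] [AddCommGroup Z'] [Module ℂ Z']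

/-- A linear map of comodules is colinear. -/
def ColinearMap (A : Type u) [Ring A] [HopfAlgebra ℂ A] {X Y : Type*}
    [AddCommGroup X] [Module ℂ X] [LeftCoaction A X] [AddCommGroup Y] [Module ℂ Y]
    [LeftCoaction A Y] (f : X →ₗ[ℂ] Y) : Prop :=
  ∀ x, coact A (f x) = f.lTensor A (coact A x)

lemma ColinearMap.apply_contract {f : X →ₗ[ℂ] Y} (hf : ColinearMap A f) (φ : A →ₗ[ℂ] ℂ) (x : X) :
    f (contract φ x) = contract φ (f x) := by
  simp only [contract, LinearMap.comp_apply, hf x]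
  generalize coact A x = t
  induction t with
  | zero => simp
  | add s t hs ht => simp only [map_add, hs, ht]
  | tmul a x => simp

lemma contract_contract {X : Type*} [AddCommGroup X] [Module ℂ X] [LeftCoaction A X] [IsComod A X]
    {φ ψ : Fn A} (h : ψ * φ = 1) (x : X) : contract φ.ofConv (contract ψ.ofConv x) = x := by
  have h1 := apply_act ψ LinearMap.id (act φ (LinearMap.id (M := X))) x
  rw [LinearMap.comp_id, act_act, h, act_one] at h1
  exact h1

lemma colinearMap_id : ColinearMap A (LinearMap.id (M := X)) := fun x => by simp

/-- Twisting is natural in colinear maps. -/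
lemma map_twist {μ : X →ₗ[ℂ] Y →ₗ[ℂ] Z} {μ' : X' →ₗ[ℂ] Y' →ₗ[ℂ] Z'} {f : X →ₗ[ℂ] X'}
    {g : Y →ₗ[ℂ] Y'} {k : Z →ₗ[ℂ] Z'} (hf : ColinearMap A f) (hg : ColinearMap A g)
    (h : ∀ x y, k (μ x y) = μ' (f x) (g y)) (x : X) (y : Y) :
    k (γ.twist μ (x ⊗ₜ y)) = γ.twist μ' (f x ⊗ₜ g y) := by
  have h1 : ∀ (s : A ⊗[ℂ] X) (t : A ⊗[ℂ] Y),
      TensorProduct.tensorTensorTensorComm ℂ A X' A Y' (f.lTensor A s ⊗ₜ g.lTensor A t) =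
      TensorProduct.map (CoalgHom.id ℂ (A ⊗[ℂ] A)).toLinearMap (TensorProduct.map f g)
        (TensorProduct.tensorTensorTensorComm ℂ A X A Y (s ⊗ₜ t)) := by
    intro s t
    induction s with
    | zero => simp
    | add s s' hs hs' => simp only [TensorProduct.add_tmul, map_add, hs, hs']
    | tmul a b =>
      induction t with
      | zero => simp
      | add t t' ht ht' => simp only [TensorProduct.tmul_add, map_add, ht, ht']
      | tmul c d => simp
  have h2 : ∀ z, coact (A ⊗[ℂ] A) (TensorProduct.map f g z) = TensorProduct.map
      (CoalgHom.id ℂ (A ⊗[ℂ] A)).toLinearMap (TensorProduct.map f g) (coact (A ⊗[ℂ] A) z) := by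
    intro z
    induction z with
    | zero => simp
    | add s t hs ht => simp only [map_add, hs, ht]
    | tmul x y => rw [TensorProduct.map_tmul, coact_tmul, coact_tmul, hf, hg, h1]
  have h3 : act γ.fn (TensorProduct.lift μ') ∘ₗ TensorProduct.map f g = _ :=
    act_comp (CoalgHom.id ℂ (A ⊗[ℂ] A)) _ h2 γ.fn (TensorProduct.lift μ')
  have h4 : TensorProduct.lift μ' ∘ₗ TensorProduct.map f g = k ∘ₗ TensorProduct.lift μ := by
    ext x y
    simp [h]
  have h5 : pull (CoalgHom.id ℂ (A ⊗[ℂ] A)) γ.fn = γ.fn := rfl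
  rw [h4, h5, ← comp_act] at h3
  exact congr($h3 (x ⊗ₜ y)).symm

end Natural

section Bar

variable {A : Type u} [Ring A] [HopfAlgebra ℂ A] [StarRing A] [StarModule ℂ A]
  {X Y Z : Type*}
  [AddCommGroup X] [Module ℂ X] [LeftCoaction A X] [AddCommGroup Y] [Module ℂ Y] [LeftCoaction A Y]
  [AddCommGroup Z] [Module ℂ Z]

lemma coact_mk (e : X) : coact A (Bar.mk e) = TensorProduct.map
    (starLinearEquiv ℂ (A := A) : A →ₛₗ[starRingEnd ℂ] A) Bar.mkₛₗ (coact A e) := rfl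

@[simp] lemma mkₛₗ_apply (e : X) : Bar.mkₛₗ e = Bar.mk e := rfl

instance [HopfStarAlgebra A] [IsComod A X] : IsComod A (Bar X) where
  coassoc z := by
    obtain ⟨e, rfl⟩ := Bar.mk.surjective z
    have h1 := IsComod.coassoc (C := A) e
    rw [coact_mk]
    have h2 : ∀ t : A ⊗[ℂ] X, TensorProduct.assoc ℂ A A (Bar X) ((comul (R := ℂ)).rTensor (Bar X)
        (TensorProduct.map (starLinearEquiv ℂ (A := A) : A →ₛₗ[starRingEnd ℂ] A) Bar.mkₛₗ t)) =
        TensorProduct.map (starLinearEquiv ℂ (A := A) : A →ₛₗ[starRingEnd ℂ] A) (TensorProduct.map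
          (starLinearEquiv ℂ (A := A) : A →ₛₗ[starRingEnd ℂ] A) Bar.mkₛₗ)
          (TensorProduct.assoc ℂ A A X ((comul (R := ℂ)).rTensor X t)) := by
      intro t
      induction t with
      | zero => simp
      | add s t hs ht => simp only [map_add, hs, ht]
      | tmul a x =>
        simp only [TensorProduct.map_tmul, LinearMap.rTensor_tmul, LinearEquiv.coe_coe,
          starLinearEquiv_apply, HopfStarAlgebra.comul_star]
        generalize comul (R := ℂ) a = s
        induction s with
        | zero => simp
        | add s s' hs hs' => simp only [star_add, TensorProduct.add_tmul, map_add, hs, hs']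
        | tmul a b => simp
    have h3 : ∀ t : A ⊗[ℂ] X, (coact A).lTensor A
        (TensorProduct.map (starLinearEquiv ℂ (A := A) : A →ₛₗ[starRingEnd ℂ] A) Bar.mkₛₗ t) =
        TensorProduct.map (starLinearEquiv ℂ (A := A) : A →ₛₗ[starRingEnd ℂ] A) (TensorProduct.map
          (starLinearEquiv ℂ (A := A) : A →ₛₗ[starRingEnd ℂ] A) Bar.mkₛₗ)
          ((coact A).lTensor A t) := by
      intro t
      induction t with
      | zero => simp
      | add s t hs ht => simp only [map_add, hs, ht]
      | tmul a x => simp [coact_mk]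
    rw [h2, h3, h1]
  counit z := by
    obtain ⟨e, rfl⟩ := Bar.mk.surjective z
    have h1 := IsComod.counit (C := A) e
    rw [coact_mk]
    conv_rhs => rw [← h1]
    generalize coact A e = t
    induction t with
    | zero => simp
    | add s t hs ht => simp only [map_add, hs, ht]
    | tmul a x => simp [counit_star, Bar.smul_mk]

/-- The conjugate `ȳ, x̄ ↦ μ(x, y)‾` of a bilinear map `μ`. -/
def barMap₂ (μ : X →ₗ[ℂ] Y →ₗ[ℂ] Z) : Bar Y →ₗ[ℂ] Bar X →ₗ[ℂ] Bar Z :=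
  LinearMap.mk₂ ℂ (fun y x => Bar.mk (μ (Bar.out x) (Bar.out y)))
    (by simp) (fun c y x => by
      obtain ⟨y, rfl⟩ := Bar.mk.surjective y
      simp [Bar.smul_mk]) (by simp) (fun c y x => by
      obtain ⟨x, rfl⟩ := Bar.mk.surjective x
      simp [Bar.smul_mk])

@[simp] lemma barMap₂_mk (μ : X →ₗ[ℂ] Y →ₗ[ℂ] Z) (x : X) (y : Y) :
    barMap₂ μ (Bar.mk y) (Bar.mk x) = Bar.mk (μ x y) := rfl

lemma Colinear.barMap₂ [LeftCoaction A Z] {μ : X →ₗ[ℂ] Y →ₗ[ℂ] Z} (hμ : Colinear A μ) :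
    Colinear A (barMap₂ μ) := by
  rw [colinear_iff_map₂] at hμ ⊢
  intro y x
  obtain ⟨y, rfl⟩ := Bar.mk.surjective y
  obtain ⟨x, rfl⟩ := Bar.mk.surjective x
  rw [barMap₂_mk, coact_mk, coact_mk, coact_mk, hμ]
  generalize coact A x = s
  generalize coact A y = t
  induction s with
  | zero => simp
  | add s s' hs hs' => simp only [map_add, hs, hs', LinearMap.add_apply]
  | tmul a b =>
    induction t with
    | zero => simp
    | add t t' ht ht' => simp only [map_add, ht, ht', LinearMap.add_apply]
    | tmul c d => simp

/-- The conjugate of the action of a functional on a bilinear map. -/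
lemma mk_act_lift (φ : Fn (A ⊗[ℂ] A)) (μ : X →ₗ[ℂ] Y →ₗ[ℂ] Z) (x : X) (y : Y) :
    Bar.mk (act φ (TensorProduct.lift μ) (x ⊗ₜ[ℂ] y)) =
      act (TwoCocycle.starFlip φ) (TensorProduct.lift (barMap₂ μ)) (Bar.mk y ⊗ₜ[ℂ] Bar.mk x) := by
  rw [act_apply, act_apply, coact_tmul, coact_tmul, coact_mk, coact_mk]
  generalize coact A x = s
  generalize coact A y = t
  induction s with
  | zero => simp
  | add s s' hs hs' =>
    simp only [map_add, hs, hs', TensorProduct.add_tmul, TensorProduct.tmul_add]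
  | tmul a b =>
    induction t with
    | zero => simp
    | add t t' ht ht' =>
      simp only [map_add, ht, ht', TensorProduct.add_tmul, TensorProduct.tmul_add]
    | tmul c d =>
      have h : (TwoCocycle.starFlip φ).ofConv (star c ⊗ₜ[ℂ] star a) =
          conj (φ.ofConv (a ⊗ₜ c)) := by simp
      simp [h, Bar.smul_mk]

lemma mk_act_id {X : Type*} [AddCommGroup X] [Module ℂ X] [LeftCoaction A X] (φ : Fn A) (x : X) :
    Bar.mk (act φ LinearMap.id x) = act (starFn φ) LinearMap.id (Bar.mk x) := by
  rw [act_apply, act_apply, coact_mk]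
  generalize coact A x = t
  induction t with
  | zero => simp
  | add s t hs ht => simp only [map_add, hs, ht]
  | tmul a x =>
    have h : (starFn φ).ofConv (star a) = conj (φ.ofConv a) := by simp
    simp [h, Bar.smul_mk]

/-- Twisting commutes with conjugation, up to the maps `𝔑`. -/
lemma TwoCocycle.IsUnitary.frakN_mk_twist [HopfStarAlgebra A] [IsComod A X] [IsComod A Y]
    [LeftCoaction A Z]
    {γ : TwoCocycle A} (hγ : γ.IsUnitary) {μ : X →ₗ[ℂ] Y →ₗ[ℂ] Z} (hμ : Colinear A μ) (x : X)
    (y : Y) : γ.frakN (Bar.mk (γ.twist μ (x ⊗ₜ y))) =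
      γ.twist (barMap₂ μ) (γ.frakN (Bar.mk y) ⊗ₜ γ.frakN (Bar.mk x)) := by
  have h1 : γ.frakN (Bar.mk (γ.twist μ (x ⊗ₜ y))) =
      act (TwoCocycle.starFlip γ.fn) (act γ.fnVbar LinearMap.id ∘ₗ TensorProduct.lift (barMap₂ μ))
        (Bar.mk y ⊗ₜ[ℂ] Bar.mk x) := by
    rw [← apply_act, ← mk_act_lift]
    rfl
  have h2 : γ.twist (barMap₂ μ) ∘ₗ TensorProduct.map (act γ.fnVbar LinearMap.id)
      (act γ.fnVbar LinearMap.id) = act (box γ.fnVbar γ.fnVbar * γ.fn)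
        (TensorProduct.lift (barMap₂ μ)) := by
    rw [map_act_act, comp_act, TensorProduct.map_id, LinearMap.comp_id, twist_eq_act, act_act]
  rw [h1, hμ.barMap₂.act_comp, act_act, LinearMap.id_comp, hγ.starFlip_fn,
      γ.antiFlip_fnInv_mul_pull_fnVbar, ← h2]
  rfl

/-- A relation between a bilinear map and a conjugate one persists after twisting. This is where
the unitarity of the cocycle is used. -/
theorem TwoCocycle.IsUnitary.apply_frakN_mk_twist [HopfStarAlgebra A] [IsComod A X] [IsComod A Y]
    [LeftCoaction A Z] {X' Y' Z' : Type*} [AddCommGroup X'] [Module ℂ X'] [LeftCoaction A X']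
    [AddCommGroup Y'] [Module ℂ Y'] [LeftCoaction A Y'] [AddCommGroup Z'] [Module ℂ Z']
    {γ : TwoCocycle A} (hγ : γ.IsUnitary) {μ : X →ₗ[ℂ] Y →ₗ[ℂ] Z} (hμ : Colinear A μ)
    {μ' : Y' →ₗ[ℂ] X' →ₗ[ℂ] Z'} {f : Bar X →ₗ[ℂ] X'} {g : Bar Y →ₗ[ℂ] Y'} {k : Bar Z →ₗ[ℂ] Z'}
    (hf : ColinearMap A f) (hg : ColinearMap A g)
    (h : ∀ x y, k (Bar.mk (μ x y)) = μ' (g (Bar.mk y)) (f (Bar.mk x))) (x : X) (y : Y) :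
    k (γ.frakN (Bar.mk (γ.twist μ (x ⊗ₜ y)))) =
      γ.twist μ' (g (γ.frakN (Bar.mk y)) ⊗ₜ f (γ.frakN (Bar.mk x))) := by
  rw [hγ.frakN_mk_twist hμ]
  exact map_twist γ hg hf (fun y x => h (Bar.out x) (Bar.out y)) _ _

end Bar

/-! ### The deformed comodule `*`-algebra and the deformed module -/

section Units

variable {A : Type u} [Ring A] [HopfAlgebra ℂ A] (γ : TwoCocycle A)
  {X Y Z : Type*} [AddCommGroup X] [Module ℂ X] [LeftCoaction A X]
  [AddCommGroup Y] [Module ℂ Y] [LeftCoaction A Y] [AddCommGroup Z] [Module ℂ Z]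

/-- Since the cocycle is unital, twisting has no effect on coinvariant elements. -/
lemma twist_of_coact_left [IsComod A Y] (μ : X →ₗ[ℂ] Y →ₗ[ℂ] Z) {x : X} (hx : coact A x = 1 ⊗ₜ x)
    (y : Y) : γ.twist μ (x ⊗ₜ y) = μ x y := by
  have h : ∀ y : Y, coact (A ⊗[ℂ] A) (TensorProduct.mk ℂ X Y x y) = TensorProduct.map
      (TwoCocycle.unitLeft A).toLinearMap (TensorProduct.mk ℂ X Y x) (coact A y) := by
    intro y
    rw [TensorProduct.mk_apply, coact_tmul, hx]
    generalize coact A y = t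
    induction t with
    | zero => simp
    | add s t hs ht => simp only [map_add, TensorProduct.tmul_add, hs, ht]
    | tmul a x => simp
  have h1 : act γ.fn (TensorProduct.lift μ) ∘ₗ TensorProduct.mk ℂ X Y x = _ :=
    act_comp (TwoCocycle.unitLeft A) _ h γ.fn (TensorProduct.lift μ)
  rw [γ.pull_unitLeft_fn, act_one] at h1
  exact congr($h1 y)

lemma twist_of_coact_right [IsComod A X] (μ : X →ₗ[ℂ] Y →ₗ[ℂ] Z) {y : Y}
    (hy : coact A y = 1 ⊗ₜ y) (x : X) : γ.twist μ (x ⊗ₜ y) = μ x y := by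
  have h : ∀ x : X, coact (A ⊗[ℂ] A) ((TensorProduct.mk ℂ X Y).flip y x) = TensorProduct.map
      (TwoCocycle.unitRight A).toLinearMap ((TensorProduct.mk ℂ X Y).flip y) (coact A x) := by
    intro x
    rw [LinearMap.flip_apply, TensorProduct.mk_apply, coact_tmul, hy]
    generalize coact A x = t
    induction t with
    | zero => simp
    | add s t hs ht => simp only [map_add, TensorProduct.add_tmul, hs, ht]
    | tmul a x => simp
  have h1 : act γ.fn (TensorProduct.lift μ) ∘ₗ (TensorProduct.mk ℂ X Y).flip y = _ :=
    act_comp (TwoCocycle.unitRight A) _ h γ.fn (TensorProduct.lift μ)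
  rw [γ.pull_unitRight_fn, act_one] at h1
  exact congr($h1 x)

end Units

section Algebra

variable {A : Type u} {B : Type v} [Ring A] [HopfAlgebra ℂ A] [StarRing A] [StarModule ℂ A]
  [Ring B] [Algebra ℂ B] [StarRing B] [StarModule ℂ B] [LeftCoaction A B] [ComoduleStarAlgebra A B]

variable (A B) in
lemma colinear_mul : Colinear A (LinearMap.mul ℂ B) := by
  rw [colinear_iff_map₂]
  exact RelHopfModule.coact_smul (A := A) (B := B) (E := B)

/-- The star of `B` as a linear map `b̄ ↦ b*` on the conjugate space. -/
def starBar (B : Type v) [Ring B] [Algebra ℂ B] [StarRing B] [StarModule ℂ B] : Bar B →ₗ[ℂ] B where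
  toFun z := star (Bar.out z)
  map_add' := by simp
  map_smul' c z := by
    obtain ⟨z, rfl⟩ := Bar.mk.surjective z
    simp [Bar.smul_mk]

@[simp] lemma starBar_mk (b : B) : starBar B (Bar.mk b) = star b := rfl

variable (A B) in
lemma colinearMap_starBar : ColinearMap A (starBar B) := by
  intro z
  obtain ⟨b, rfl⟩ := Bar.mk.surjective z
  rw [starBar_mk, ComoduleStarAlgebra.coact_star, coact_mk]
  generalize coact A b = t
  induction t with
  | zero => simp
  | add s t hs ht => simp only [map_add, star_add, hs, ht]
  | tmul a x => simp

lemma starAlg_eq (γ : TwoCocycle A) (b : B) :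
    γ.starAlg b = starBar B (γ.frakN (Bar.mk b)) :=
  ((colinearMap_starBar A B).apply_contract γ.Vbar (Bar.mk b)).symm

lemma coact_one' : coact A (1 : B) = 1 ⊗ₜ 1 := ComoduleStarAlgebra.coact_one

end Algebra

/-- The underlying space of a deformed object: a copy of `V`, to carry the deformed structure. -/
def Twisted {A : Type u} [Ring A] [HopfAlgebra ℂ A] (_ : TwoCocycle A) (V : Type v) : Type v := V

namespace Twisted

section

variable {A : Type u} {V : Type v} [Ring A] [HopfAlgebra ℂ A] {γ : TwoCocycle A}
  [AddCommGroup V]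

instance : AddCommGroup (Twisted γ V) := inferInstanceAs (AddCommGroup V)

/-- The identity map `V → V_γ`. -/
def mk : V ≃+ Twisted γ V := AddEquiv.refl V

/-- The identity map `V_γ → V`. -/
def out : Twisted γ V ≃+ V := mk.symm

variable [Module ℂ V]

instance : Module ℂ (Twisted γ V) := inferInstanceAs (Module ℂ V)

end

section Algebra

variable {A : Type u} {B : Type v} [Ring A] [HopfAlgebra ℂ A] [StarRing A] [StarModule ℂ A]
  [Ring B] [Algebra ℂ B] [StarRing B] [StarModule ℂ B] [LeftCoaction A B] [ComoduleStarAlgebra A B]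
  {γ : TwoCocycle A}

instance : Ring (Twisted γ B) where
  __ := (inferInstance : AddCommGroup (Twisted γ B))
  mul b c := mk (γ.twist (LinearMap.mul ℂ B) (out b ⊗ₜ out c))
  one := mk 1
  left_distrib h k l := by
    change mk (γ.twist (LinearMap.mul ℂ B) (out h ⊗ₜ out (k + l))) =
      mk (γ.twist (LinearMap.mul ℂ B) (out h ⊗ₜ out k)) +
        mk (γ.twist (LinearMap.mul ℂ B) (out h ⊗ₜ out l))
    simp [TensorProduct.tmul_add]
  right_distrib h k l := by
    change mk (γ.twist (LinearMap.mul ℂ B) (out (h + k) ⊗ₜ out l)) =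
      mk (γ.twist (LinearMap.mul ℂ B) (out h ⊗ₜ out l)) +
        mk (γ.twist (LinearMap.mul ℂ B) (out k ⊗ₜ out l))
    simp [TensorProduct.add_tmul]
  zero_mul h := by
    change mk (γ.twist (LinearMap.mul ℂ B) (out (0 : Twisted γ B) ⊗ₜ out h)) = 0
    simp
  mul_zero h := by
    change mk (γ.twist (LinearMap.mul ℂ B) (out h ⊗ₜ out (0 : Twisted γ B))) = 0
    simp
  mul_assoc b c d := congr(mk $(twist_assoc γ (colinear_mul A B) (colinear_mul A B) mul_assoc
    (out b) (out c) (out d)))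
  one_mul b := (twist_of_coact_left γ _ coact_one' (out b)).trans (one_mul (out b))
  mul_one b := (twist_of_coact_right γ _ coact_one' (out b)).trans (mul_one (out b))

instance : Algebra ℂ (Twisted γ B) := Algebra.ofModule
  (fun c h k => by
    change γ.twist (LinearMap.mul ℂ B) ((c • out h) ⊗ₜ out k) =
      c • γ.twist (LinearMap.mul ℂ B) (out h ⊗ₜ out k)
    rw [← TensorProduct.smul_tmul', map_smul])
  (fun c h k => by
    change γ.twist (LinearMap.mul ℂ B) (out h ⊗ₜ (c • out k)) =
      c • γ.twist (LinearMap.mul ℂ B) (out h ⊗ₜ out k)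
    rw [TensorProduct.tmul_smul, map_smul])

end Algebra

/-- The identity map `V → V_γ` as a linear isomorphism. -/
def of {A : Type u} {V : Type v} [Ring A] [HopfAlgebra ℂ A] {γ : TwoCocycle A}
    [AddCommGroup V] [Module ℂ V] : V ≃ₗ[ℂ] Twisted γ V := LinearEquiv.refl ℂ V

section Coaction

variable {A : Type u} {V : Type v} [Ring A] [HopfAlgebra ℂ A] [StarRing A] [StarModule ℂ A]
  {γ : TwoCocycle A} (Aγ : TwistedHopf γ) [AddCommGroup V] [Module ℂ V] [LeftCoaction A V]

instance : LeftCoaction Aγ.carrier (Twisted γ V) where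
  coaction := TensorProduct.map Aγ.of.toLinearMap of.toLinearMap ∘ₗ coact A ∘ₗ of.symm.toLinearMap

lemma coact_of (v : V) : coact Aγ.carrier (of v : Twisted γ V) =
    TensorProduct.map Aγ.of.toLinearMap of.toLinearMap (coact A v) := rfl

instance [LeftComodule A V] : LeftComodule Aγ.carrier (Twisted γ V) where
  coassoc v := by
    obtain ⟨v, rfl⟩ := of.surjective v
    let σ : V ≃ₗ[ℂ] Twisted γ V := of
    have h1 : ∀ t : A ⊗[ℂ] V, TensorProduct.assoc ℂ _ _ _ ((comul (R := ℂ)).rTensor (Twisted γ V)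
        (TensorProduct.map Aγ.of.toLinearMap σ.toLinearMap t)) =
        TensorProduct.map Aγ.of.toLinearMap (TensorProduct.map Aγ.of.toLinearMap σ.toLinearMap)
          (TensorProduct.assoc ℂ _ _ _ ((comul (R := ℂ)).rTensor V t)) := by
      intro t
      induction t with
      | zero => simp
      | add s t hs ht => simp only [map_add, hs, ht]
      | tmul a v =>
        simp only [TensorProduct.map_tmul, LinearMap.rTensor_tmul, LinearEquiv.coe_coe,
          Aγ.comul_of]
        generalize comul (R := ℂ) a = s
        induction s with
        | zero => simp
        | add s s' hs hs' => simp only [TensorProduct.add_tmul, map_add, hs, hs']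
        | tmul a b => simp
    have h2 : ∀ t : A ⊗[ℂ] V, (coact Aγ.carrier).lTensor Aγ.carrier
        (TensorProduct.map Aγ.of.toLinearMap σ.toLinearMap t) =
        TensorProduct.map Aγ.of.toLinearMap (TensorProduct.map Aγ.of.toLinearMap σ.toLinearMap)
          ((coact A).lTensor A t) := by
      intro t
      induction t with
      | zero => simp
      | add s t hs ht => simp only [map_add, hs, ht]
      | tmul a v => simp [σ, coact_of]
    rw [coact_of, h1, h2, LeftComodule.coassoc]
  counit v := by
    obtain ⟨v, rfl⟩ := of.surjective v
    rw [coact_of]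
    conv_rhs => rw [← LeftComodule.counit (A := A) v]
    generalize coact A v = t
    induction t with
    | zero => simp
    | add s t hs ht => simp only [map_add, hs, ht]
    | tmul a v => simp [Aγ.counit_of]

end Coaction

end Twisted

section

variable {A : Type u} {B : Type v} [Ring A] [HopfAlgebra ℂ A] [StarRing A] [StarModule ℂ A]
  [HopfStarAlgebra A]
  [Ring B] [Algebra ℂ B] [StarRing B] [StarModule ℂ B] [LeftCoaction A B] [ComoduleStarAlgebra A B]
  {γ : TwoCocycle A}

lemma TwoCocycle.IsUnitary.starAlg_twist (hγ : γ.IsUnitary) (b c : B) :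
    γ.starAlg (γ.twist (LinearMap.mul ℂ B) (b ⊗ₜ c)) =
      γ.twist (LinearMap.mul ℂ B) (γ.starAlg c ⊗ₜ γ.starAlg b) := by
  simp only [starAlg_eq]
  exact hγ.apply_frakN_mk_twist (colinear_mul A B) (colinearMap_starBar A B)
    (colinearMap_starBar A B) (by simp) b c

/-- `𝔑(x̄)` is the conjugate of `V(x₍₋₁₎) x₍₀₎`. -/
lemma TwoCocycle.IsUnitary.frakN_mk {X : Type*} [AddCommGroup X] [Module ℂ X] [LeftCoaction A X]
    (hγ : γ.IsUnitary) (x : X) : γ.frakN (Bar.mk x) = Bar.mk (contract γ.V x) := by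
  have h := mk_act_id γ.fnV x
  rw [hγ.starFn_fnV] at h
  exact h.symm

lemma TwoCocycle.IsUnitary.starAlg_starAlg (hγ : γ.IsUnitary) (b : B) :
    γ.starAlg (γ.starAlg b) = b := by
  rw [starAlg_eq (b := b), hγ.frakN_mk, starBar_mk, TwoCocycle.starAlg, star_star]
  exact contract_contract γ.fnV_mul_fnVbar b

/-- The coaction of `V̄(x₍₋₁₎) x₍₀₎`. -/
lemma coact_contract_Vbar {X : Type*} [AddCommGroup X] [Module ℂ X] [LeftCoaction A X]
    [IsComod A X] (γ : TwoCocycle A) (x : X) : coact A (contract γ.Vbar x) = TensorProduct.map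
    (toConv (Algebra.linearMap ℂ A ∘ₗ γ.Vbar) * toConv LinearMap.id *
      toConv (Algebra.linearMap ℂ A ∘ₗ γ.V)).ofConv (contract γ.Vbar) (coact A x) := by
  refine eq_of_box fun φ ξ => ?_
  have h1 := comp_mul_linearMap γ.fnV
    (toConv (Algebra.linearMap ℂ A ∘ₗ γ.Vbar) * toConv LinearMap.id) φ
  have h2 := comp_linearMap_mul γ.fnVbar (toConv LinearMap.id) φ
  have h3 := h1.trans congr($h2 * γ.fnV)
  have h4 : toConv (ξ.ofConv ∘ₗ contract γ.Vbar) = toConv (act γ.fnVbar ξ.ofConv) :=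
    congr(toConv $(comp_act γ.fnVbar LinearMap.id ξ.ofConv))
  rw [box_map, h4]
  refine Eq.trans ?_ congr(box $h3.symm _ _)
  rw [box_coact, box_coact, ofConv_toConv, act_act, mul_assoc _ γ.fnV, γ.fnV_mul_fnVbar, mul_one]
  have h5 := apply_act γ.fnVbar LinearMap.id (act φ ξ.ofConv) x
  rw [LinearMap.comp_id, act_act] at h5
  exact h5

lemma coact_starAlg (b : B) : coact A (γ.starAlg b) = TensorProduct.map
    (toConv (Algebra.linearMap ℂ A ∘ₗ γ.Vbar) * toConv LinearMap.id *
      toConv (Algebra.linearMap ℂ A ∘ₗ γ.V)).ofConv (contract γ.Vbar) (star (coact A b)) := by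
  rw [← ComoduleStarAlgebra.coact_star]
  exact coact_contract_Vbar γ (star b)

/-- The comodule `*`-algebra `B_γ`, for a unitary cocycle `γ`. -/
def twistedAlgebra (Aγ : TwistedHopf γ) (B : Type v) [Ring B] [Algebra ℂ B] [StarRing B]
    [StarModule ℂ B] [LeftCoaction A B] [ComoduleStarAlgebra A B] (hγ : γ.IsUnitary) :
    TwistedAlgebra Aγ B :=
  letI : StarRing (Twisted γ B) :=
    { star := fun b => Twisted.of (γ.starAlg (Twisted.of.symm b))
      star_involutive := fun b => hγ.starAlg_starAlg (Twisted.of.symm b)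
      star_mul := fun b c => hγ.starAlg_twist (Twisted.of.symm b) (Twisted.of.symm c)
      star_add := fun b c => by simp [TwoCocycle.starAlg] }
  haveI : StarModule ℂ (Twisted γ B) := ⟨fun c b => by
    change Twisted.of (γ.starAlg (c • Twisted.of.symm b)) =
      conj c • Twisted.of (γ.starAlg (Twisted.of.symm b))
    simp [TwoCocycle.starAlg]⟩
  haveI : ComoduleStarAlgebra Aγ.carrier (Twisted γ B) :=
    { coact_one := by
        have h := Twisted.coact_of Aγ (1 : B)
        rw [coact_one', TensorProduct.map_tmul] at h
        refine h.trans ?_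
        rw [Algebra.TensorProduct.one_def, Aγ.one_eq]
        rfl
      coact_mul := fun b c => by
        obtain ⟨b, rfl⟩ := Twisted.of.surjective b
        obtain ⟨c, rfl⟩ := Twisted.of.surjective c
        have h := Twisted.coact_of Aγ (γ.twist (LinearMap.mul ℂ B) (b ⊗ₜ c))
        rw [coact_twist γ (colinear_mul A B), coact_tmul] at h
        refine h.trans ?_
        rw [Twisted.coact_of, Twisted.coact_of]
        generalize coact A b = s
        generalize coact A c = t
        induction s with
        | zero => simp
        | add s s' hs hs' => simp only [TensorProduct.add_tmul, map_add, hs, hs', add_mul]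
        | tmul a b =>
          induction t with
          | zero => simp
          | add t t' ht ht' => simp only [TensorProduct.tmul_add, map_add, ht, ht', mul_add]
          | tmul c d =>
            simp [Aγ.mul_of]
            rfl
      coact_star := fun b => by
        obtain ⟨b, rfl⟩ := Twisted.of.surjective b
        have h := Twisted.coact_of Aγ (γ.starAlg b)
        rw [coact_starAlg] at h
        refine h.trans ?_
        rw [Twisted.coact_of]
        generalize coact A b = t
        induction t with
        | zero => simp
        | add s t hs ht => simp only [map_add, star_add, hs, ht]
        | tmul a b =>
          simp [Aγ.star_of]
          rfl }
  { carrier := Twisted γ B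
    of := Twisted.of
    coact_of := Twisted.coact_of Aγ
    one_eq := rfl
    mul_of := fun _ _ => rfl
    star_of := fun _ => rfl }

end

section Module

variable {A : Type u} {B : Type v} {E : Type w} [Ring A] [HopfAlgebra ℂ A]
  [Ring B] [Algebra ℂ B] [LeftCoaction A B]
  [AddCommGroup E] [Module ℂ E] [Module B E] [Module Bᵐᵒᵖ E] [SMulCommClass B Bᵐᵒᵖ E]
  [IsScalarTower ℂ B E] [IsScalarTower ℂ Bᵐᵒᵖ E] [LeftCoaction A E] [RelHopfModule A B E]
  {γ : TwoCocycle A}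

variable (A B E) in
lemma colinear_leftAct : Colinear A (leftAct B E) := by
  rw [colinear_iff_map₂]
  exact RelHopfModule.coact_smul

variable (A B E) in
lemma colinear_rightAct : Colinear A (rightAct B E) := by
  rw [colinear_iff_map₂]
  exact fun e b => RelHopfModule.coact_op_smul b e

variable [StarRing A] [StarModule ℂ A] [StarRing B]

lemma TwistedAlgebra.mul_eq {Aγ : TwistedHopf γ} (Bγ : TwistedAlgebra Aγ B) (b c : Bγ.carrier) :
    b * c = Bγ.of (γ.twist (LinearMap.mul ℂ B) (Bγ.of.symm b ⊗ₜ Bγ.of.symm c)) := by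
  rw [← Bγ.mul_of, LinearEquiv.apply_symm_apply, LinearEquiv.apply_symm_apply]

variable [StarModule ℂ B] [ComoduleStarAlgebra A B]

/-- The deformed relative Hopf module `Γ(E)`. -/
def twistedModule {Aγ : TwistedHopf γ} (Bγ : TwistedAlgebra Aγ B) (E : Type w)
    [AddCommGroup E] [Module ℂ E] [Module B E] [Module Bᵐᵒᵖ E] [SMulCommClass B Bᵐᵒᵖ E]
    [IsScalarTower ℂ B E] [IsScalarTower ℂ Bᵐᵒᵖ E] [LeftCoaction A E] [RelHopfModule A B E] :
    TwistedModule Bγ E :=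
  letI : Module Bγ.carrier (Twisted γ E) :=
    { smul := fun b e => Twisted.of (γ.twist (leftAct B E) (Bγ.of.symm b ⊗ₜ Twisted.of.symm e))
      one_smul := fun e => by
        change γ.twist (leftAct B E) (Bγ.of.symm 1 ⊗ₜ Twisted.of.symm e) = Twisted.of.symm e
        rw [Bγ.one_eq, LinearEquiv.symm_apply_apply, twist_of_coact_left γ _ coact_one',
          leftAct_apply, one_smul]
      mul_smul := fun b c e => by
        change γ.twist (leftAct B E) (Bγ.of.symm (b * c) ⊗ₜ Twisted.of.symm e) =
          γ.twist (leftAct B E) (Bγ.of.symm b ⊗ₜ γ.twist (leftAct B E) (Bγ.of.symm c ⊗ₜ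
            Twisted.of.symm e))
        rw [Bγ.mul_eq, LinearEquiv.symm_apply_apply]
        exact twist_assoc γ (colinear_mul A B) (colinear_leftAct A B E) mul_smul _ _ _
      smul_zero := fun b => by
        change γ.twist (leftAct B E) (Bγ.of.symm b ⊗ₜ Twisted.of.symm 0) = 0
        simp
      smul_add := fun b e f => by
        change γ.twist (leftAct B E) (Bγ.of.symm b ⊗ₜ Twisted.of.symm (e + f)) =
          γ.twist (leftAct B E) (Bγ.of.symm b ⊗ₜ Twisted.of.symm e) +
            γ.twist (leftAct B E) (Bγ.of.symm b ⊗ₜ Twisted.of.symm f)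
        simp [TensorProduct.tmul_add]
      add_smul := fun b c e => by
        change γ.twist (leftAct B E) (Bγ.of.symm (b + c) ⊗ₜ Twisted.of.symm e) =
          γ.twist (leftAct B E) (Bγ.of.symm b ⊗ₜ Twisted.of.symm e) +
            γ.twist (leftAct B E) (Bγ.of.symm c ⊗ₜ Twisted.of.symm e)
        simp [TensorProduct.add_tmul]
      zero_smul := fun e => by
        change γ.twist (leftAct B E) (Bγ.of.symm 0 ⊗ₜ Twisted.of.symm e) = 0
        simp }
  letI : Module Bγ.carrierᵐᵒᵖ (Twisted γ E) :=
    { smul := fun b e => Twisted.of (γ.twist (rightAct B E) (Twisted.of.symm e ⊗ₜ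
        Bγ.of.symm (unop b)))
      one_smul := fun e => by
        change γ.twist (rightAct B E) (Twisted.of.symm e ⊗ₜ Bγ.of.symm 1) = Twisted.of.symm e
        rw [Bγ.one_eq, LinearEquiv.symm_apply_apply, twist_of_coact_right γ _ coact_one',
          rightAct_apply, op_one, one_smul]
      mul_smul := fun b c e => by
        change γ.twist (rightAct B E) (Twisted.of.symm e ⊗ₜ Bγ.of.symm (unop c * unop b)) =
          γ.twist (rightAct B E) (γ.twist (rightAct B E) (Twisted.of.symm e ⊗ₜ
            Bγ.of.symm (unop c)) ⊗ₜ Bγ.of.symm (unop b))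
        rw [Bγ.mul_eq, LinearEquiv.symm_apply_apply]
        exact (twist_assoc γ (colinear_rightAct A B E) (colinear_mul A B)
          (fun e b c => by simp [mul_smul]) _ _ _).symm
      smul_zero := fun b => by
        change γ.twist (rightAct B E) (Twisted.of.symm 0 ⊗ₜ Bγ.of.symm (unop b)) = 0
        simp
      smul_add := fun b e f => by
        change γ.twist (rightAct B E) (Twisted.of.symm (e + f) ⊗ₜ Bγ.of.symm (unop b)) =
          γ.twist (rightAct B E) (Twisted.of.symm e ⊗ₜ Bγ.of.symm (unop b)) +
            γ.twist (rightAct B E) (Twisted.of.symm f ⊗ₜ Bγ.of.symm (unop b))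
        simp [TensorProduct.add_tmul]
      add_smul := fun b c e => by
        change γ.twist (rightAct B E) (Twisted.of.symm e ⊗ₜ Bγ.of.symm (unop (b + c))) =
          γ.twist (rightAct B E) (Twisted.of.symm e ⊗ₜ Bγ.of.symm (unop b)) +
            γ.twist (rightAct B E) (Twisted.of.symm e ⊗ₜ Bγ.of.symm (unop c))
        simp [TensorProduct.tmul_add]
      zero_smul := fun e => by
        change γ.twist (rightAct B E) (Twisted.of.symm e ⊗ₜ Bγ.of.symm (unop 0)) = 0
        simp }
  haveI : SMulCommClass Bγ.carrier Bγ.carrierᵐᵒᵖ (Twisted γ E) := ⟨fun b c e =>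
    (twist_assoc γ (colinear_leftAct A B E) (colinear_rightAct A B E)
      (fun b e c => (smul_comm b (op c) e).symm) (Bγ.of.symm b) (Twisted.of.symm e)
      (Bγ.of.symm (unop c))).symm⟩
  haveI : IsScalarTower ℂ Bγ.carrier (Twisted γ E) := ⟨fun c b e => by
    change γ.twist (leftAct B E) (Bγ.of.symm (c • b) ⊗ₜ Twisted.of.symm e) =
      c • γ.twist (leftAct B E) (Bγ.of.symm b ⊗ₜ Twisted.of.symm e)
    rw [map_smul, ← TensorProduct.smul_tmul', map_smul]⟩
  haveI : IsScalarTower ℂ Bγ.carrierᵐᵒᵖ (Twisted γ E) := ⟨fun c b e => by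
    change γ.twist (rightAct B E) (Twisted.of.symm e ⊗ₜ Bγ.of.symm (c • unop b)) =
      c • γ.twist (rightAct B E) (Twisted.of.symm e ⊗ₜ Bγ.of.symm (unop b))
    rw [map_smul, TensorProduct.tmul_smul, map_smul]⟩
  have smul_of : ∀ (b : B) (e : E), Bγ.of b • (Twisted.of e : Twisted γ E) =
      Twisted.of (γ.twist (leftAct B E) (b ⊗ₜ e)) := fun b e => by
    change Twisted.of (γ.twist (leftAct B E) (Bγ.of.symm (Bγ.of b) ⊗ₜ e)) = _
    rw [LinearEquiv.symm_apply_apply]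
  have op_smul_of : ∀ (b : B) (e : E), op (Bγ.of b) • (Twisted.of e : Twisted γ E) =
      Twisted.of (γ.twist (rightAct B E) (e ⊗ₜ b)) := fun b e => by
    change Twisted.of (γ.twist (rightAct B E) (e ⊗ₜ Bγ.of.symm (Bγ.of b))) = _
    rw [LinearEquiv.symm_apply_apply]
  haveI : RelHopfModule Aγ.carrier Bγ.carrier (Twisted γ E) :=
    { coact_smul := fun b e => by
        obtain ⟨b, rfl⟩ := Bγ.of.surjective b
        obtain ⟨e, rfl⟩ := Twisted.of.surjective e
        rw [smul_of, Twisted.coact_of, Twisted.coact_of, Bγ.coact_of,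
          coact_twist γ (colinear_leftAct A B E), coact_tmul]
        generalize coact A b = s
        generalize coact A e = t
        induction s with
        | zero => simp
        | add s s' hs hs' =>
          simp only [TensorProduct.add_tmul, map_add, hs, hs', LinearMap.add_apply]
        | tmul a b =>
          induction t with
          | zero => simp
          | add t t' ht ht' => simp only [TensorProduct.tmul_add, map_add, ht, ht']
          | tmul c d => simp [Aγ.mul_of, smul_of]
      coact_op_smul := fun b e => by
        obtain ⟨b, rfl⟩ := Bγ.of.surjective b
        obtain ⟨e, rfl⟩ := Twisted.of.surjective e
        rw [op_smul_of, Twisted.coact_of, Twisted.coact_of, Bγ.coact_of,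
          coact_twist γ (colinear_rightAct A B E), coact_tmul]
        generalize coact A b = s
        generalize coact A e = t
        induction t with
        | zero => simp
        | add s s' hs hs' =>
          simp only [TensorProduct.add_tmul, map_add, hs, hs', LinearMap.add_apply]
        | tmul a b =>
          induction s with
          | zero => simp
          | add t t' ht ht' => simp only [TensorProduct.tmul_add, map_add, ht, ht']
          | tmul c d => simp [Aγ.mul_of, op_smul_of] }
  { carrier := Twisted γ E
    of := Twisted.of
    coact_of := Twisted.coact_of Aγ
    smul_of := smul_of
    op_smul_of := op_smul_of }

end Module

/-! ### Covariance and colinearity -/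

section Pairing

variable {A : Type u} [Ring A] [HopfAlgebra ℂ A]
  {X Y Z : Type*} [AddCommGroup X] [Module ℂ X] [LeftCoaction A X]
  [AddCommGroup Y] [Module ℂ Y] [LeftCoaction A Y] [AddCommGroup Z] [Module ℂ Z] [LeftCoaction A Z]

/-- The map `a ⊗ (b ⊗ z) ↦ a b ⊗ z`. -/
def mulTensor (A : Type u) [Ring A] [HopfAlgebra ℂ A] (Z : Type*) [AddCommGroup Z] [Module ℂ Z] :
    A ⊗[ℂ] (A ⊗[ℂ] Z) →ₗ[ℂ] A ⊗[ℂ] Z :=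
  (LinearMap.mul' ℂ A).rTensor Z ∘ₗ (TensorProduct.assoc ℂ A A Z).symm.toLinearMap

@[simp] lemma mulTensor_tmul (a b : A) (z : Z) :
    mulTensor A Z (a ⊗ₜ (b ⊗ₜ z)) = (a * b) ⊗ₜ z := rfl

/-- `x ↦ S(x₍₋₁₎) f(x₍₀₎)₍₋₁₎ ⊗ f(x₍₀₎)₍₀₎`. -/
def antipodeCoact (A : Type u) [Ring A] [HopfAlgebra ℂ A] [LeftCoaction A X] [LeftCoaction A Z]
    (f : X →ₗ[ℂ] Z) : X →ₗ[ℂ] A ⊗[ℂ] Z :=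
  mulTensor A Z ∘ₗ TensorProduct.map (HopfAlgebra.antipode ℂ) (coact A ∘ₗ f) ∘ₗ coact A

variable [LeftComodule A X]

lemma lTensor_antipodeCoact (f : X →ₗ[ℂ] Z) (x : X) :
    (antipodeCoact A f).lTensor A (coact A x) =
      (mulTensor A Z ∘ₗ TensorProduct.map (HopfAlgebra.antipode ℂ) (coact A ∘ₗ f)).lTensor A
        (TensorProduct.assoc ℂ A A X ((comul (R := ℂ)).rTensor X (coact A x))) := by
  rw [LeftComodule.coassoc, ← LinearMap.lTensor_comp_apply]
  rfl

/-- `x₍₋₂₎ S(x₍₋₁₎) f(x₍₀₎)₍₋₁₎ ⊗ f(x₍₀₎)₍₀₎ = δ(f(x))`. -/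
lemma mulTensor_antipodeCoact (f : X →ₗ[ℂ] Z) (x : X) :
    mulTensor A Z ((antipodeCoact A f).lTensor A (coact A x)) = coact A (f x) := by
  rw [lTensor_antipodeCoact]
  conv_rhs => rw [← LeftComodule.counit (A := A) x]
  generalize coact A x = t
  induction t with
  | zero => simp
  | add s t hs ht => simp only [map_add, hs, ht]
  | tmul a x =>
    have h : ∀ (s : A ⊗[ℂ] A) (t : A ⊗[ℂ] Z), mulTensor A Z ((mulTensor A Z).lTensor A
        (((HopfAlgebra.antipode ℂ).rTensor _).lTensor A (TensorProduct.assoc ℂ A A _ (s ⊗ₜ t)))) =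
        mulTensor A Z (LinearMap.mul' ℂ A ((HopfAlgebra.antipode ℂ).lTensor A s) ⊗ₜ t) := by
      intro s t
      induction s with
      | zero => simp
      | add s s' hs hs' => simp only [TensorProduct.add_tmul, map_add, hs, hs']
      | tmul a b =>
        induction t with
        | zero => simp
        | add t t' ht ht' => simp only [TensorProduct.tmul_add, map_add, ht, ht']
        | tmul c z => simp [mul_assoc]
    have h1 : ∀ s : A ⊗[ℂ] A, (mulTensor A Z ∘ₗ TensorProduct.map (HopfAlgebra.antipode ℂ)
        (coact A ∘ₗ f)).lTensor A (TensorProduct.assoc ℂ A A X (s ⊗ₜ x)) =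
        (mulTensor A Z).lTensor A (((HopfAlgebra.antipode ℂ).rTensor _).lTensor A
          (TensorProduct.assoc ℂ A A _ (s ⊗ₜ coact A (f x)))) := by
      intro s
      induction s with
      | zero => simp
      | add s s' hs hs' => simp only [TensorProduct.add_tmul, map_add, hs, hs']
      | tmul a b => simp
    rw [LinearMap.rTensor_tmul, h1, h, HopfAlgebra.mul_antipode_lTensor_comul_apply]
    have h2 : ∀ t : A ⊗[ℂ] Z, mulTensor A Z (1 ⊗ₜ t) = t := by
      intro t
      induction t with
      | zero => simp
      | add t t' ht ht' => simp only [TensorProduct.tmul_add, map_add, ht, ht']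
      | tmul c z => simp
    simp [Algebra.algebraMap_eq_smul_one, ← TensorProduct.smul_tmul', h2]

lemma antipodeCoact_id (x : X) : antipodeCoact A LinearMap.id x = 1 ⊗ₜ x :=
  antipode_mul_coact x

/-- For a colinear bilinear map, `S(x₍₋₁₎) μ(x₍₀₎, y)₍₋₁₎ ⊗ μ(x₍₀₎, y)₍₀₎ = y₍₋₁₎ ⊗ μ(x, y₍₀₎)`. -/
lemma Colinear.antipodeCoact_flip {μ : X →ₗ[ℂ] Y →ₗ[ℂ] Z} (hμ : Colinear A μ) (x : X) (y : Y) :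
    antipodeCoact A (μ.flip y) x = (μ x).lTensor A (coact A y) := by
  rw [colinear_iff_map₂] at hμ
  have h1 : ∀ t : A ⊗[ℂ] X, mulTensor A Z (TensorProduct.map (HopfAlgebra.antipode ℂ)
      (coact A ∘ₗ μ.flip y) t) = TensorProduct.map₂ (LinearMap.mul ℂ A) μ (mulTensor A X
        (TensorProduct.map (HopfAlgebra.antipode ℂ) (coact A) t)) (coact A y) := by
    intro t
    induction t with
    | zero => simp
    | add t t' ht ht' => simp only [map_add, ht, ht', LinearMap.add_apply]
    | tmul a x =>
      simp only [TensorProduct.map_tmul, LinearMap.comp_apply, LinearMap.flip_apply, hμ]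
      generalize coact A x = s
      generalize coact A y = t
      induction s with
      | zero => simp
      | add s s' hs hs' => simp only [TensorProduct.tmul_add, map_add, hs, hs',
          LinearMap.add_apply]
      | tmul b x =>
        induction t with
        | zero => simp
        | add t t' ht ht' => simp only [TensorProduct.tmul_add, map_add, ht, ht']
        | tmul c z => simp [mul_assoc]
  have h2 : mulTensor A X (TensorProduct.map (HopfAlgebra.antipode ℂ) (coact A) (coact A x)) =
      1 ⊗ₜ x := antipode_mul_coact x
  have h3 := h1 (coact A x)
  rw [h2] at h3
  refine h3.trans ?_
  generalize coact A y = t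
  induction t with
  | zero => simp
  | add t t' ht ht' => simp only [map_add, ht, ht']
  | tmul c z => simp

/-- The converse of `Colinear.antipodeCoact_flip`. -/
lemma colinear_of_antipodeCoact_flip {μ : X →ₗ[ℂ] Y →ₗ[ℂ] Z}
    (h : ∀ x y, antipodeCoact A (μ.flip y) x = (μ x).lTensor A (coact A y)) : Colinear A μ := by
  rw [colinear_iff_map₂]
  intro x y
  have h1 := mulTensor_antipodeCoact (A := A) (μ.flip y) x
  rw [LinearMap.flip_apply] at h1
  rw [← h1]
  generalize coact A x = t
  induction t with
  | zero => simp
  | add t t' ht ht' => simp only [map_add, ht, ht', LinearMap.add_apply]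
  | tmul a x =>
    rw [LinearMap.lTensor_tmul, h]
    generalize coact A y = s
    induction s with
    | zero => simp
    | add s s' hs hs' => simp only [TensorProduct.tmul_add, map_add, hs, hs']
    | tmul c z => simp

/-- If `μ(x, y) = f(x)` for all `x`, with `f` colinear, then twisting `μ` does not change this. -/
lemma twist_eq_of_forall (γ : TwoCocycle A) {μ : X →ₗ[ℂ] Y →ₗ[ℂ] Z} (hμ : Colinear A μ) {y : Y}
    {f : X →ₗ[ℂ] Z} (hf : ColinearMap A f) (h : ∀ x, μ x y = f x) (x : X) :
    γ.twist μ (x ⊗ₜ y) = f x := by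
  have h1 : ∀ x, (μ x).lTensor A (coact A y) = 1 ⊗ₜ f x := by
    intro x
    have e : μ.flip y = f := LinearMap.ext h
    rw [← hμ.antipodeCoact_flip, e, ← LinearMap.lTensor_tmul, ← antipodeCoact_id]
    simp only [antipodeCoact, LinearMap.comp_apply, LinearMap.comp_id]
    generalize coact A x = t
    induction t with
    | zero => simp
    | add t t' ht ht' => simp only [map_add, ht, ht']
    | tmul a x =>
      simp only [TensorProduct.map_tmul, LinearMap.comp_apply, hf x]
      generalize coact A x = s
      induction s with
      | zero => simp
      | add s s' hs hs' => simp only [TensorProduct.tmul_add, map_add, hs, hs']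
      | tmul c z => simp
  have h2 : ∀ t : A ⊗[ℂ] X, TensorProduct.lid ℂ Z (TensorProduct.map γ.fn.ofConv
      (TensorProduct.lift μ) (TensorProduct.tensorTensorTensorComm ℂ A X A Y (t ⊗ₜ coact A y))) =
      TensorProduct.lid ℂ Z (TensorProduct.map (counit (R := ℂ)) f t) := by
    intro t
    induction t with
    | zero => simp
    | add t t' ht ht' => simp only [map_add, TensorProduct.add_tmul, ht, ht']
    | tmul a x =>
      have h3 : ∀ s : A ⊗[ℂ] Y, TensorProduct.lid ℂ Z (TensorProduct.map γ.fn.ofConv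
          (TensorProduct.lift μ) (TensorProduct.tensorTensorTensorComm ℂ A X A Y
            ((a ⊗ₜ x) ⊗ₜ s))) = TensorProduct.lid ℂ Z (TensorProduct.map
              (γ.fn.ofConv ∘ₗ TensorProduct.mk ℂ A A a) LinearMap.id ((μ x).lTensor A s)) := by
        intro s
        induction s with
        | zero => simp
        | add s s' hs hs' => simp only [TensorProduct.tmul_add, map_add, hs, hs']
        | tmul c z => simp
      rw [h3, h1]
      simp [γ.val_one_right]
  rw [twist_eq_act, act_apply, coact_tmul, h2]
  conv_rhs => rw [← LeftComodule.counit (A := A) x]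
  generalize coact A x = t
  induction t with
  | zero => simp
  | add t t' ht ht' => simp only [map_add, ht, ht']
  | tmul a x => simp

/-- If `y₍₋₁₎ ⊗ γ.twist μ (x ⊗ y₍₀₎) = 0` for all `x`, then `μ(x, y) = 0` for all `x`. -/
lemma apply_eq_zero_of_twist [IsComod A Y] (γ : TwoCocycle A) (μ : X →ₗ[ℂ] Y →ₗ[ℂ] Z) {y : Y}
    (h : ∀ x, (γ.twist μ ∘ₗ TensorProduct.mk ℂ X Y x).lTensor A (coact A y) = 0) (x : X) :
    μ x y = 0 := by
  have h1 : act γ.fnInv (γ.twist μ) = TensorProduct.lift μ := by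
    rw [twist_eq_act, act_act, γ.fnInv_mul_fn, act_one]
  have h2 : ∀ t : A ⊗[ℂ] X, TensorProduct.lid ℂ Z (TensorProduct.map γ.fnInv.ofConv
      (γ.twist μ) (TensorProduct.tensorTensorTensorComm ℂ A X A Y (t ⊗ₜ coact A y))) = 0 := by
    intro t
    induction t with
    | zero => simp
    | add t t' ht ht' => simp only [map_add, TensorProduct.add_tmul, ht, ht', add_zero]
    | tmul a x =>
      have h3 : ∀ s : A ⊗[ℂ] Y, TensorProduct.lid ℂ Z (TensorProduct.map γ.fnInv.ofConv
          (γ.twist μ) (TensorProduct.tensorTensorTensorComm ℂ A X A Y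
            ((a ⊗ₜ x) ⊗ₜ s))) = TensorProduct.lid ℂ Z (TensorProduct.map
              (γ.fnInv.ofConv ∘ₗ TensorProduct.mk ℂ A A a) LinearMap.id
                ((γ.twist μ ∘ₗ TensorProduct.mk ℂ X Y x).lTensor A s)) := by
        intro s
        induction s with
        | zero => simp
        | add s s' hs hs' => simp only [TensorProduct.tmul_add, map_add, hs, hs']
        | tmul c z => simp
      rw [h3, h]
      simp
  have h3 := congr($h1 (x ⊗ₜ y))
  rw [act_apply, coact_tmul, h2, TensorProduct.lift.tmul] at h3
  exact h3.symm

end Pairing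

section Hom

variable {A : Type u} {B : Type v} {E : Type w} {F : Type x} [Ring A] [HopfAlgebra ℂ A]
  [Ring B] [Algebra ℂ B]
  [AddCommGroup E] [Module ℂ E] [Module B E] [Module Bᵐᵒᵖ E] [SMulCommClass B Bᵐᵒᵖ E]
  [IsScalarTower ℂ B E] [IsScalarTower ℂ Bᵐᵒᵖ E]
  [AddCommGroup F] [Module ℂ F] [Module B F] [Module Bᵐᵒᵖ F] [SMulCommClass B Bᵐᵒᵖ F]
  [IsScalarTower ℂ B F] [IsScalarTower ℂ Bᵐᵒᵖ F]
  [LeftCoaction A B] [LeftCoaction A E] [LeftCoaction A F]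
  {W : Type*} [AddCommGroup W] [Module ℂ W] [LeftCoaction A W]

/-- The bilinear map `e, w ↦ i(w)(e)` attached to a linear map `i : W → Hom(E, F)`. -/
def pairing (i : W →ₗ[ℂ] (E →ₗ[B] F)) : E →ₗ[ℂ] W →ₗ[ℂ] F :=
  LinearMap.mk₂ ℂ (fun e w => i w e) (by simp)
    (fun c e w => LinearMap.map_smul_of_tower (i w) c e) (by simp) (by simp)

@[simp] lemma pairing_apply (i : W →ₗ[ℂ] (E →ₗ[B] F)) (e : E) (w : W) :
    pairing i e w = i w e := rfl

/-- A linear map `W → Hom(E, F)` is colinear if and only if the corresponding bilinear map is. -/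
lemma colinear_pairing_iff [LeftComodule A B] [RelHopfModule A B E] [RelHopfModule A B F]
    [Module.Finite B E] (i : W →ₗ[ℂ] (E →ₗ[B] F)) :
    (∀ w, homCoact A (i w) = i.lTensor A (coact A w)) ↔ Colinear A (pairing i) := by
  have h1 : ∀ w e, evalHom (i.lTensor A (coact A w)) e =
      (pairing i e).lTensor A (coact A w) := by
    intro w e
    generalize coact A w = t
    induction t with
    | zero => simp [evalHom]
    | add s t hs ht =>
      simp only [evalHom, map_add] at hs ht ⊢
      rw [hs, ht]
    | tmul a x => simp [evalHom]
  have h2 : ∀ w e, homCoactAt A (i w) e = antipodeCoact A ((pairing i).flip w) e :=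
    fun w e => rfl
  constructor
  · intro h
    refine colinear_of_antipodeCoact_flip fun e w => ?_
    rw [← h1, ← h2, ← h, evalHom_homCoact]
  · intro h w
    refine (existsUnique_homCoact (i w)).unique (evalHom_homCoact _) fun e => ?_
    rw [h1, h2, h.antipodeCoact_flip]

/-- The map `𝔖` twists the pairing. -/
lemma frakS_apply [LeftComodule A E] (γ : TwoCocycle A) (i : W →ₗ[ℂ] (E →ₗ[B] F))
    (hi : Colinear A (pairing i)) (w : W) (e : E) :
    γ.frakS (i w) e = γ.twist (pairing i) (e ⊗ₜ w) := by
  let M : A ⊗[ℂ] (A ⊗[ℂ] F) →ₗ[ℂ] F := (TensorProduct.lid ℂ F).toLinearMap ∘ₗ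
    γ.val.rTensor F ∘ₗ (TensorProduct.assoc ℂ A A F).symm.toLinearMap
  have h1 : γ.frakS (i w) e = M ((antipodeCoact A ((pairing i).flip w)).lTensor A (coact A e)) := by
    rw [lTensor_antipodeCoact]
    simp only [TwoCocycle.frakS, LinearMap.comp_apply]
    generalize coact A e = t
    induction t with
    | zero => simp
    | add s t hs ht => simp only [map_add, hs, ht]
    | tmul a e =>
      have h : coact A ((i w).restrictScalars ℂ e) = coact A ((pairing i).flip w e) := rfl
      simp only [TensorProduct.map_tmul, LinearMap.rTensor_tmul, LinearMap.comp_apply, h]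
      generalize comul (R := ℂ) a = s
      induction s with
      | zero => simp
      | add s s' hs hs' => simp only [TensorProduct.add_tmul, map_add, hs, hs']
      | tmul a b =>
        simp only [TensorProduct.assoc_tmul, LinearMap.lTensor_tmul, LinearMap.comp_apply,
          TensorProduct.map_tmul]
        generalize coact A ((pairing i).flip w e) = t
        induction t with
        | zero => simp
        | add s s' hs hs' => simp only [TensorProduct.tmul_add, map_add, hs, hs']
        | tmul c f => simp [M]
  rw [h1, twist_eq_act, act_apply, coact_tmul]
  generalize coact A e = t
  induction t with
  | zero => simp
  | add s t hs ht => simp only [map_add, TensorProduct.add_tmul, hs, ht]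
  | tmul a e =>
    rw [LinearMap.lTensor_tmul, hi.antipodeCoact_flip]
    generalize coact A w = t
    induction t with
    | zero => simp
    | add s s' hs hs' => simp only [TensorProduct.tmul_add, map_add, hs, hs']
    | tmul c f =>
      simp [M]

end Hom

/-! ### The form of a Hermitian metric and its dual basis -/

section Diagonal

variable {A : Type u} [Ring A] [HopfAlgebra ℂ A]

/-- The tensor product `X ⊗ Y` of two `A`-comodules, with the diagonal coaction of `A`. -/
def Diag (X Y : Type*) [AddCommGroup X] [Module ℂ X] [AddCommGroup Y] [Module ℂ Y] : Type _ :=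
  X ⊗[ℂ] Y

variable {X Y : Type*} [AddCommGroup X] [Module ℂ X] [AddCommGroup Y] [Module ℂ Y]

instance : AddCommGroup (Diag X Y) := inferInstanceAs (AddCommGroup (X ⊗[ℂ] Y))

instance : Module ℂ (Diag X Y) := inferInstanceAs (Module ℂ (X ⊗[ℂ] Y))

/-- The identity map from `X ⊗ Y` to the diagonal comodule. -/
def Diag.of : X ⊗[ℂ] Y ≃ₗ[ℂ] Diag X Y := LinearEquiv.refl ℂ _

variable [LeftCoaction A X] [LeftCoaction A Y]

instance : LeftCoaction A (Diag X Y) where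
  coaction := TensorProduct.map (LinearMap.mul' ℂ A) Diag.of.toLinearMap ∘ₗ
    coact (A ⊗[ℂ] A) ∘ₗ Diag.of.symm.toLinearMap

/-- The bilinear map `x, y ↦ x ⊗ y`. -/
def Diag.mk (X Y : Type*) [AddCommGroup X] [Module ℂ X] [AddCommGroup Y] [Module ℂ Y] :
    X →ₗ[ℂ] Y →ₗ[ℂ] Diag X Y :=
  (TensorProduct.mk ℂ X Y).compr₂ Diag.of.toLinearMap

lemma Diag.lift_mk : TensorProduct.lift (Diag.mk X Y) = Diag.of.toLinearMap := by
  ext x y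
  rfl

variable (A X Y) in
lemma Diag.colinear_mk : Colinear A (Diag.mk X Y) := by
  intro z
  rw [Diag.lift_mk]
  rfl

/-- The bilinear map `v, z ⊗ y ↦ ν(μ(v, z), y)`. -/
def Diag.assocMap {V W Z : Type*} [AddCommGroup V] [Module ℂ V] [AddCommGroup W] [Module ℂ W]
    [AddCommGroup Z] [Module ℂ Z] (μ : V →ₗ[ℂ] X →ₗ[ℂ] W) (ν : W →ₗ[ℂ] Y →ₗ[ℂ] Z) :
    V →ₗ[ℂ] Diag X Y →ₗ[ℂ] Z :=
  LinearMap.mk₂ ℂ (fun v t => TensorProduct.lift (ν ∘ₗ μ v) (Diag.of.symm t))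
    (fun v v' t => by
      generalize Diag.of.symm t = s
      induction s with
      | zero => simp
      | add s s' hs hs' =>
        simp only [map_add (TensorProduct.lift _), hs, hs']
        abel
      | tmul x y => simp)
    (fun c v t => by
      generalize Diag.of.symm t = s
      induction s with
      | zero => simp
      | add s s' hs hs' => simp only [map_add, hs, hs', smul_add]
      | tmul x y => simp)
    (by simp) (by simp)

@[simp] lemma Diag.assocMap_of {V W Z : Type*} [AddCommGroup V] [Module ℂ V] [AddCommGroup W]
    [Module ℂ W] [AddCommGroup Z] [Module ℂ Z] (μ : V →ₗ[ℂ] X →ₗ[ℂ] W) (ν : W →ₗ[ℂ] Y →ₗ[ℂ] Z)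
    (v : V) (x : X) (y : Y) : Diag.assocMap μ ν v (Diag.of (x ⊗ₜ y)) = ν (μ v x) y := rfl

lemma Diag.colinear_assocMap {V W Z : Type*} [AddCommGroup V] [Module ℂ V] [AddCommGroup W]
    [Module ℂ W] [AddCommGroup Z] [Module ℂ Z] [LeftCoaction A V] [LeftCoaction A W]
    [LeftCoaction A Z] {μ : V →ₗ[ℂ] X →ₗ[ℂ] W} {ν : W →ₗ[ℂ] Y →ₗ[ℂ] Z} (hμ : Colinear A μ)
    (hν : Colinear A ν) : Colinear A (Diag.assocMap μ ν) := by
  rw [colinear_iff_map₂] at hμ hν ⊢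
  intro v t
  obtain ⟨t, rfl⟩ := Diag.of.surjective t
  induction t with
  | zero => simp
  | add s s' hs hs' => simp only [map_add, hs, hs']
  | tmul x y =>
    have h : coact A (Diag.of (x ⊗ₜ[ℂ] y)) = TensorProduct.map (LinearMap.mul' ℂ A)
      Diag.of.toLinearMap (coact (A ⊗[ℂ] A) (x ⊗ₜ[ℂ] y)) := rfl
    rw [Diag.assocMap_of, hν, hμ, h, coact_tmul]
    generalize coact A v = s
    generalize coact A x = t
    generalize coact A y = r
    induction s with
    | zero => simp
    | add s s' hs hs' => simp only [map_add, hs, hs', LinearMap.add_apply]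
    | tmul a b =>
      induction t with
      | zero => simp
      | add t t' ht ht' =>
        simp only [TensorProduct.add_tmul, map_add, ht, ht', LinearMap.add_apply]
      | tmul c d =>
        induction r with
        | zero => simp
        | add r r' hr hr' => simp only [TensorProduct.tmul_add, map_add, hr, hr']
        | tmul e f => simp [mul_assoc]

end Diagonal

section BarActions

variable (B : Type v) (E : Type w)
  [Ring B] [Algebra ℂ B] [StarRing B] [StarModule ℂ B]
  [AddCommGroup E] [Module ℂ E] [Module B E] [Module Bᵐᵒᵖ E]
  [IsScalarTower ℂ B E] [IsScalarTower ℂ Bᵐᵒᵖ E]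

/-- The right action of `B` on `Ē` as a bilinear map. -/
def barRightAct : Bar E →ₗ[ℂ] B →ₗ[ℂ] Bar E :=
  LinearMap.mk₂ ℂ (fun z b => op b • z) (by simp)
    (fun c z b => by
      obtain ⟨e, rfl⟩ := Bar.mk.surjective z
      simp only [Bar.smul_mk, Bar.op_smul_mk]
      rw [← algebraMap_smul B (conj c) e, ← algebraMap_smul B (conj c) (star b • e), smul_smul,
        smul_smul, Algebra.commutes])
    (by simp [add_smul])
    (fun c z b => by
      obtain ⟨e, rfl⟩ := Bar.mk.surjective z
      simp only [Bar.smul_mk, Bar.op_smul_mk, star_smul, smul_assoc]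
      rfl)

/-- The left action of `B` on `Ē` as a bilinear map. -/
def barLeftAct : B →ₗ[ℂ] Bar E →ₗ[ℂ] Bar E :=
  LinearMap.mk₂ ℂ (fun b z => b • z) (by simp [add_smul])
    (fun c b z => by
      obtain ⟨e, rfl⟩ := Bar.mk.surjective z
      simp [Bar.smul_mk, Bar.smul_mk'])
    (by simp)
    (fun c b z => by
      obtain ⟨e, rfl⟩ := Bar.mk.surjective z
      simp only [Bar.smul_mk, Bar.smul_mk']
      rw [← algebraMap_smul Bᵐᵒᵖ (conj c) e, ← algebraMap_smul Bᵐᵒᵖ (conj c) (op (star b) • e),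
        smul_smul, smul_smul, Algebra.commutes])

@[simp] lemma barRightAct_apply (z : Bar E) (b : B) : barRightAct B E z b = op b • z := rfl

@[simp] lemma barLeftAct_apply (b : B) (z : Bar E) : barLeftAct B E b z = b • z := rfl

end BarActions

section Metric

variable {A : Type u} {B : Type v} {E : Type w}
    [Ring A] [HopfAlgebra ℂ A] [StarRing A] [StarModule ℂ A] [HopfStarAlgebra A]
    [Ring B] [Algebra ℂ B] [StarRing B] [StarModule ℂ B] [LeftCoaction A B]
    [ComoduleStarAlgebra A B]
    [AddCommGroup E] [Module ℂ E] [Module B E] [Module Bᵐᵒᵖ E] [SMulCommClass B Bᵐᵒᵖ E]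
    [IsScalarTower ℂ B E] [IsScalarTower ℂ Bᵐᵒᵖ E] [LeftCoaction A E] [RelHopfModule A B E]


variable (A B E) in
lemma colinear_barRightAct : Colinear A (barRightAct B E) := by
  rw [colinear_iff_map₂]
  intro z b
  obtain ⟨e, rfl⟩ := Bar.mk.surjective z
  have h : coact A b = star (coact A (star b)) := by
    rw [← ComoduleStarAlgebra.coact_star, star_star]
  rw [barRightAct_apply, Bar.op_smul_mk, coact_mk, coact_mk, RelHopfModule.coact_smul, h]
  generalize coact A e = s
  generalize coact A (star b) = t
  induction s with
  | zero => simp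
  | add s s' hs hs' => simp only [map_add, hs, hs', LinearMap.add_apply]
  | tmul a b =>
    induction t with
    | zero => simp
    | add t t' ht ht' => simp only [map_add, star_add, ht, ht', LinearMap.add_apply]
    | tmul c d => simp [-op_star, Bar.op_smul_mk]

variable (A B E) in
lemma colinear_barLeftAct : Colinear A (barLeftAct B E) := by
  rw [colinear_iff_map₂]
  intro b z
  obtain ⟨e, rfl⟩ := Bar.mk.surjective z
  have h : coact A b = star (coact A (star b)) := by
    rw [← ComoduleStarAlgebra.coact_star, star_star]
  rw [barLeftAct_apply, Bar.smul_mk', coact_mk, coact_mk, RelHopfModule.coact_op_smul, h]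
  generalize coact A e = s
  generalize coact A (star b) = t
  induction s with
  | zero => simp
  | add s s' hs hs' => simp only [map_add, hs, hs', LinearMap.add_apply]
  | tmul a b =>
    induction t with
    | zero => simp
    | add t t' ht ht' => simp only [map_add, star_add, ht, ht', LinearMap.add_apply]
    | tmul c d => simp [Bar.smul_mk']

variable [Module.Finite B E] [Module.Projective B E] (𝔥 : HermitianMetric A B E)

namespace HermitianMetric

/-- The bilinear form `⟨e, z⟩` of a Hermitian metric, for `e` in `E` and `z` in `Ē`. -/
def form : E →ₗ[ℂ] Bar E →ₗ[ℂ] B := pairing 𝔥.iso.toLinearMap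

lemma form_apply (e : E) (z : Bar E) : 𝔥.form e z = 𝔥.iso z e := rfl

lemma colinear_form : Colinear A 𝔥.form :=
  (colinear_pairing_iff 𝔥.iso.toLinearMap).1 𝔥.covariant

lemma form_smul (b : B) (e : E) (z : Bar E) : 𝔥.form (b • e) z = b * 𝔥.form e z :=
  (𝔥.iso z).map_smul b e

lemma form_op_smul (b : B) (e : E) (z : Bar E) : 𝔥.form (op b • e) z = 𝔥.form e (b • z) :=
  congr($(𝔥.map_smul b z) e).symm

lemma form_right (b : B) (e : E) (z : Bar E) : 𝔥.form e (op b • z) = 𝔥.form e z * b :=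
  congr($(𝔥.map_op_smul b z) e)

lemma star_form (x y : E) : star (𝔥.form y (Bar.mk x)) = 𝔥.form x (Bar.mk y) :=
  𝔥.star_inner x y

lemma frakS_iso (γ : TwoCocycle A) (z : Bar E) (e : E) :
    γ.frakS (𝔥.iso z) e = γ.twist 𝔥.form (e ⊗ₜ z) :=
  frakS_apply γ 𝔥.iso.toLinearMap 𝔥.colinear_form z e

/-- The functionals of a dual basis of `E` are of the form `⟨·, z⟩`, since the metric is an
isomorphism. -/
lemma exists_dual_basis : ∃ T : Bar E ⊗[ℂ] E, ∀ v : E,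
    TensorProduct.lift (leftAct B E ∘ₗ 𝔥.form v) T = v := by
  obtain ⟨n, f, g, -, -, hfg⟩ := Module.Finite.exists_comp_eq_id_of_projective B E
  refine ⟨∑ i, 𝔥.iso.symm (LinearMap.proj i ∘ₗ g) ⊗ₜ f (Pi.single i 1), fun v => ?_⟩
  have h := congr($hfg v)
  rw [LinearMap.comp_apply, LinearMap.id_apply] at h
  conv_rhs => rw [← h, pi_eq_sum_univ' (g v)]
  simp [form_apply, map_sum]

/-- If `T` is the tensor of a dual basis of `E`, then the action of `γ⁻¹` on `T` gives a dual basis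
for the deformed form: by `twist_assoc`, the two actions of the cocycle on `T` cancel. -/
lemma exists_dual_basis_twist (γ : TwoCocycle A) : ∃ s : Finset (Bar E × E), ∀ v : E,
    ∑ p ∈ s, γ.twist (leftAct B E) (γ.twist 𝔥.form (v ⊗ₜ p.1) ⊗ₜ p.2) = v := by
  obtain ⟨T, hT⟩ := 𝔥.exists_dual_basis
  have h1 : ∀ v, γ.twist (Diag.assocMap 𝔥.form (leftAct B E)) (v ⊗ₜ Diag.of T) = v :=
    twist_eq_of_forall γ (Diag.colinear_assocMap 𝔥.colinear_form (colinear_leftAct A B E))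
      (f := LinearMap.id) colinearMap_id hT
  have h2 : γ.twist (Diag.mk (Bar E) E) (act γ.fnInv LinearMap.id T) = Diag.of T := by
    rw [twist_eq_act, apply_act, LinearMap.comp_id, act_act, γ.fnInv_mul_fn, act_one, Diag.lift_mk]
    rfl
  have h3 : ∀ (v : E) (t : Bar E ⊗[ℂ] E), γ.twist (leftAct B E) (TensorProduct.map
      (γ.twist 𝔥.form) LinearMap.id ((TensorProduct.assoc ℂ E (Bar E) E).symm (v ⊗ₜ t))) =
      γ.twist (Diag.assocMap 𝔥.form (leftAct B E)) (v ⊗ₜ γ.twist (Diag.mk (Bar E) E) t) := by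
    intro v t
    induction t with
    | zero => simp
    | add s t hs ht => simp only [TensorProduct.tmul_add, map_add, hs, ht]
    | tmul z e =>
      exact twist_assoc γ 𝔥.colinear_form (Diag.colinear_mk A (Bar E) E) (fun _ _ _ => rfl) v z e
  obtain ⟨s, hs⟩ := TensorProduct.exists_finset (act γ.fnInv LinearMap.id T)
  refine ⟨s, fun v => ?_⟩
  have h4 := h3 v (act γ.fnInv LinearMap.id T)
  rw [h2, h1, hs] at h4
  simpa [TensorProduct.tmul_sum] using h4

end HermitianMetric

end Metric

/-! ### Compatibility of `𝔑` with the bimodule structures -/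

section Metric

variable {A : Type u} {B : Type v} {E : Type w}
    [Ring A] [HopfAlgebra ℂ A] [StarRing A] [StarModule ℂ A] [HopfStarAlgebra A]
    [Ring B] [Algebra ℂ B] [StarRing B] [StarModule ℂ B] [LeftCoaction A B]
    [ComoduleStarAlgebra A B]
    [AddCommGroup E] [Module ℂ E] [Module B E] [Module Bᵐᵒᵖ E] [SMulCommClass B Bᵐᵒᵖ E]
    [IsScalarTower ℂ B E] [IsScalarTower ℂ Bᵐᵒᵖ E] [LeftCoaction A E] [RelHopfModule A B E]
    {γ : TwoCocycle A} {Aγ : TwistedHopf γ} {Bγ : TwistedAlgebra Aγ B}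

/-- The identification of the conjugate of `X̄` with `X`. -/
def barBar (X : Type*) [AddCommGroup X] [Module ℂ X] : Bar (Bar X) →ₗ[ℂ] X where
  toFun z := Bar.out (Bar.out z)
  map_add' := by simp
  map_smul' c z := by
    obtain ⟨z, rfl⟩ := Bar.mk.surjective z
    obtain ⟨z, rfl⟩ := Bar.mk.surjective z
    simp [Bar.smul_mk]

@[simp] lemma barBar_mk {X : Type*} [AddCommGroup X] [Module ℂ X] (z : Bar X) :
    barBar X (Bar.mk z) = Bar.out z := rfl

lemma colinearMap_barBar (A : Type u) [Ring A] [HopfAlgebra ℂ A] [StarRing A] [StarModule ℂ A]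
    (X : Type*) [AddCommGroup X] [Module ℂ X] [LeftCoaction A X] : ColinearMap A (barBar X) := by
  intro z
  obtain ⟨z, rfl⟩ := Bar.mk.surjective z
  obtain ⟨x, rfl⟩ := Bar.mk.surjective z
  rw [barBar_mk, coact_mk, coact_mk, Bar.out_mk]
  generalize coact A x = t
  induction t with
  | zero => simp
  | add t t' ht ht' => simp only [map_add, ht.symm, ht'.symm]
  | tmul a x => simp

/-- `𝔑` intertwines the right action on the conjugate of `Γ(E)` with the deformed right action on
`Ē`. -/
lemma TwoCocycle.IsUnitary.frakN_op_smul (hγ : γ.IsUnitary) (b : B) (e : E) :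
    γ.frakN (Bar.mk (γ.twist (leftAct B E) (γ.starAlg b ⊗ₜ e))) =
      γ.twist (barRightAct B E) (γ.frakN (Bar.mk e) ⊗ₜ b) := by
  have h := hγ.apply_frakN_mk_twist (colinear_leftAct A B E) (μ' := barRightAct B E)
    (colinearMap_starBar A B) (colinearMap_id (X := Bar E)) (k := LinearMap.id)
    (fun b e => by simp [-op_star, Bar.op_smul_mk]) (γ.starAlg b) e
  rw [← starAlg_eq, hγ.starAlg_starAlg] at h
  exact h

/-- `𝔑` intertwines the left action on the conjugate of `Γ(E)` with the deformed left action on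
`Ē`. -/
lemma TwoCocycle.IsUnitary.frakN_smul (hγ : γ.IsUnitary) (b : B) (e : E) :
    γ.frakN (Bar.mk (γ.twist (rightAct B E) (e ⊗ₜ γ.starAlg b))) =
      γ.twist (barLeftAct B E) (b ⊗ₜ γ.frakN (Bar.mk e)) := by
  have h := hγ.apply_frakN_mk_twist (colinear_rightAct A B E) (μ' := barLeftAct B E)
    (colinearMap_id (X := Bar E)) (colinearMap_starBar A B) (k := LinearMap.id)
    (fun b e => by simp [Bar.smul_mk']) e (γ.starAlg b)
  rw [← starAlg_eq, hγ.starAlg_starAlg] at h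
  exact h

/-- The map `𝔑`, as a linear isomorphism from the conjugate of `Γ(E)` onto `Ē`. Its inverse is
given by the action of `V`, as `V * V̄ = 1 = V̄ * V`. -/
def frakNEquiv (ΓE : TwistedModule Bγ E) : Bar ΓE.carrier ≃ₗ[ℂ] Bar E where
  toFun z := γ.frakN (Bar.mk (ΓE.of.symm (Bar.out z)))
  invFun w := Bar.mk (ΓE.of (Bar.out (contract γ.V w)))
  map_add' := by simp [TwoCocycle.frakN]
  map_smul' c z := by
    obtain ⟨x, rfl⟩ := Bar.mk.surjective z
    have h : Bar.mk (ΓE.of.symm (conj c • x)) = c • Bar.mk (ΓE.of.symm x) := by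
      rw [Bar.smul_mk, map_smul]
    rw [Bar.smul_mk, Bar.out_mk, Bar.out_mk, h, TwoCocycle.frakN, map_smul, TwoCocycle.frakN,
      RingHom.id_apply]
  left_inv z := by
    obtain ⟨x, rfl⟩ := Bar.mk.surjective z
    have h := contract_contract γ.fnVbar_mul_fnV (Bar.mk (ΓE.of.symm x))
    change contract γ.V (γ.frakN (Bar.mk (ΓE.of.symm x))) = _ at h
    simp [h]
  right_inv w := by
    have h : contract γ.Vbar (contract γ.V w) = w := contract_contract γ.fnV_mul_fnVbar w
    simpa [TwoCocycle.frakN] using h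

@[simp] lemma frakNEquiv_mk (ΓE : TwistedModule Bγ E) (x : E) :
    frakNEquiv ΓE (Bar.mk (ΓE.of x)) = γ.frakN (Bar.mk x) := by
  change γ.frakN (Bar.mk (ΓE.of.symm (ΓE.of x))) = _
  rw [LinearEquiv.symm_apply_apply]

lemma coact_frakNEquiv (ΓE : TwistedModule Bγ E) (z : Bar ΓE.carrier) :
    TensorProduct.map Aγ.of.toLinearMap LinearMap.id (coact A (frakNEquiv ΓE z)) =
      (frakNEquiv ΓE).toLinearMap.lTensor Aγ.carrier (coact Aγ.carrier z) := by
  obtain ⟨x, rfl⟩ := Bar.mk.surjective z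
  obtain ⟨x, rfl⟩ := ΓE.of.surjective x
  rw [frakNEquiv_mk, TwoCocycle.frakN, coact_contract_Vbar, coact_mk, coact_mk, ΓE.coact_of]
  generalize coact A x = t
  induction t with
  | zero => simp
  | add t t' ht ht' => simp only [map_add, ht, ht']
  | tmul a x =>
    simp [Aγ.star_of]
    rfl

/-! ### The deformed metric -/

variable [Module.Finite B E] [Module.Projective B E] (𝔥 : HermitianMetric A B E)
  (ΓE : TwistedModule Bγ E)

namespace HermitianMetric

/-- The functional `y ↦ γ(y₍₋₁₎ ⊗ z₍₋₁₎) ⟨y₍₀₎, z₍₀₎⟩` on `Γ(E)`. -/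
def twistHom (z : Bar E) : ΓE.carrier →ₗ[Bγ.carrier] Bγ.carrier where
  toFun y := Bγ.of (γ.twist 𝔥.form (ΓE.of.symm y ⊗ₜ z))
  map_add' := by simp [TensorProduct.add_tmul]
  map_smul' b y := by
    obtain ⟨b, rfl⟩ := Bγ.of.surjective b
    obtain ⟨y, rfl⟩ := ΓE.of.surjective y
    rw [ΓE.smul_of, LinearEquiv.symm_apply_apply, LinearEquiv.symm_apply_apply, RingHom.id_apply,
      smul_eq_mul, Bγ.mul_of]
    congr 1
    exact twist_assoc γ (colinear_leftAct A B E) 𝔥.colinear_form (μ' := LinearMap.mul ℂ B)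
      (fun b e z => 𝔥.form_smul b e z) b y z

@[simp] lemma twistHom_of (z : Bar E) (y : E) :
    𝔥.twistHom ΓE z (ΓE.of y) = Bγ.of (γ.twist 𝔥.form (y ⊗ₜ z)) := by
  simp [twistHom]

/-- A dual basis of the deformed module whose functionals come from the deformed form. -/
lemma exists_dual_basis_carrier : ∃ s : Finset (Bar E × E), ∀ y : ΓE.carrier,
    ∑ p ∈ s, 𝔥.twistHom ΓE p.1 y • ΓE.of p.2 = y := by
  obtain ⟨s, hs⟩ := 𝔥.exists_dual_basis_twist γ
  refine ⟨s, fun y => ?_⟩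
  obtain ⟨y, rfl⟩ := ΓE.of.surjective y
  conv_rhs => rw [← hs y]
  simp [ΓE.smul_of]

lemma finite_projective_carrier (𝔥 : HermitianMetric A B E) (ΓE : TwistedModule Bγ E) :
    Module.Finite Bγ.carrier ΓE.carrier ∧ Module.Projective Bγ.carrier ΓE.carrier := by
  obtain ⟨s, hs⟩ := 𝔥.exists_dual_basis_carrier ΓE
  let g : ΓE.carrier →ₗ[Bγ.carrier] (s → Bγ.carrier) :=
    LinearMap.pi fun p => 𝔥.twistHom ΓE p.1.1
  let f : (s → Bγ.carrier) →ₗ[Bγ.carrier] ΓE.carrier :=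
    Fintype.linearCombination Bγ.carrier fun p : s => ΓE.of p.1.2
  have h : f ∘ₗ g = LinearMap.id := by
    ext y
    simp only [f, g, LinearMap.comp_apply, Fintype.linearCombination_apply, LinearMap.pi_apply,
      LinearMap.id_apply]
    rw [Finset.sum_coe_sort s fun p => 𝔥.twistHom ΓE p.1 y • ΓE.of p.2, hs]
  exact ⟨Module.Finite.of_surjective f fun y => ⟨g y, congr($h y)⟩,
      Module.Projective.of_split g f h⟩

lemma twistHom_op_smul (z : Bar E) (b : B) :
    𝔥.twistHom ΓE (γ.twist (barRightAct B E) (z ⊗ₜ b)) =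
      homOpSMul (𝔥.twistHom ΓE z) (Bγ.of b) := by
  ext y
  obtain ⟨y, rfl⟩ := ΓE.of.surjective y
  change _ = op (Bγ.of b) • 𝔥.twistHom ΓE z (ΓE.of y)
  rw [twistHom_of, twistHom_of, op_smul_eq_mul, Bγ.mul_of]
  congr 1
  exact (twist_assoc γ 𝔥.colinear_form (colinear_barRightAct A B E) (μ := LinearMap.mul ℂ B)
    (fun e z b => (𝔥.form_right b e z).symm) y z b).symm

lemma twistHom_smul (z : Bar E) (b : B) :
    𝔥.twistHom ΓE (γ.twist (barLeftAct B E) (b ⊗ₜ z)) = homSMul (Bγ.of b) (𝔥.twistHom ΓE z) := by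
  ext y
  obtain ⟨y, rfl⟩ := ΓE.of.surjective y
  change _ = 𝔥.twistHom ΓE z (op (Bγ.of b) • ΓE.of y)
  rw [twistHom_of, ΓE.op_smul_of, twistHom_of]
  congr 1
  exact (twist_assoc γ (colinear_rightAct A B E) (colinear_barLeftAct A B E) (μ := 𝔥.form)
    (fun e b z => 𝔥.form_op_smul b e z) y b z).symm

/-- The form on the deformed objects, before the identification of conjugates by `𝔑`. -/
def twistHomLinear : Bar E →ₗ[ℂ] (ΓE.carrier →ₗ[Bγ.carrier] Bγ.carrier) where
  toFun := 𝔥.twistHom ΓE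
  map_add' z z' := by
    ext y
    simp [twistHom, TensorProduct.tmul_add]
  map_smul' c z := by
    ext y
    simp [twistHom]

lemma surjective_twistHomLinear : Function.Surjective (𝔥.twistHomLinear ΓE) := by
  intro g
  obtain ⟨s, hs⟩ := 𝔥.exists_dual_basis_carrier ΓE
  -- expand `g(y)` in the dual basis and move the values `g(e)` into the second slot of the form
  refine ⟨∑ p ∈ s, γ.twist (barRightAct B E) (p.1 ⊗ₜ Bγ.of.symm (g (ΓE.of p.2))), ?_⟩
  ext y
  conv_rhs => rw [← hs y, map_sum]
  rw [map_sum, LinearMap.sum_apply]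
  refine Finset.sum_congr rfl fun p _ => ?_
  change 𝔥.twistHom ΓE _ y = _
  rw [twistHom_op_smul, _root_.map_smul, LinearEquiv.apply_symm_apply]
  rfl

/-- If the deformed form vanishes at `z`, then by colinearity it vanishes at `z₍₀₎` in
`z₍₋₁₎ ⊗ z₍₀₎`, and twisting back by `γ⁻¹` shows that the form itself vanishes at `z`. -/
lemma injective_twistHomLinear : Function.Injective (𝔥.twistHomLinear ΓE) := by
  rw [injective_iff_map_eq_zero]
  intro z hz
  -- view `Ē` as a comodule over `A_γ`, for which the deformed form is colinear
  let P : ΓE.carrier →ₗ[ℂ] Twisted γ (Bar E) →ₗ[ℂ] Bγ.carrier :=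
    pairing (𝔥.twistHomLinear ΓE ∘ₗ Twisted.of.symm.toLinearMap)
  have hP : ∀ y z, P (ΓE.of y) (Twisted.of z) = Bγ.of (γ.twist 𝔥.form (y ⊗ₜ z)) :=
    fun y z => 𝔥.twistHom_of ΓE z y
  have hcol : Colinear Aγ.carrier P := by
    rw [colinear_iff_map₂]
    intro y z
    obtain ⟨y, rfl⟩ := ΓE.of.surjective y
    obtain ⟨z, rfl⟩ := Twisted.of.surjective z
    rw [hP, Bγ.coact_of, coact_twist γ 𝔥.colinear_form, ΓE.coact_of, Twisted.coact_of, coact_tmul]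
    generalize coact A y = s
    generalize coact A z = t
    induction s with
    | zero => simp
    | add s s' hs hs' => simp only [TensorProduct.add_tmul, map_add, hs, hs', LinearMap.add_apply]
    | tmul a b =>
      induction t with
      | zero => simp
      | add t t' ht ht' => simp only [TensorProduct.tmul_add, map_add, ht, ht']
      | tmul c d => simp [hP, Aγ.mul_of]
  have h0 : P.flip (Twisted.of z) = 0 := by
    ext y
    exact congr($hz y)
  have h1 : ∀ y, (P (ΓE.of y)).lTensor Aγ.carrier (coact Aγ.carrier (Twisted.of z)) = 0 := by
    intro y
    rw [← hcol.antipodeCoact_flip, h0]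
    simp [antipodeCoact]
  have h2 : ∀ y, (γ.twist 𝔥.form ∘ₗ TensorProduct.mk ℂ E (Bar E) y).lTensor A (coact A z) = 0 := by
    intro y
    refine (TensorProduct.congr Aγ.of Bγ.of).injective ?_
    rw [map_zero, ← h1 y, Twisted.coact_of]
    generalize coact A z = t
    induction t with
    | zero => simp
    | add t t' ht ht' => simp only [map_add, ht, ht']
    | tmul c d => simp [hP]
  have h3 : 𝔥.iso z = 0 := by
    ext y
    exact apply_eq_zero_of_twist γ 𝔥.form h2 y
  exact 𝔥.iso.injective (h3.trans (map_zero _).symm)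

/-- The deformed metric `𝔖 ∘ Γ(𝔥) ∘ 𝔑`. -/
def twist (hγ : γ.IsUnitary) (ΓE : TwistedModule Bγ E) [Module.Finite Bγ.carrier ΓE.carrier]
    [Module.Projective Bγ.carrier ΓE.carrier] :
    HermitianMetric Aγ.carrier Bγ.carrier ΓE.carrier where
  iso := frakNEquiv ΓE ≪≫ₗ LinearEquiv.ofBijective (𝔥.twistHomLinear ΓE)
    ⟨𝔥.injective_twistHomLinear ΓE, 𝔥.surjective_twistHomLinear ΓE⟩
  map_smul b z := by
    obtain ⟨b, rfl⟩ := Bγ.of.surjective b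
    obtain ⟨x, rfl⟩ := Bar.mk.surjective z
    obtain ⟨x, rfl⟩ := ΓE.of.surjective x
    rw [Bar.smul_mk', Bγ.star_of, ΓE.op_smul_of]
    change 𝔥.twistHom ΓE (frakNEquiv ΓE _) =
      homSMul (Bγ.of b) (𝔥.twistHom ΓE (frakNEquiv ΓE _))
    rw [frakNEquiv_mk, frakNEquiv_mk, hγ.frakN_smul, twistHom_smul]
  map_op_smul b z := by
    obtain ⟨b, rfl⟩ := Bγ.of.surjective b
    obtain ⟨x, rfl⟩ := Bar.mk.surjective z
    obtain ⟨x, rfl⟩ := ΓE.of.surjective x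
    rw [Bar.op_smul_mk, Bγ.star_of, ΓE.smul_of]
    change 𝔥.twistHom ΓE (frakNEquiv ΓE _) =
      homOpSMul (𝔥.twistHom ΓE (frakNEquiv ΓE _)) (Bγ.of b)
    rw [frakNEquiv_mk, frakNEquiv_mk, hγ.frakN_op_smul, twistHom_op_smul]
  covariant := by
    refine (colinear_pairing_iff (frakNEquiv ΓE ≪≫ₗ LinearEquiv.ofBijective
      (𝔥.twistHomLinear ΓE) ⟨𝔥.injective_twistHomLinear ΓE,
        𝔥.surjective_twistHomLinear ΓE⟩).toLinearMap).2 ?_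
    rw [colinear_iff_map₂]
    intro y z
    obtain ⟨y, rfl⟩ := ΓE.of.surjective y
    change coact Aγ.carrier (𝔥.twistHom ΓE (frakNEquiv ΓE z) (ΓE.of y)) =
      TensorProduct.map₂ _ (pairing (𝔥.twistHomLinear ΓE ∘ₗ (frakNEquiv ΓE).toLinearMap)) _ _
    have h1 : ∀ (s : Aγ.carrier ⊗[ℂ] ΓE.carrier) t, TensorProduct.map₂ (LinearMap.mul ℂ Aγ.carrier)
        (pairing (𝔥.twistHomLinear ΓE ∘ₗ (frakNEquiv ΓE).toLinearMap)) s t =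
        TensorProduct.map₂ (LinearMap.mul ℂ Aγ.carrier) (pairing (𝔥.twistHomLinear ΓE)) s
          ((frakNEquiv ΓE).toLinearMap.lTensor Aγ.carrier t) := by
      intro s t
      induction s with
      | zero => simp
      | add s s' hs hs' => simp only [map_add, hs, hs', LinearMap.add_apply]
      | tmul a b =>
        induction t with
        | zero => simp
        | add t t' ht ht' => simp only [map_add, ht, ht']
        | tmul c d => simp
    rw [h1, ← coact_frakNEquiv, twistHom_of, Bγ.coact_of, coact_twist γ 𝔥.colinear_form,
      ΓE.coact_of, coact_tmul]
    generalize coact A y = s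
    generalize coact A (frakNEquiv ΓE z) = t
    induction s with
    | zero => simp
    | add s s' hs hs' => simp only [TensorProduct.add_tmul, map_add, hs, hs', LinearMap.add_apply]
    | tmul a b =>
      induction t with
      | zero => simp
      | add t t' ht ht' => simp only [TensorProduct.tmul_add, map_add, ht, ht']
      | tmul c d =>
        have h2 : 𝔥.twistHomLinear ΓE d (ΓE.of b) = _ := 𝔥.twistHom_of ΓE d b
        simp [h2, Aγ.mul_of]
  star_inner x y := by
    obtain ⟨x, rfl⟩ := ΓE.of.surjective x
    obtain ⟨y, rfl⟩ := ΓE.of.surjective y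
    change star (𝔥.twistHom ΓE (frakNEquiv ΓE _) _) = 𝔥.twistHom ΓE (frakNEquiv ΓE _) _
    rw [frakNEquiv_mk, frakNEquiv_mk, twistHom_of, twistHom_of, Bγ.star_of, starAlg_eq]
    congr 1
    rw [hγ.apply_frakN_mk_twist 𝔥.colinear_form (colinearMap_id (X := Bar E))
      (colinearMap_barBar A E) (μ' := 𝔥.form) (fun x z => ?_)]
    · congr 2
      rw [hγ.frakN_mk, barBar_mk]
      have h := contract_contract γ.fnVbar_mul_fnV (Bar.mk x)
      exact congr(Bar.out $h)
    · obtain ⟨z, rfl⟩ := Bar.mk.surjective z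
      exact 𝔥.star_form z x

@[simp] lemma twist_iso (hγ : γ.IsUnitary) (ΓE : TwistedModule Bγ E)
    [Module.Finite Bγ.carrier ΓE.carrier] [Module.Projective Bγ.carrier ΓE.carrier] (x y : E) :
    (𝔥.twist hγ ΓE).iso (Bar.mk (ΓE.of x)) (ΓE.of y) =
      Bγ.of (γ.frakS (𝔥.iso (γ.frakN (Bar.mk x))) y) := by
  rw [frakS_iso]
  change 𝔥.twistHom ΓE (frakNEquiv ΓE _) _ = _
  rw [frakNEquiv_mk, twistHom_of]

end HermitianMetric

end Metric

end RelHopf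

end

open RelHopf in
theorem mainTheorem3 {A : Type u} {B : Type v} {E : Type w}
    [Ring A] [HopfAlgebra ℂ A] [StarRing A] [StarModule ℂ A] [HopfStarAlgebra A]
    [Ring B] [Algebra ℂ B] [StarRing B] [StarModule ℂ B] [LeftCoaction A B]
    [ComoduleStarAlgebra A B]
    [AddCommGroup E] [Module ℂ E] [Module B E] [Module Bᵐᵒᵖ E] [SMulCommClass B Bᵐᵒᵖ E]
    [IsScalarTower ℂ B E] [IsScalarTower ℂ Bᵐᵒᵖ E] [LeftCoaction A E] [RelHopfModule A B E]
    [Module.Finite B E] [Module.Projective B E]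
    (𝔥 : HermitianMetric A B E) (γ : TwoCocycle A) (hγ : γ.IsUnitary) :
    ∃ (Aγ : TwistedHopf γ) (Bγ : TwistedAlgebra Aγ B) (ΓE : TwistedModule Bγ E)
      (_ : Module.Finite Bγ.carrier ΓE.carrier) (_ : Module.Projective Bγ.carrier ΓE.carrier)
      (𝔥γ : HermitianMetric Aγ.carrier Bγ.carrier ΓE.carrier),
      ∀ x y : E, 𝔥γ.iso (Bar.mk (ΓE.of x)) (ΓE.of y) =
        Bγ.of (γ.frakS (𝔥.iso (γ.frakN (Bar.mk x))) y) := by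
  let Aγ := twistedHopf hγ
  let Bγ := twistedAlgebra Aγ B hγ
  let ΓE := twistedModule Bγ E
  obtain ⟨hf, hp⟩ := 𝔥.finite_projective_carrier ΓE
  exact ⟨Aγ, Bγ, ΓE, hf, hp, 𝔥.twist hγ ΓE, 𝔥.twist_iso hγ ΓE⟩
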